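/- For an open set $\Omega\subset\mathbb C$ let $A^2(\Omega)$ be the Bergman space, i.e. the closed subspace of analytic functions in $L^2(\Omega)$ (area measure), $P_\Omega:L^2(\Omega)\to A^2(\Omega)$ the orthogonal projection, and, for $a\in L^\infty(\Omega)$, $T_a:A^2(\Omega)\to A^2(\Omega)$, $T_af=P_\Omega(af)$, the Toeplitz operator. The essential spectrum $\sigma_{\rm ess}(T)$ of a bounded operator $T$ is the set of $\mu\in\mathbb C$ such that $T-\mu$ is not Fredholm. Write $B(x,r)$ for the open disc in $\mathbb C$ with centre $x$ and radius $r$, and $\mathbb D=B(0,1)$. **Theorem.** Let $b\in L^\infty(\mathbb D)$ be real-valued with support in $\{|z|<R\}$ for some $R<1$. Then $T_b:A^2(\mathbb D)\to A^2(\mathbb D)$ is compact and self-adjoint. Its nonzero eigenvalues, each repeated according to its multiplicity, can be listed as $\lambda_1,\lambda_2,\dots\in\mathbb R$ with $|\lambda_1|\ge|\lambda_2|\ge\cdots$ (a finite list being continued by zeros), and for every such list the spectrum of $T_b$ is $\{0\}\cup\bigcup_{n\ge1}\{\lambda_n\}$. Fix $R_0\in(\frac14,\frac12)$. For $0<h\le\frac1{10}$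 let $$\varpi_h=\{|z|<R_0\}\cup\{|\operatorname{Re}z|<\tfrac12,\ -h<\operatorname{Im}z<h\},\qquad \Pi_h=\operatorname{int}\bigcup_{m\in\mathbb Z}\overline{\varpi_h+m},$$ and let $\mathsf a$ be the $1$-periodic function with $\mathsf a(z)=b\big((z-m)/R_0\big)$ if $|z-m|<R_0$ for some $m\in\mathbb Z$, and $\mathsf a(z)=0$ otherwise. Let $(\lambda_n)$ be a list as above, and let $N\ge1$ and $\delta>0$ be such that $|\lambda_N|>|\lambda_{N+1}|+2\delta$. Then there is $\varepsilon_0>0$ such that for every $\varepsilon\in(0,\varepsilon_0)$ there is $h\in(0,\frac1{10}]$ with the following properties. * $\varpi_h$ is a periodic cell: it is a bounded simply connected domain in the strip $|\operatorname{Re}z|<\frac12$, its boundary is a closed Lipschitz curve (a bi-Lipschitz image of the unit circle), and for some $c<d$ this boundary meets each line $\operatorname{Re}z=\pm\frac12$ exactly in the segment $\{\pm\frac12\}\times[c,d]$. The periodic domain $\Pi_h$ is simply connected, and $\mathsf a\in L^\infty(\Pi_h)$. * For the Toeplitz operator $T_{\mathsf a}:A^2(\Pi_h)\to A^2(\Pi_h)$,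 $$\sigma_{\rm ess}(T_{\mathsf a})\cap B(\lambda_n,\varepsilon)\ne\emptyset\qquad\text{for all } n\le N .$$ * With $G_\varepsilon=\bigcup_{n\le N}B(\lambda_n,\varepsilon)$, $$\operatorname{dist}\big(\sigma_{\rm ess}(T_{\mathsf a})\cap G_\varepsilon,\ \sigma_{\rm ess}(T_{\mathsf a})\setminus G_\varepsilon\big)\ge\delta ,$$ that is, $|x-y|\ge\delta$ for all $x$ in the first set and all $y$ in the second. -/

import Mathlib

open MeasureTheory Metric Set Filter Topology
open scoped ENNReal Real

noncomputable section

/-! ### The Bergman space of an open subset of the plane -/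

/-- `L²(Ω)` with respect to the area measure. -/
abbrev L2 (Ω : TopologicalSpace.Opens ℂ) : Type :=
  Lp ℂ 2 (volume.restrict (Ω : Set ℂ))

/-- The Bergman space `A²(Ω)`: the elements of `L²(Ω)` that are represented by a function
analytic in `Ω`. -/
def bergman (Ω : TopologicalSpace.Opens ℂ) : Submodule ℂ (L2 Ω) where
  carrier := {f | ∃ g : ℂ → ℂ, DifferentiableOn ℂ g Ω ∧ f =ᵐ[volume.restrict (Ω : Set ℂ)] g}
  zero_mem' := ⟨fun _ => 0, differentiableOn_const 0, Lp.coeFn_zero ..⟩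
  add_mem' := by
    rintro f₁ f₂ ⟨g₁, h₁, e₁⟩ ⟨g₂, h₂, e₂⟩
    refine ⟨g₁ + g₂, h₁.add h₂, (Lp.coeFn_add f₁ f₂).trans (e₁.add e₂)⟩
  smul_mem' := by
    rintro c f ⟨g, h, e⟩
    exact ⟨c • g, h.const_smul c, (Lp.coeFn_smul c f).trans (e.const_smul c)⟩

/-- Point evaluations are bounded in the mean over a disc. -/
theorem bergman_mean_bound (g : ℂ → ℂ) (z : ℂ) (r : ℝ) (hr : 0 < r)
    (hg : DifferentiableOn ℂ g (closedBall z r)) :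
    ENNReal.ofReal (r / 2) * ENNReal.ofReal (r / 2) * ‖g z‖ₑ ≤
      ∫⁻ w in ball z r, ‖g w‖ₑ := by
  have hcirc : ∀ ρ ∈ Ioo (r / 2) r,
      ‖g z‖ₑ ≤ ∫⁻ θ in Ioo (-π) π, ‖g (z + Complex.polarCoord.symm (ρ, θ))‖ₑ := by
    intro ρ hρ
    have hρ0 : 0 < ρ := by linarith [hρ.1]
    have hd : DiffContOnCl ℂ g (ball z |ρ|) := by
      apply DifferentiableOn.diffContOnCl
      rw [abs_of_pos hρ0, closure_ball _ hρ0.ne']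
      exact hg.mono (closedBall_subset_closedBall hρ.2.le)
    have h1 := hd.circleAverage
    rw [Real.circleAverage_eq_integral_add (-π)] at h1
    have h3 : (∫ θ in (0 : ℝ)..2 * π, g (circleMap z ρ (θ + -π)))
        = ∫ θ in Ioo (-π) π, g (z + Complex.polarCoord.symm (ρ, θ)) := by
      rw [intervalIntegral.integral_comp_add_right (fun θ => g (circleMap z ρ θ))]
      rw [show (0 : ℝ) + -π = -π by ring, show 2 * π + -π = π by ring,
        intervalIntegral.integral_of_le (by linarith [Real.pi_pos]),
        integral_Ioc_eq_integral_Ioo]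
      refine integral_congr_ae (Eventually.of_forall fun θ => ?_)
      simp only [circleMap, Complex.polarCoord_symm_apply, Complex.exp_mul_I, Complex.ofReal_cos,
        Complex.ofReal_sin]
    rw [h3] at h1
    rw [← h1, enorm_smul]
    calc ‖(2 * π)⁻¹‖ₑ * ‖∫ θ in Ioo (-π) π, g (z + Complex.polarCoord.symm (ρ, θ))‖ₑ
        ≤ 1 * ‖∫ θ in Ioo (-π) π, g (z + Complex.polarCoord.symm (ρ, θ))‖ₑ := by
          gcongr
          rw [Real.enorm_eq_ofReal (by positivity)]
          apply ENNReal.ofReal_le_one.2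
          apply inv_le_one_of_one_le₀
          linarith [Real.pi_gt_three]
      _ ≤ _ := by rw [one_mul]; exact enorm_integral_le_lintegral_enorm _
  set G : ℂ → ℝ≥0∞ := (ball z r).indicator fun w => ‖g w‖ₑ with hG
  have hGm : Measurable G := by
    classical
    rw [hG, ← piecewise_eq_indicator]
    refine ContinuousOn.measurable_piecewise ?_ continuousOn_const measurableSet_ball
    exact (hg.continuousOn.mono ball_subset_closedBall).enorm
  have hstep : ∫⁻ w in ball z r, ‖g w‖ₑ = ∫⁻ ρ in Ioi (0 : ℝ), ∫⁻ θ in Ioo (-π) π,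
      ENNReal.ofReal ρ * G (z + Complex.polarCoord.symm (ρ, θ)) := by
    rw [← lintegral_indicator measurableSet_ball, ← lintegral_add_left_eq_self _ z,
      ← Complex.lintegral_comp_polarCoord_symm]
    rw [polarCoord_target, Measure.volume_eq_prod, ← Measure.prod_restrict, lintegral_prod]
    · rfl
    · refine Measurable.aemeasurable ?_
      have : Measurable fun p : ℝ × ℝ => Complex.polarCoord.symm p := by
        have : (fun p : ℝ × ℝ => Complex.polarCoord.symm p) = fun p : ℝ × ℝ =>
            (p.1 : ℂ) * (Real.cos p.2 + Real.sin p.2 * Complex.I) := by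
          funext p; exact Complex.polarCoord_symm_apply p
        rw [this]
        fun_prop
      exact (measurable_fst.ennreal_ofReal).mul (hGm.comp (measurable_const.add this))
  rw [hstep]
  calc ENNReal.ofReal (r / 2) * ENNReal.ofReal (r / 2) * ‖g z‖ₑ
      = ∫⁻ _ in Ioo (r / 2) r, ENNReal.ofReal (r / 2) * ‖g z‖ₑ := by
        rw [setLIntegral_const, Real.volume_Ioo, show r - r / 2 = r / 2 by ring]
        ring
    _ ≤ ∫⁻ ρ in Ioo (r / 2) r, ∫⁻ θ in Ioo (-π) π,
          ENNReal.ofReal ρ * G (z + Complex.polarCoord.symm (ρ, θ)) := by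
        refine setLIntegral_mono' measurableSet_Ioo fun ρ hρ => ?_
        have hρ0 : 0 < ρ := by linarith [hρ.1]
        rw [lintegral_const_mul' _ _ ENNReal.ofReal_ne_top]
        refine mul_le_mul' (ENNReal.ofReal_le_ofReal hρ.1.le) ((hcirc ρ hρ).trans_eq ?_)
        refine lintegral_congr fun θ => ?_
        rw [hG, indicator_of_mem]
        rw [mem_ball_iff_norm, add_sub_cancel_left, Complex.norm_polarCoord_symm,
          abs_of_pos hρ0]
        exact hρ.2
    _ ≤ _ := lintegral_mono_set fun ρ hρ => lt_trans (by linarith) hρ.1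

/-- Point evaluations are bounded with respect to the `L²` norm, locally uniformly. -/
theorem bergman_point_bound (r : ℝ) (hr : 0 < r) : ∃ C : ℝ≥0∞, C ≠ ∞ ∧
    ∀ (U : Set ℂ) (g : ℂ → ℂ) (z : ℂ), closedBall z r ⊆ U → IsOpen U → DifferentiableOn ℂ g U →
      ‖g z‖ₑ ≤ C * eLpNorm g 2 (volume.restrict U) := by
  set c : ℝ≥0∞ := ENNReal.ofReal (r / 2) * ENNReal.ofReal (r / 2) with hc
  have hc0 : c ≠ 0 := by
    have : ENNReal.ofReal (r / 2) ≠ 0 := by simpa using hr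
    exact mul_ne_zero this this
  have hct : c ≠ ∞ := ENNReal.mul_ne_top ENNReal.ofReal_ne_top ENNReal.ofReal_ne_top
  set V : ℝ≥0∞ := volume (ball (0 : ℂ) r) ^ (1 / 2 : ℝ) with hV
  have hVt : V ≠ ∞ := ENNReal.rpow_ne_top_of_nonneg (by norm_num) measure_ball_lt_top.ne
  refine ⟨c⁻¹ * V, ENNReal.mul_ne_top (ENNReal.inv_ne_top.2 hc0) hVt, fun U g z hzU hU hg => ?_⟩
  have h1 := bergman_mean_bound g z r hr (hg.mono hzU)
  have hm : AEStronglyMeasurable g (volume.restrict (ball z r)) :=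
    ((hg.mono hzU).continuousOn.mono ball_subset_closedBall).aestronglyMeasurable
      measurableSet_ball
  have h2 : ∫⁻ w in ball z r, ‖g w‖ₑ ≤ eLpNorm g 2 (volume.restrict U) * V := by
    rw [← eLpNorm_one_eq_lintegral_enorm]
    refine (eLpNorm_le_eLpNorm_mul_rpow_measure_univ (p := 1) (q := 2) (by norm_num) hm).trans ?_
    refine mul_le_mul' (eLpNorm_mono_measure g
      (Measure.restrict_mono (ball_subset_closedBall.trans hzU) le_rfl)) (le_of_eq ?_)
    rw [Measure.restrict_apply_univ, hV, Measure.addHaar_ball_center]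
    norm_num
  calc ‖g z‖ₑ = c⁻¹ * (c * ‖g z‖ₑ) := by
        rw [← mul_assoc, ENNReal.inv_mul_cancel hc0 hct, one_mul]
    _ ≤ c⁻¹ * (eLpNorm g 2 (volume.restrict U) * V) := by
        exact mul_le_mul' le_rfl (h1.trans h2)
    _ = _ := by ring

/-- The Bergman space is closed in `L²(Ω)`. -/
theorem isClosed_bergman (Ω : TopologicalSpace.Opens ℂ) : IsClosed (bergman Ω : Set (L2 Ω)) := by
  refine isClosed_of_closure_subset fun f hf => ?_
  obtain ⟨u, hu, hlim⟩ := mem_closure_iff_seq_limit.1 hf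
  choose g hg he using hu
  have hcau : CauchySeq u := hlim.cauchySeq
  have hdiff : ∀ n m, eLpNorm (fun w => g n w - g m w) 2 (volume.restrict (Ω : Set ℂ))
      = edist (u n) (u m) := by
    intro n m
    rw [Lp.edist_def]
    refine eLpNorm_congr_ae ?_
    filter_upwards [he n, he m] with w h1 h2
    simp [h1, h2]
  have hunif : ∀ z ∈ (Ω : Set ℂ), ∃ r > 0, ball z r ⊆ (Ω : Set ℂ) ∧
      UniformCauchySeqOn g atTop (ball z r) := by
    intro z hz
    obtain ⟨s, hs, hsub⟩ := Metric.isOpen_iff.1 Ω.isOpen z hz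
    obtain ⟨C, hC, hbd⟩ := bergman_point_bound (s / 2) (by positivity)
    refine ⟨s / 2, by positivity, (ball_subset_ball (by linarith)).trans hsub, ?_⟩
    rw [Metric.uniformCauchySeqOn_iff]
    intro ε hε
    obtain ⟨N, hN⟩ := Metric.cauchySeq_iff.1 hcau (ε / (C.toReal + 1)) (by positivity)
    refine ⟨N, fun m hm n hn x hx => ?_⟩
    have h1 : ‖g m x - g n x‖ₑ ≤ C * edist (u m) (u n) := by
      rw [← hdiff]
      refine hbd Ω (fun w => g m w - g n w) x ?_ Ω.isOpen ((hg m).sub (hg n))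
      intro y hy
      apply hsub
      rw [mem_ball] at hx ⊢
      rw [mem_closedBall] at hy
      linarith [dist_triangle y x z]
    have h2 : dist (g m x) (g n x) ≤ C.toReal * dist (u m) (u n) := by
      have := ENNReal.toReal_mono (ENNReal.mul_ne_top hC (edist_ne_top _ _)) h1
      rwa [ENNReal.toReal_mul, ← dist_edist, toReal_enorm, ← dist_eq_norm] at this
    calc dist (g m x) (g n x) ≤ C.toReal * dist (u m) (u n) := h2
      _ ≤ C.toReal * (ε / (C.toReal + 1)) := by
          gcongr; exact (hN m hm n hn).le
      _ < (C.toReal + 1) * (ε / (C.toReal + 1)) := by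
          have : 0 < ε / (C.toReal + 1) := by positivity
          nlinarith
      _ = ε := by field_simp
  have hpt : ∀ z ∈ (Ω : Set ℂ), ∃ l, Tendsto (fun n => g n z) atTop (𝓝 l) := by
    intro z hz
    obtain ⟨r, hr, -, h⟩ := hunif z hz
    exact cauchySeq_tendsto_of_complete (h.cauchySeq (mem_ball_self hr))
  choose! G hG using hpt
  have hloc : TendstoLocallyUniformlyOn g G atTop (Ω : Set ℂ) := by
    rw [tendstoLocallyUniformlyOn_iff_forall_tendsto]
    intro z hz
    obtain ⟨r, hr, hsub, h⟩ := hunif z hz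
    have h1 := h.tendstoUniformlyOn_of_tendsto fun x hx => hG x (hsub hx)
    rw [tendstoUniformlyOn_iff_tendsto] at h1
    refine h1.mono_left (Filter.prod_mono le_rfl ?_)
    rw [le_principal_iff]
    exact mem_nhdsWithin_of_mem_nhds (ball_mem_nhds z hr)
  refine ⟨G, hloc.differentiableOn (Eventually.of_forall hg) Ω.isOpen, ?_⟩
  obtain ⟨φ, hφ, hae⟩ := (tendstoInMeasure_of_tendsto_Lp hlim).exists_seq_tendsto_ae
  filter_upwards [hae, ae_all_iff.2 he, ae_restrict_mem Ω.isOpen.measurableSet] with w h1 h2 h3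
  refine tendsto_nhds_unique h1 ?_
  simp only [h2]
  exact (hG w h3).comp hφ.tendsto_atTop

instance (Ω : TopologicalSpace.Opens ℂ) : CompleteSpace (bergman Ω) :=
  (isClosed_bergman Ω).completeSpace_coe

/-! ### Toeplitz operators -/

/-- `a` is (a representative of) an element of `L^∞(Ω)`. -/
abbrev IsSymbol (Ω : TopologicalSpace.Opens ℂ) (a : ℂ → ℂ) : Prop :=
  MemLp a ∞ (volume.restrict (Ω : Set ℂ))

/-- The operator of multiplication by `a ∈ L^∞(Ω)` on `L²(Ω)`. -/
def mulOp (Ω : TopologicalSpace.Opens ℂ) (a : ℂ → ℂ) (ha : IsSymbol Ω a) :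
    L2 Ω →L[ℂ] L2 Ω :=
  (ContinuousLinearMap.mul ℂ ℂ).holderL (volume.restrict (Ω : Set ℂ)) ∞ 2 2 (ha.toLp a)

/-- The Toeplitz operator `T_a f = P_Ω (a f)` on `A²(Ω)`, where `P_Ω` is the orthogonal
projection of `L²(Ω)` onto `A²(Ω)`. -/
def toeplitz (Ω : TopologicalSpace.Opens ℂ) (a : ℂ → ℂ) (ha : IsSymbol Ω a) :
    bergman Ω →L[ℂ] bergman Ω :=
  (bergman Ω).orthogonalProjectionOnto ∘L mulOp Ω a ha ∘L (bergman Ω).subtypeL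

/-! ### Spectral notions -/

/-- The essential spectrum of a bounded operator: the `μ` for which `T - μ` is not Fredholm. -/
def essSpectrum {H : Type*} [NormedAddCommGroup H] [InnerProductSpace ℂ H] (T : H →L[ℂ] H) :
    Set ℂ :=
  {μ | ¬ (T - μ • ContinuousLinearMap.id ℂ H).IsFredholm}

/-- `lam 1, lam 2, …` lists the nonzero eigenvalues of `T`, each as many times as its
multiplicity, in the order of decreasing absolute value. If there are only finitely many of them,
the list is continued by zeros. -/
structure IsEigenvalueSequence {H : Type*} [NormedAddCommGroup H] [InnerProductSpace ℂ H]
    (T : H →L[ℂ] H) (lam : ℕ+ → ℝ) : Prop where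
  antitone_abs : Antitone fun n => |lam n|
  finiteDimensional (μ : ℂ) (hμ : μ ≠ 0) :
    FiniteDimensional ℂ (Module.End.eigenspace (T : H →ₗ[ℂ] H) μ)
  multiplicity (μ : ℂ) (hμ : μ ≠ 0) :
    {n : ℕ+ | (lam n : ℂ) = μ}.encard =
      (Module.finrank ℂ (Module.End.eigenspace (T : H →ₗ[ℂ] H) μ) : ℕ∞)

/-! ### Periodic domains -/

/-- The open unit disc. -/
def unitDisc : TopologicalSpace.Opens ℂ := ⟨ball 0 1, isOpen_ball⟩

/-- `Γ` is a closed Lipschitz curve: a bi-Lipschitz image of the unit circle. -/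
def IsClosedLipschitzCurve (Γ : Set ℂ) : Prop :=
  ∃ γ : Circle → ℂ, (∃ K, LipschitzWith K γ) ∧ (∃ K, AntilipschitzWith K γ) ∧ range γ = Γ

/-- `ϖ` is a simply connected periodic cell: a bounded domain in the strip `|Re z| < 1/2` whose
boundary is a closed Lipschitz curve that meets the two lines `Re z = ± 1/2` in the segments
`{± 1/2} × [c, d]` with the same `c < d`. -/
structure IsPeriodicCell (ϖ : Set ℂ) : Prop where
  isOpen : IsOpen ϖ
  simplyConnected : SimplyConnectedSpace ϖ
  bounded : ∃ M : ℝ, ∀ z ∈ ϖ, |z.re| < 1 / 2 ∧ |z.im| < M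
  lipschitz : IsClosedLipschitzCurve (frontier ϖ)
  sides : ∃ c d : ℝ, c < d ∧ ∀ s : ℝ, |s| = 1 / 2 →
    frontier ϖ ∩ {z | z.re = s} = {z | z.re = s ∧ z.im ∈ Icc c d}

/-- The periodic domain with cell `ϖ`: the interior of the union of the closures of the
translates `ϖ + m`, `m ∈ ℤ`. -/
def periodicDomain (ϖ : Set ℂ) : TopologicalSpace.Opens ℂ :=
  TopologicalSpace.Opens.interior (⋃ m : ℤ, closure ((fun z : ℂ => z + m) '' ϖ))

/-- The cell `ϖ_h`: the disc of radius `R₀` centred at the origin, together with the thin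
horizontal ligament of width `2h` across the strip `|Re z| < 1/2`. -/
def cell (R₀ h : ℝ) : Set ℂ :=
  ball 0 R₀ ∪ {z | |z.re| < 1 / 2 ∧ -h < z.im ∧ z.im < h}

open Classical in
/-- The `1`-periodic symbol built from copies of `b`: with `m` the integer nearest to `Re z`, its
value at `z` is `b ((z - m) / R₀)` if `z` lies in the disc of radius `R₀` centred at `m`, and `0`
otherwise. -/
def periodicSymbol (b : ℂ → ℝ) (R₀ : ℝ) (z : ℂ) : ℝ :=
  if z - (⌊z.re + 1 / 2⌋ : ℤ) ∈ ball (0 : ℂ) R₀ then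
    b ((z - (⌊z.re + 1 / 2⌋ : ℤ)) / R₀)
  else 0

end

/-!
The periodic domain consists of a thin strip and of disjoint discs of radius `R₀` about the
integers. Let `J` be the restriction of functions in `A²(Π_h)` to the discs, transported to the unit
disc, a contraction of `A²(Π_h)` into the Hilbert sum of copies of `A²(𝔻)`. Since the periodic
symbol vanishes outside of the discs, the periodic Toeplitz operator is the compression `J† D J` of the
direct sum `D` of copies of `T_b` (`toeplitz_periodicSymbol_eq_compress`).

The compression loses little as `h → 0`: the norm of `D - J J† D` tends to zero
(`eventually_norm_lpMap_toeplitz_sub_le`). As `T_b` is the norm limit of finite rank operators onto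
the span of the monomials, it suffices that `J J†` is close to the identity on sequences of
multiples of one monomial. Such a sequence is, up to a small error, of the form `J f` with `f` of
small mass in the ligaments (`exists_bergman_restrictDiscs_approx`). The function `f` is a
superposition of translates of the rational function `zⁿ / (1 + (2 z) ^ N)`, rescaled, with `N` even
and large: it is close to `zⁿ` for `|z| < R₀ < 1 / 2`, it is small and decays like `z⁻²` on the
other discs, and its poles, on the circle `|z| = 1 / 2`, stay away from the real axis. The bound on
the ligaments depends on `N` but not on `h`, while their area tends to zero with `h`.

It follows that every nonzero point of the spectrum of `J† D J` is close to the spectrum of `D`,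
which is that of `T_b`, and that every leading eigenvalue of `T_b` is close to the spectrum of
`J† D J`, because `J† φ` is an approximate eigenvector if `φ` is an eigenvector of `D`
(`essSpectrum_inter_nonempty_and_separated`). Finally, every nonzero spectral point `μ` of `J† D J`
is in the essential spectrum (`mem_essSpectrum_toeplitz_periodicSymbol`). Otherwise the eigenspace
of `μ` would be nonzero and finite-dimensional, and it would contain an eigenvector of the
translation by `1`; the mass of this eigenvector is the same on every disc, hence zero, so that the
eigenvector is annihilated by `J`.

On the disc, the normalized monomials `eₙ` form a basis of `A²(𝔻)` in which `‖T_b eₙ‖` decays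
geometrically, which gives the compactness of `T_b`. The cell is star-shaped, and its gauge yields a
bi-Lipschitz parametrization of its boundary (`isPeriodicCell_cell`).
-/

noncomputable section

/-! ### Self-adjoint and Fredholm operators on Hilbert spaces -/

section Operators

open ContinuousLinearMap
open scoped InnerProduct

variable {H K : Type*} [NormedAddCommGroup H] [InnerProductSpace ℂ H] [CompleteSpace H]
  [NormedAddCommGroup K] [InnerProductSpace ℂ K] [CompleteSpace K]

theorem IsSelfAdjoint.sub_ofReal_smul_id {T : H →L[ℂ] H} (hT : IsSelfAdjoint T) (μ : ℝ) :
    IsSelfAdjoint (T - (μ : ℂ) • ContinuousLinearMap.id ℂ H) := by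
  refine hT.sub (IsSelfAdjoint.smul ?_ (IsSelfAdjoint.one _))
  simp [IsSelfAdjoint, Complex.conj_ofReal]

theorem IsSelfAdjoint.orthogonal_range_eq_ker {A : H →L[ℂ] H} (hA : IsSelfAdjoint A) :
    A.rangeᗮ = A.ker := by
  rw [ContinuousLinearMap.orthogonal_range, hA.adjoint_eq]

theorem IsSelfAdjoint.isUnit_of_bounded_below {A : H →L[ℂ] H} (hA : IsSelfAdjoint A) {c : ℝ}
    (hc : 0 < c) (h : ∀ x, c * ‖x‖ ≤ ‖A x‖) : IsUnit A := by
  rw [isUnit_iff_bijective, bijective_iff_dense_range_and_antilipschitz]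
  constructor
  · rw [Submodule.topologicalClosure_eq_top_iff, hA.orthogonal_range_eq_ker, Submodule.eq_bot_iff]
    intro x hx
    have h1 : A x = 0 := hx
    have := h x
    rw [h1, norm_zero] at this
    have h2 : ‖x‖ ≤ 0 := by by_contra! h3; nlinarith
    simpa using h2
  · refine ⟨c⁻¹.toNNReal, A.antilipschitz_of_bound fun x => ?_⟩
    have := h x
    rw [Real.coe_toNNReal _ (by positivity), inv_mul_eq_div, le_div_iff₀ hc]
    linarith

/-- The distance to the spectrum of a self-adjoint operator is controlled by approximate
eigenvectors: this is the formula `‖A⁻¹‖ = 1 / dist(0, σ(A))`. -/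
theorem IsSelfAdjoint.exists_mem_spectrum_norm_lt {A : H →L[ℂ] H} (hA : IsSelfAdjoint A) {ε : ℝ}
    {f : H} (hf : ‖A f‖ < ε * ‖f‖) : ∃ s ∈ spectrum ℂ A, ‖s‖ < ε := by
  have hε : 0 < ε := by
    by_contra! h
    nlinarith [norm_nonneg (A f), norm_nonneg f]
  have hf0 : 0 < ‖f‖ := by
    by_contra! h
    nlinarith [norm_nonneg (A f), norm_nonneg f]
  by_cases hu : IsUnit A
  swap
  · exact ⟨0, (spectrum.zero_mem_iff ℂ).2 hu, by simpa using hε⟩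
  obtain ⟨u, rfl⟩ := hu
  have hB : IsSelfAdjoint (↑u⁻¹ : H →L[ℂ] H) := by
    have : IsSelfAdjoint u := Units.ext hA
    have h2 : IsSelfAdjoint u⁻¹ := this.inv
    exact congrArg Units.val h2
  have : Nontrivial H := ⟨f, 0, by rintro rfl; simp at hf0⟩
  obtain ⟨s, hs, hsn⟩ := spectrum.exists_nnnorm_eq_spectralRadius (↑u⁻¹ : H →L[ℂ] H)
  rw [hB.spectralRadius_eq_nnnorm] at hsn
  have hsn' : ‖s‖ = ‖(↑u⁻¹ : H →L[ℂ] H)‖ :=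
    congrArg NNReal.toReal (ENNReal.coe_injective hsn)
  have hs0 : s ≠ 0 := by
    rintro rfl
    exact spectrum.zero_notMem (R := ℂ) (Units.isUnit u⁻¹) hs
  have h1 : ‖f‖ ≤ ‖s‖ * ‖(u : H →L[ℂ] H) f‖ := by
    rw [hsn']
    refine le_trans (le_of_eq ?_) (le_opNorm (↑u⁻¹ : H →L[ℂ] H) _)
    rw [← mul_apply_eq_comp, Units.inv_mul, one_apply_eq_self]
  refine ⟨s⁻¹, ?_, ?_⟩
  · have := spectrum.inv_mem_iff (r := Units.mk0 s hs0) (a := u⁻¹)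
    simpa using this.1 hs
  · rw [norm_inv]
    have hsp : 0 < ‖s‖ := norm_pos_iff.2 hs0
    rw [inv_lt_iff_one_lt_mul₀ hsp]
    by_contra! h
    have : ‖s‖ * ‖(u : H →L[ℂ] H) f‖ < ‖s‖ * (ε * ‖f‖) := by gcongr
    nlinarith

omit [CompleteSpace H] in
theorem mem_spectrum_iff_not_isUnit {T : H →L[ℂ] H} {μ : ℂ} :
    μ ∈ spectrum ℂ T ↔ ¬ IsUnit (T - μ • ContinuousLinearMap.id ℂ H) := by
  rw [spectrum.mem_iff, ← IsUnit.neg_iff, neg_sub, Algebra.algebraMap_eq_smul_one]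
  rfl

theorem IsSelfAdjoint.exists_mem_spectrum_dist_lt {T : H →L[ℂ] H} (hT : IsSelfAdjoint T) {ε μ : ℝ}
    {f : H} (hf : ‖T f - (μ : ℂ) • f‖ < ε * ‖f‖) : ∃ s ∈ spectrum ℂ T, dist s (μ : ℂ) < ε := by
  obtain ⟨s, hs, hsε⟩ := (hT.sub_ofReal_smul_id μ).exists_mem_spectrum_norm_lt (f := f)
    (ε := ε) (by simpa using hf)
  refine ⟨s + μ, ?_, by simpa [dist_eq_norm] using hsε⟩
  rw [mem_spectrum_iff_not_isUnit] at hs ⊢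
  rwa [add_comm, add_smul, ← sub_sub]

theorem essSpectrum_subset_spectrum (T : H →L[ℂ] H) : essSpectrum T ⊆ spectrum ℂ T := by
  intro μ hμ
  rw [mem_spectrum_iff_not_isUnit]
  intro hu
  refine hμ ?_
  obtain ⟨u, hu⟩ := hu
  have hb := isUnit_iff_bijective.1 ⟨u, hu⟩
  let e := ContinuousLinearEquiv.ofBijective _ (LinearMap.ker_eq_bot.2 hb.1)
    (LinearMap.range_eq_top.2 hb.2)
  exact IsFredholm.of_isQuasiInverse (v := (e.symm : H →L[ℂ] H)) e.toLinearEquiv.isQuasiInverse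

/-- The range is closed, and its orthogonal complement is the kernel. -/
theorem IsSelfAdjoint.isUnit_of_isFredholm {A : H →L[ℂ] H} (hA : IsSelfAdjoint A)
    (hF : A.IsFredholm) (hker : A.ker = ⊥) : IsUnit A := by
  rw [isUnit_iff_bijective]
  refine ⟨LinearMap.ker_eq_bot.1 hker, ?_⟩
  have h1 : A.rangeᗮ = ⊥ := by rw [hA.orthogonal_range_eq_ker, hker]
  have h2 := Submodule.topologicalClosure_eq_top_iff.2 h1
  rw [hF.isClosed_range.submodule_topologicalClosure_eq] at h2
  exact LinearMap.range_eq_top.1 h2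

/-! ### Comparison of `J† D J` with `D` -/

/-- If `J J†` is close to the identity on the range of `D`, then `D - μ` bounded below implies
`J† D J - μ` bounded below. The vector `J f` solves `(D - μ) J f = J (T - μ) f` up to a small error,
which bounds `J f` by `(T - μ) f`; and `μ f = T f - (T - μ) f`, where `T f` is bounded by `J f`. -/
theorem norm_sub_smul_compress_bounded_below {T : H →L[ℂ] H} {D : K →L[ℂ] K} {J : H →L[ℂ] K}
    (hT : T = adjoint J ∘L D ∘L J) (hJ : ‖J‖ ≤ 1) {η d μ : ℝ}
    (hη : ‖D - J ∘L adjoint J ∘L D‖ ≤ η) (hηd : η < d) (hμ : μ ≠ 0)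
    (hD : ∀ u, d * ‖u‖ ≤ ‖D u - (μ : ℂ) • u‖) :
    ∃ c > 0, ∀ f, c * ‖f‖ ≤ ‖T f - (μ : ℂ) • f‖ := by
  have hJ' : ‖adjoint J‖ ≤ 1 := by simpa using hJ
  have hμ' : 0 < |μ| := abs_pos.2 hμ
  have hd : 0 < d - η := by linarith
  refine ⟨|μ| / (1 + ‖D‖ / (d - η)), by positivity, fun f => ?_⟩
  set r := ‖T f - (μ : ℂ) • f‖ with hr
  have h1 : (d - η) * ‖J f‖ ≤ r := by
    have e : D (J f) - (μ : ℂ) • J f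
        = J (T f - (μ : ℂ) • f) + (D - J ∘L adjoint J ∘L D) (J f) := by
      simp [hT]
    have h2 : ‖J (T f - (μ : ℂ) • f)‖ ≤ r := by
      refine (J.le_opNorm _).trans ?_
      exact mul_le_of_le_one_left (norm_nonneg _) hJ
    have h3 : ‖(D - J ∘L adjoint J ∘L D) (J f)‖ ≤ η * ‖J f‖ :=
      ((D - J ∘L adjoint J ∘L D).le_opNorm _).trans (by gcongr)
    have := (hD (J f)).trans ((congrArg norm e).le.trans (norm_add_le _ _))
    linarith
  have h4 : |μ| * ‖f‖ ≤ r + ‖D‖ * ‖J f‖ := by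
    have e : (μ : ℂ) • f = T f - (T f - (μ : ℂ) • f) := by abel
    have h5 : ‖T f‖ ≤ ‖D‖ * ‖J f‖ := by
      rw [hT]
      refine ((adjoint J).le_opNorm _).trans ((mul_le_of_le_one_left (norm_nonneg _) hJ').trans ?_)
      exact D.le_opNorm _
    calc |μ| * ‖f‖ = ‖(μ : ℂ) • f‖ := by rw [norm_smul]; simp
      _ = ‖T f - (T f - (μ : ℂ) • f)‖ := by rw [← e]
      _ ≤ ‖T f‖ + ‖T f - (μ : ℂ) • f‖ := norm_sub_le _ _
      _ ≤ _ := by linarith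
  have h6 : ‖J f‖ ≤ r / (d - η) := by rw [le_div_iff₀ hd]; linarith
  rw [div_mul_eq_mul_div, div_le_iff₀ (by positivity)]
  calc |μ| * ‖f‖ ≤ r + ‖D‖ * ‖J f‖ := h4
    _ ≤ r + ‖D‖ * (r / (d - η)) := by gcongr
    _ = r * (1 + ‖D‖ / (d - η)) := by ring

/-- If `J J†` is close to the identity on the range of `D`, then `J† φ` is an approximate
eigenvector of `J† D J` for every eigenvector `φ` of `D` with a nonzero eigenvalue: such a `φ` lies
in the range of `D`. -/
theorem norm_compress_adjoint_eigenvector_le {T : H →L[ℂ] H} {D : K →L[ℂ] K} {J : H →L[ℂ] K}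
    (hT : T = adjoint J ∘L D ∘L J) (hJ : ‖J‖ ≤ 1) {η l : ℝ} (hη : ‖D - J ∘L adjoint J ∘L D‖ ≤ η)
    (hl : l ≠ 0) {φ : K} (hφ : D φ = (l : ℂ) • φ) :
    ‖T (adjoint J φ) - (l : ℂ) • adjoint J φ‖ ≤ ‖D‖ * (η / |l|) * ‖φ‖ ∧
      (1 - η / |l|) * ‖φ‖ ≤ ‖adjoint J φ‖ := by
  have hJ' : ‖adjoint J‖ ≤ 1 := by simpa using hJ
  have hl' : 0 < |l| := abs_pos.2 hl
  have h1 : ‖φ - J (adjoint J φ)‖ ≤ η / |l| * ‖φ‖ := by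
    have e : (l : ℂ) • (φ - J (adjoint J φ)) = (D - J ∘L adjoint J ∘L D) φ := by
      simp [hφ, smul_sub]
    have h2 := ((D - J ∘L adjoint J ∘L D).le_opNorm φ).trans
      (mul_le_mul_of_nonneg_right hη (norm_nonneg φ))
    rw [← e, norm_smul] at h2
    rw [div_mul_eq_mul_div, le_div_iff₀ hl']
    simpa [mul_comm] using h2
  constructor
  · have e : T (adjoint J φ) - (l : ℂ) • adjoint J φ = - adjoint J (D (φ - J (adjoint J φ))) := by
      simp [hT, hφ]
    rw [e, norm_neg]
    calc ‖adjoint J (D (φ - J (adjoint J φ)))‖ ≤ ‖D (φ - J (adjoint J φ))‖ :=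
          ((adjoint J).le_opNorm _).trans (mul_le_of_le_one_left (norm_nonneg _) hJ')
      _ ≤ ‖D‖ * ‖φ - J (adjoint J φ)‖ := D.le_opNorm _
      _ ≤ ‖D‖ * (η / |l| * ‖φ‖) := by gcongr
      _ = _ := by ring
  · have h3 : ‖J (adjoint J φ)‖ ≤ ‖adjoint J φ‖ :=
      (J.le_opNorm _).trans (mul_le_of_le_one_left (norm_nonneg _) hJ)
    have h4 := norm_sub_norm_le φ (J (adjoint J φ))
    linarith

/-- If `J` is a contraction, `1 - J J†` is small on the vectors `J f` for which `J` almost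
preserves the norm of `f`. -/
theorem norm_sub_comp_adjoint_sq_le {J : H →L[ℂ] K} (hJ : ‖J‖ ≤ 1) (f : H) :
    ‖J f - J (adjoint J (J f))‖ ^ 2 ≤ ‖f‖ ^ 2 - ‖J f‖ ^ 2 := by
  have h0 : ‖J f - J (adjoint J (J f))‖ ≤ ‖f - adjoint J (J f)‖ := by
    rw [← map_sub]
    exact (J.le_opNorm _).trans (mul_le_of_le_one_left (norm_nonneg _) hJ)
  have h1 : ‖f - adjoint J (J f)‖ ^ 2 = ‖f‖ ^ 2 - 2 * ‖J f‖ ^ 2 + ‖adjoint J (J f)‖ ^ 2 := by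
    rw [@norm_sub_sq ℂ, adjoint_inner_right, inner_self_eq_norm_sq]
  have h2 : ‖adjoint J (J f)‖ ≤ ‖J f‖ :=
    ((adjoint J).le_opNorm _).trans (mul_le_of_le_one_left (norm_nonneg _) (by simpa using hJ))
  calc ‖J f - J (adjoint J (J f))‖ ^ 2 ≤ ‖f - adjoint J (J f)‖ ^ 2 := by gcongr
    _ ≤ _ := by rw [h1]; nlinarith [norm_nonneg (adjoint J (J f))]

theorem norm_sub_comp_adjoint_le {J : H →L[ℂ] K} (hJ : ‖J‖ ≤ 1) (v : K) :
    ‖v - J (adjoint J v)‖ ≤ 2 * ‖v‖ := by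
  have h1 : ‖J (adjoint J v)‖ ≤ ‖adjoint J v‖ :=
    (J.le_opNorm _).trans (mul_le_of_le_one_left (norm_nonneg _) hJ)
  have h2 : ‖adjoint J v‖ ≤ ‖v‖ :=
    ((adjoint J).le_opNorm _).trans (mul_le_of_le_one_left (norm_nonneg _) (by simpa using hJ))
  linarith [norm_sub_le v (J (adjoint J v))]

end Operators

/-! ### Enumeration of the eigenvalues of a compact self-adjoint operator -/

/-- A multiplicity function on `ℝ ∖ {0}` whose support accumulates only at `0` is the counting
function of a sequence of decreasing absolute value. The points with multiplicity are ordered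
lexicographically, by `-|μ|` first, and the sequence inverts the map that sends a point to the
number of its predecessors. -/
theorem exists_antitone_abs_enumeration (mult : ℝ → ℕ)
    (hfin : ∀ ε > 0, {μ : ℝ | ε ≤ |μ| ∧ mult μ ≠ 0}.Finite) :
    ∃ g : ℕ → ℝ, Antitone (fun n => |g n|) ∧
      ∀ μ ≠ 0, {n | g n = μ}.encard = (mult μ : ℕ∞) := by
  classical
  set A : Set (ℝ × ℕ) := {x | x.1 ≠ 0 ∧ x.2 < mult x.1} with hA
  let key : ℝ × ℕ → ℝ ×ₗ (ℝ ×ₗ ℕ) := fun x => toLex (-|x.1|, toLex (x.1, x.2))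
  have hkey : Function.Injective key := by
    rintro ⟨a, i⟩ ⟨b, j⟩ h
    simp only [key, EmbeddingLike.apply_eq_iff_eq, Prod.mk.injEq] at h
    rw [Prod.mk.injEq]
    exact h.2
  have hkey_abs : ∀ x y, key x ≤ key y → |y.1| ≤ |x.1| := by
    intro x y h
    rw [Prod.Lex.le_iff] at h
    rcases h with h | h
    · exact (neg_lt_neg_iff.1 h).le
    · exact (neg_inj.1 h.1).ge
  let below : ℝ × ℕ → Set (ℝ × ℕ) := fun x => {y | y ∈ A ∧ key y < key x}
  have hbelow : ∀ x ∈ A, (below x).Finite := by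
    intro x hx
    refine ((hfin |x.1| (abs_pos.2 hx.1)).biUnion (t := fun μ => (fun i => (μ, i)) '' Iio (mult μ))
      fun μ _ => (finite_Iio _).image _).subset ?_
    rintro ⟨μ, i⟩ ⟨hyA, hyx⟩
    simp only [mem_iUnion]
    refine ⟨μ, ⟨hkey_abs _ _ hyx.le, ?_⟩, i, hyA.2, rfl⟩
    have : i < mult μ := hyA.2
    omega
  let rank : ℝ × ℕ → ℕ := fun x => (below x).ncard
  have hrank : ∀ x ∈ A, ∀ y ∈ A, key y < key x → rank y < rank x := by
    intro x hx y hy hyx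
    refine ncard_lt_ncard ⟨fun z hz => ⟨hz.1, hz.2.trans hyx⟩, fun h => ?_⟩ (hbelow x hx)
    exact lt_irrefl _ (h (show y ∈ below x from ⟨hy, hyx⟩)).2
  have hinj : InjOn rank A := by
    intro x hx y hy h
    rcases lt_trichotomy (key x) (key y) with h1 | h1 | h1
    · exact absurd h (hrank y hy x hx h1).ne
    · exact hkey h1
    · exact absurd h (hrank x hx y hy h1).ne'
  have hinit : ∀ x ∈ A, ∀ n < rank x, ∃ y ∈ A, rank y = n ∧ key y < key x := by
    intro x hx n hn
    have him : rank '' below x = Iio (rank x) := by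
      refine eq_of_subset_of_ncard_le ?_ ?_ (finite_Iio _)
      · rintro _ ⟨y, hy, rfl⟩
        exact hrank x hx y hy.1 hy.2
      · rw [(hinj.mono fun y hy => hy.1).ncard_image]
        simp [rank]
    obtain ⟨y, hy, hyn⟩ := him.symm.subset (mem_Iio.2 hn)
    exact ⟨y, hy.1, hyn, hy.2⟩
  let g : ℕ → ℝ := fun n => if h : ∃ x ∈ A, rank x = n then h.choose.1 else 0
  have hg : ∀ x ∈ A, g (rank x) = x.1 := by
    intro x hx
    have h : ∃ y ∈ A, rank y = rank x := ⟨x, hx, rfl⟩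
    have h2 := h.choose_spec
    simp only [g, dif_pos h]
    rw [hinj h2.1 hx h2.2]
  have hg0 : ∀ n, (¬ ∃ x ∈ A, rank x = n) → g n = 0 := fun n h => dif_neg h
  refine ⟨g, ?_, fun μ hμ => ?_⟩
  · intro n n' hnn'
    by_cases h : ∃ x ∈ A, rank x = n'
    swap
    · simp [hg0 n' h]
    obtain ⟨x, hx, rfl⟩ := h
    rcases hnn'.eq_or_lt with rfl | hlt
    · exact le_rfl
    obtain ⟨y, hy, rfl, hyx⟩ := hinit x hx n hlt
    simp only [hg x hx, hg y hy]
    exact hkey_abs _ _ hyx.le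
  · have hset : {n | g n = μ} = rank '' ((fun i => (μ, i)) '' Iio (mult μ)) := by
      ext n
      constructor
      · intro hn
        have h : ∃ x ∈ A, rank x = n := by
          by_contra h
          exact hμ (hn.symm.trans (hg0 n h))
        obtain ⟨x, hx, rfl⟩ := h
        have h1 : x.1 = μ := (hg x hx).symm.trans hn
        refine ⟨x, ⟨x.2, ?_, by simp [← h1]⟩, rfl⟩
        rw [← h1]; exact hx.2
      · rintro ⟨_, ⟨i, hi, rfl⟩, rfl⟩
        exact hg (μ, i) ⟨hμ, hi⟩
    have hsub : (fun i => (μ, i)) '' Iio (mult μ) ⊆ A := by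
      rintro _ ⟨i, hi, rfl⟩
      exact ⟨hμ, hi⟩
    rw [hset, (hinj.mono hsub).encard_image,
      Function.Injective.encard_image (fun i j h => (Prod.mk.inj h).2)]
    rw [← Finset.coe_Iio, encard_coe_eq_coe_finsetCard, Nat.card_Iio]

section Compact

open ContinuousLinearMap

variable {H : Type*} [NormedAddCommGroup H] [InnerProductSpace ℂ H] [CompleteSpace H]
  {T : H →L[ℂ] H}

omit [CompleteSpace H] in
/-- Otherwise the images of infinitely many orthonormal eigenvectors would be uniformly
separated. -/
theorem IsCompactOperator.finite_setOf_hasEigenvalue (hT : IsCompactOperator T)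
    (hs : (T : H →ₗ[ℂ] H).IsSymmetric) {ε : ℝ} (hε : 0 < ε) :
    {μ : ℝ | ε ≤ |μ| ∧ Module.End.HasEigenvalue (T : H →ₗ[ℂ] H) (μ : ℂ)}.Finite := by
  by_contra hinf
  have hinf' : Set.Infinite _ := hinf
  let e := hinf'.natEmbedding
  have hv : ∀ n, ∃ v : H, ‖v‖ = 1 ∧ T v = ((e n : ℝ) : ℂ) • v := by
    intro n
    obtain ⟨w, hw⟩ := (e n).2.2.exists_hasEigenvector
    have hw0 : ‖w‖ ≠ 0 := norm_ne_zero_iff.2 hw.2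
    refine ⟨((‖w‖⁻¹ : ℝ) : ℂ) • w, ?_, ?_⟩
    · rw [norm_smul]; simp [hw0]
    · rw [map_smul]
      have : T w = ((e n : ℝ) : ℂ) • w := hw.apply_eq_smul
      rw [this, smul_comm]
  choose v hv1 hvT using hv
  have hsep : ∀ m n, m ≠ n → ε ≤ ‖T (v m) - T (v n)‖ := by
    intro m n hmn
    have hne : ((e m : ℝ) : ℂ) ≠ ((e n : ℝ) : ℂ) := by
      intro h
      exact hmn (e.injective (Subtype.ext (Complex.ofReal_injective h)))
    have horth : inner ℂ (v m) (v n) = 0 :=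
      hs.orthogonalFamily_eigenspaces hne
        ⟨v m, Module.End.mem_eigenspace_iff.2 (hvT m)⟩
        ⟨v n, Module.End.mem_eigenspace_iff.2 (hvT n)⟩
    have h0 : inner ℂ (T (v m)) (T (v n)) = 0 := by
      rw [hvT, hvT, inner_smul_left, inner_smul_right, horth]; simp
    have h1 : ‖T (v m) - T (v n)‖ ^ 2 = ‖T (v m)‖ ^ 2 + ‖T (v n)‖ ^ 2 := by
      rw [@norm_sub_sq ℂ, h0]; simp
    have h2 : ε ≤ ‖T (v m)‖ := by
      rw [hvT, norm_smul, hv1]; simpa using (e m).2.1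
    have h3 : ε ^ 2 ≤ ‖T (v m) - T (v n)‖ ^ 2 := by
      rw [h1]; nlinarith [sq_nonneg ‖T (v n)‖]
    exact le_of_sq_le_sq h3 (norm_nonneg _)
  obtain ⟨K, hK, hK'⟩ := hT.image_closedBall_subset_compact (f := (T : H →ₗ[ℂ] H)) 1
  obtain ⟨y, -, ψ, hψ, hψy⟩ := hK.tendsto_subseq (x := fun n => T (v n))
    (fun n => hK' ⟨v n, by simp [hv1], rfl⟩)
  obtain ⟨N, hN⟩ := Metric.cauchySeq_iff'.1 hψy.cauchySeq ε hε
  have h1 := hN (N + 1) (by omega)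
  rw [dist_eq_norm] at h1
  exact absurd h1 (not_lt.2 (hsep _ _ (hψ.injective.ne (by omega))))

theorem IsCompactOperator.exists_isEigenvalueSequence (hT : IsCompactOperator T)
    (hs : IsSelfAdjoint T) : ∃ lam : ℕ+ → ℝ, IsEigenvalueSequence T lam := by
  have hsym : (T : H →ₗ[ℂ] H).IsSymmetric := hs.isSymmetric
  have hfd : ∀ μ : ℂ, μ ≠ 0 → FiniteDimensional ℂ (Module.End.eigenspace (T : H →ₗ[ℂ] H) μ) :=
    fun μ hμ => ContinuousLinearMap.finite_dimensional_eigenspace hT μ hμ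
  obtain ⟨g, hg, hgm⟩ := exists_antitone_abs_enumeration
    (fun μ => Module.finrank ℂ (Module.End.eigenspace (T : H →ₗ[ℂ] H) (μ : ℂ))) (by
      intro ε hε
      refine (hT.finite_setOf_hasEigenvalue hsym hε).subset fun μ hμ => ⟨hμ.1, ?_⟩
      intro h
      apply hμ.2
      have h' : Module.End.eigenspace (T : H →ₗ[ℂ] H) (μ : ℂ) = ⊥ := h
      rw [h']
      exact finrank_bot ℂ H)
  refine ⟨fun n => g n.natPred, fun m n hmn => hg (PNat.natPred_le_natPred.2 hmn), hfd,
    fun μ hμ => ?_⟩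
  by_cases him : (μ.re : ℂ) = μ
  · have h1 := hgm μ.re (by rintro h; rw [h] at him; exact hμ (by simpa using him.symm))
    rw [← congrArg (fun ν => (Module.finrank ℂ (Module.End.eigenspace (T : H →ₗ[ℂ] H) ν) : ℕ∞)) him,
      ← h1]
    have : {n : ℕ | g n = μ.re} = PNat.natPred '' {n : ℕ+ | (g n.natPred : ℂ) = μ} := by
      ext n
      constructor
      · intro hn
        refine ⟨n.succPNat, ?_, by simp⟩
        simp only [mem_ofPred_eq, Nat.natPred_succPNat] at hn ⊢
        rw [hn, him]
      · rintro ⟨k, hk, rfl⟩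
        simp only [mem_ofPred_eq] at hk ⊢
        rw [← hk, Complex.ofReal_re]
    rw [this, PNat.natPred_injective.encard_image]
  · have h1 : {n : ℕ+ | (g n.natPred : ℂ) = μ} = ∅ := by
      rw [eq_empty_iff_forall_notMem]
      intro n hn
      apply him
      rw [← (show (g n.natPred : ℂ) = μ from hn), Complex.ofReal_re]
    have h2 : Module.End.eigenspace (T : H →ₗ[ℂ] H) μ = ⊥ := by
      by_contra h
      have h3 := hsym.conj_eigenvalue_eq_self (μ := μ) h
      exact him (Complex.conj_eq_iff_re.1 h3)
    rw [h1, h2]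
    simp

omit [CompleteSpace H] in
theorem IsEigenvalueSequence.hasEigenvalue_iff {lam : ℕ+ → ℝ} (h : IsEigenvalueSequence T lam)
    {μ : ℂ} (hμ : μ ≠ 0) :
    Module.End.HasEigenvalue (T : H →ₗ[ℂ] H) μ ↔ ∃ n, (lam n : ℂ) = μ := by
  have := h.finiteDimensional μ hμ
  have h1 := h.multiplicity μ hμ
  rw [Module.End.hasEigenvalue_iff, ← not_iff_not, not_not, ← Submodule.finrank_eq_zero (R := ℂ)]
  rw [← Nat.cast_inj (R := ℕ∞), ← h1, Nat.cast_zero, encard_eq_zero, eq_empty_iff_forall_notMem]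
  simp

/-- In infinite dimension `0` is in the spectrum of a compact operator, whether or not it is an
eigenvalue or the list contains a zero. -/
theorem IsEigenvalueSequence.spectrum_eq {lam : ℕ+ → ℝ} (h : IsEigenvalueSequence T lam)
    (hT : IsCompactOperator T) (hinf : ¬ FiniteDimensional ℂ H) :
    spectrum ℂ T = {0} ∪ ⋃ n : ℕ+, {(lam n : ℂ)} := by
  have h0 : (0 : ℂ) ∈ spectrum ℂ T := by
    rw [spectrum.zero_mem_iff]
    rintro ⟨u, hu⟩
    apply hinf
    apply FiniteDimensional.of_isCompactOperator_id (𝕜 := ℂ)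
    have h1 := hT.clm_comp (↑u⁻¹ : H →L[ℂ] H)
    convert! h1 using 1
    ext x
    have : ((↑u⁻¹ : H →L[ℂ] H) * (u : H →L[ℂ] H)) x = x := by simp
    rw [hu] at this
    exact this.symm
  ext μ
  by_cases hμ : μ = 0
  · subst hμ; simp [h0]
  · rw [← hT.hasEigenvalue_iff_mem_spectrum hμ, h.hasEigenvalue_iff hμ]
    simp [hμ, eq_comm]

end Compact

/-! ### The cell and the periodic domain -/

section Geometry

variable {R₀ h : ℝ}

/-- The gauge of the cell, the minimum of the gauges of the disc and of the rectangle. The cell is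
star-shaped about `0` but not convex, so that this is not a seminorm. -/
def cellGauge (R₀ h : ℝ) (z : ℂ) : ℝ :=
  min (‖z‖ / R₀) (max (2 * |z.re|) (|z.im| / h))

theorem cellGauge_lt_one_iff (hR : 0 < R₀) (hh : 0 < h) (z : ℂ) :
    cellGauge R₀ h z < 1 ↔ z ∈ cell R₀ h := by
  have e : 2 * |z.re| < 1 ↔ |z.re| < 1 / 2 := by constructor <;> intro h <;> linarith
  simp only [cellGauge, min_lt_iff, max_lt_iff, div_lt_one hR, div_lt_one hh, cell, mem_union,
    mem_ball_zero_iff, mem_ofPred_eq, e, abs_lt (a := z.im)]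

theorem cellGauge_smul (R₀ h : ℝ) {t : ℝ} (ht : 0 ≤ t) (z : ℂ) :
    cellGauge R₀ h (t • z) = t * cellGauge R₀ h z := by
  simp only [cellGauge, norm_smul, Complex.smul_re, Complex.smul_im, smul_eq_mul, abs_mul,
    abs_of_nonneg ht, Real.norm_eq_abs]
  rw [mul_min_of_nonneg _ _ ht, mul_max_of_nonneg _ _ ht]
  congr 1
  · ring
  · congr 1 <;> ring

theorem continuous_cellGauge (R₀ h : ℝ) : Continuous (cellGauge R₀ h) := by
  unfold cellGauge; fun_prop

theorem isOpen_cell (hR : 0 < R₀) (hh : 0 < h) : IsOpen (cell R₀ h) := by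
  have : cell R₀ h = cellGauge R₀ h ⁻¹' Iio 1 := by
    ext z; exact (cellGauge_lt_one_iff hR hh z).symm
  rw [this]
  exact isOpen_Iio.preimage (continuous_cellGauge R₀ h)

theorem closure_cell (hR : 0 < R₀) (hh : 0 < h) :
    closure (cell R₀ h) = {z | cellGauge R₀ h z ≤ 1} := by
  apply Subset.antisymm
  · refine closure_minimal (fun z hz => ((cellGauge_lt_one_iff hR hh z).2 hz).le) ?_
    exact isClosed_Iic.preimage (continuous_cellGauge R₀ h)
  · intro z hz
    have h1 : Tendsto (fun t : ℝ => t • z) (𝓝[<] 1) (𝓝 z) := by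
      have : Continuous fun t : ℝ => t • z := by fun_prop
      simpa using (this.tendsto 1).mono_left nhdsWithin_le_nhds
    refine mem_closure_of_tendsto h1 ?_
    have h2 : ∀ᶠ t : ℝ in 𝓝[<] 1, 0 < t :=
      nhdsWithin_le_nhds (lt_mem_nhds one_pos)
    filter_upwards [h2, self_mem_nhdsWithin] with t ht ht1
    rw [← cellGauge_lt_one_iff hR hh, cellGauge_smul _ _ ht.le]
    have hz1 : cellGauge R₀ h z ≤ 1 := hz
    have ht1' : t < 1 := ht1
    nlinarith

theorem frontier_cell (hR : 0 < R₀) (hh : 0 < h) :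
    frontier (cell R₀ h) = {z | cellGauge R₀ h z = 1} := by
  rw [frontier, (isOpen_cell hR hh).interior_eq, closure_cell hR hh]
  ext z
  rw [Set.mem_sdiff, ← cellGauge_lt_one_iff hR hh]
  simp only [mem_ofPred_eq]
  rw [not_lt, le_antisymm_iff]

theorem starConvex_cell (hR : 0 < R₀) (hh : 0 < h) : StarConvex ℝ 0 (cell R₀ h) := by
  rw [starConvex_zero_iff]
  intro z hz t ht ht1
  rw [← cellGauge_lt_one_iff hR hh] at hz ⊢
  rw [cellGauge_smul _ _ ht]
  have h0 : 0 ≤ cellGauge R₀ h z := by unfold cellGauge; positivity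
  nlinarith

/-- The gauge is comparable to the norm. The lower bound expresses that the cell lies in the unit
disc. -/
theorem cellGauge_bounds (hR : 0 < R₀) (hR' : R₀ < 1 / 2) (hh : 0 < h) (hh' : h ≤ 1 / 10) (z : ℂ) :
    ‖z‖ ≤ cellGauge R₀ h z ∧ cellGauge R₀ h z ≤ ‖z‖ / R₀ := by
  refine ⟨le_min ?_ ?_, min_le_left _ _⟩
  · rw [le_div_iff₀ hR]; nlinarith [norm_nonneg z]
  · have h1 := Complex.norm_le_abs_re_add_abs_im z
    have h2 : 2 * |z.im| ≤ |z.im| / h := by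
      rw [le_div_iff₀ hh]; nlinarith [abs_nonneg z.im]
    have h3 := le_max_left (2 * |z.re|) (|z.im| / h)
    have h4 := le_max_right (2 * |z.re|) (|z.im| / h)
    linarith

theorem abs_cellGauge_sub_le (hR : 0 < R₀) (hh : 0 < h) (z w : ℂ) :
    |cellGauge R₀ h z - cellGauge R₀ h w| ≤ (1 / R₀ + 2 + 1 / h) * ‖z - w‖ := by
  set C := 1 / R₀ + 2 + 1 / h with hC
  have key : ∀ z w : ℂ, cellGauge R₀ h z ≤ cellGauge R₀ h w + C * ‖z - w‖ := by
    intro z w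
    have h0 := norm_nonneg (z - w)
    have i1 : 0 ≤ 1 / R₀ * ‖z - w‖ := by positivity
    have i2 : 0 ≤ 1 / h * ‖z - w‖ := by positivity
    have e : C * ‖z - w‖ = 1 / R₀ * ‖z - w‖ + 2 * ‖z - w‖ + 1 / h * ‖z - w‖ := by rw [hC]; ring
    have hre : |z.re| ≤ |w.re| + ‖z - w‖ := by
      have h1 := abs_sub_abs_le_abs_sub z.re w.re
      have h2 := Complex.abs_re_le_norm (z - w)
      rw [Complex.sub_re] at h2
      linarith
    have him : |z.im| ≤ |w.im| + ‖z - w‖ := by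
      have h1 := abs_sub_abs_le_abs_sub z.im w.im
      have h2 := Complex.abs_im_le_norm (z - w)
      rw [Complex.sub_im] at h2
      linarith
    have hn : ‖z‖ ≤ ‖w‖ + ‖z - w‖ := by linarith [norm_sub_norm_le z w]
    unfold cellGauge
    rw [min_add, e]
    refine min_le_min ?_ ?_
    · have : ‖z‖ / R₀ ≤ (‖w‖ + ‖z - w‖) / R₀ := by gcongr
      rw [add_div, div_eq_mul_one_div ‖z - w‖, mul_comm ‖z - w‖] at this
      linarith
    · refine max_le ?_ ?_
      · have := le_max_left (2 * |w.re|) (|w.im| / h)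
        linarith
      · have h1 := le_max_right (2 * |w.re|) (|w.im| / h)
        have : |z.im| / h ≤ (|w.im| + ‖z - w‖) / h := by gcongr
        rw [add_div, div_eq_mul_one_div ‖z - w‖, mul_comm ‖z - w‖] at this
        linarith
  rw [abs_sub_le_iff]
  constructor
  · linarith [key z w]
  · have := key w z
    rw [norm_sub_rev] at this
    linarith

/-- The boundary of the cell is parametrized by `u ↦ u / g(u)`, where `g` is the gauge of the
cell. This map is bi-Lipschitz because `g` is Lipschitz and bounded above and below on the
circle. -/
theorem isClosedLipschitzCurve_frontier_cell (hR : 0 < R₀) (hR' : R₀ < 1 / 2) (hh : 0 < h)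
    (hh' : h ≤ 1 / 10) : IsClosedLipschitzCurve (frontier (cell R₀ h)) := by
  set g := cellGauge R₀ h with hg
  have hb : ∀ u : Circle, 1 ≤ g u ∧ g u ≤ 1 / R₀ := by
    intro u
    have := cellGauge_bounds hR hR' hh hh' u
    rwa [Circle.norm_coe] at this
  have hpos : ∀ u : Circle, 0 < g u := fun u => by linarith [(hb u).1]
  let γ : Circle → ℂ := fun u => (g u)⁻¹ • (u : ℂ)
  have hγn : ∀ u, ‖γ u‖ = (g u)⁻¹ := by
    intro u
    simp only [γ, norm_smul, Circle.norm_coe, mul_one, Real.norm_eq_abs]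
    exact abs_of_pos (inv_pos.2 (hpos u))
  have hγu : ∀ u : Circle, g u • γ u = (u : ℂ) := fun u => smul_inv_smul₀ (hpos u).ne' _
  set C := 1 / R₀ + 2 + 1 / h with hC
  have hC0 : 0 < C := by positivity
  have hdist : ∀ u v : Circle, dist u v = ‖(u : ℂ) - v‖ := fun u v => dist_eq_norm (u : ℂ) v
  refine ⟨γ, ⟨(1 / R₀ + C).toNNReal, ?_⟩, ⟨(2 / R₀).toNNReal, ?_⟩, ?_⟩
  · refine LipschitzWith.of_dist_le_mul fun u v => ?_
    rw [Real.coe_toNNReal _ (by positivity), dist_eq_norm, hdist]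
    have e : γ u - γ v = ((g u)⁻¹ * (g v)⁻¹) • (g v • ((u : ℂ) - v) + (g v - g u) • (v : ℂ)) := by
      simp only [γ, Complex.real_smul]
      have h1 : (g u : ℂ) ≠ 0 := by exact_mod_cast (hpos u).ne'
      have h2 : (g v : ℂ) ≠ 0 := by exact_mod_cast (hpos v).ne'
      push_cast
      field_simp
      ring
    have i1 : (g u)⁻¹ * (g v)⁻¹ ≤ 1 :=
      mul_le_one₀ (inv_le_one_of_one_le₀ (hb u).1) (inv_nonneg.2 (hpos v).le)
        (inv_le_one_of_one_le₀ (hb v).1)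
    rw [e, norm_smul, Real.norm_eq_abs,
      abs_of_pos (mul_pos (inv_pos.2 (hpos u)) (inv_pos.2 (hpos v)))]
    refine (mul_le_of_le_one_left (norm_nonneg _) i1).trans ((norm_add_le _ _).trans ?_)
    rw [norm_smul, norm_smul, Circle.norm_coe, mul_one, Real.norm_eq_abs, Real.norm_eq_abs,
      abs_of_pos (hpos v), add_mul]
    refine add_le_add (mul_le_mul_of_nonneg_right (hb v).2 (norm_nonneg _)) ?_
    have := abs_cellGauge_sub_le hR hh (v : ℂ) u
    rwa [norm_sub_rev] at this
  · refine AntilipschitzWith.of_le_mul_dist fun u v => ?_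
    rw [Real.coe_toNNReal _ (by positivity), dist_eq_norm, hdist]
    have e : (u : ℂ) - v = g u • (γ u - γ v) + (g u - g v) • γ v := by
      rw [smul_sub, sub_smul, hγu, hγu]; abel
    have e2 : ‖(g u - g v) • γ v‖ ≤ g u * ‖γ u - γ v‖ := by
      have e3 : |g u - g v| * (g v)⁻¹ = g u * |(g v)⁻¹ - (g u)⁻¹| := by
        rw [← abs_of_pos (inv_pos.2 (hpos v)), ← abs_mul, abs_of_pos (inv_pos.2 (hpos v))]
        conv_rhs => rw [← abs_of_pos (hpos u)]
        rw [← abs_mul, abs_of_pos (hpos u)]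
        congr 1
        have := (hpos u).ne'
        have := (hpos v).ne'
        field_simp
      rw [norm_smul, hγn, Real.norm_eq_abs, e3]
      refine mul_le_mul_of_nonneg_left ?_ (hpos u).le
      rw [← hγn, ← hγn, norm_sub_rev]
      exact abs_norm_sub_norm_le _ _
    rw [e]
    refine (norm_add_le _ _).trans ?_
    rw [norm_smul, Real.norm_eq_abs, abs_of_pos (hpos u)]
    have i1 := mul_le_mul_of_nonneg_right (hb u).2 (norm_nonneg (γ u - γ v))
    have : 2 / R₀ * ‖γ u - γ v‖ = 1 / R₀ * ‖γ u - γ v‖ + 1 / R₀ * ‖γ u - γ v‖ := by ring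
    linarith
  · rw [frontier_cell hR hh]
    ext z
    constructor
    · rintro ⟨u, rfl⟩
      change g ((g u)⁻¹ • (u : ℂ)) = 1
      rw [hg, cellGauge_smul _ _ (inv_nonneg.2 (hpos u).le), ← hg, inv_mul_cancel₀ (hpos u).ne']
    · intro hz
      have hz1 : g z = 1 := hz
      have hz0 : z ≠ 0 := by
        rintro rfl
        simp [hg, cellGauge] at hz1
      have hn : 0 < ‖z‖ := norm_pos_iff.2 hz0
      have hu : ‖‖z‖⁻¹ • z‖ = 1 := by
        rw [norm_smul, norm_inv, norm_norm, inv_mul_cancel₀ hn.ne']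
      refine ⟨⟨‖z‖⁻¹ • z, mem_sphere_zero_iff_norm.2 hu⟩, ?_⟩
      change (g (‖z‖⁻¹ • z))⁻¹ • (‖z‖⁻¹ • z) = z
      rw [hg, cellGauge_smul _ _ (inv_nonneg.2 hn.le), ← hg, hz1, mul_one, inv_inv,
        smul_inv_smul₀ hn.ne']

theorem isPeriodicCell_cell (hR : 0 < R₀) (hR' : R₀ < 1 / 2) (hh : 0 < h) (hh' : h ≤ 1 / 10) :
    IsPeriodicCell (cell R₀ h) where
  isOpen := isOpen_cell hR hh
  simplyConnected := by
    have := (starConvex_cell hR hh).contractibleSpace ⟨0, Or.inl (mem_ball_self hR)⟩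
    infer_instance
  bounded := by
    refine ⟨1 / 2, ?_⟩
    rintro z (hz | hz)
    · rw [mem_ball_zero_iff] at hz
      exact ⟨(Complex.abs_re_le_norm z).trans_lt (hz.trans hR'),
        (Complex.abs_im_le_norm z).trans_lt (hz.trans hR')⟩
    · exact ⟨hz.1, by rw [abs_lt]; constructor <;> linarith [hz.2.1, hz.2.2]⟩
  lipschitz := isClosedLipschitzCurve_frontier_cell hR hR' hh hh'
  sides := by
    refine ⟨-h, h, by linarith, fun s hs => ?_⟩
    rw [frontier_cell hR hh]
    ext z
    simp only [mem_inter_iff, mem_ofPred_eq, mem_Icc, ← abs_le]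
    rw [and_comm]
    refine and_congr_right fun hz => ?_
    have h1 : 1 < ‖z‖ / R₀ := by
      rw [one_lt_div hR]
      refine lt_of_lt_of_le ?_ (Complex.abs_re_le_norm z)
      rw [hz, hs]; exact hR'
    have h2 : 2 * |z.re| = 1 := by rw [hz, hs]; norm_num
    rw [cellGauge, h2, ← div_le_one hh]
    constructor
    · intro h3
      by_contra! h4
      have := lt_min h1 (lt_max_of_lt_right (b := (1 : ℝ)) h4)
      linarith
    · intro h3
      rw [max_eq_left h3, min_eq_right h1.le]

/-- The periodic domain consists of the strip `|Im z| < h` and of the discs of radius `R₀` centred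
at the integers. -/
theorem mem_periodicDomain_cell (hR : 0 < R₀) (hR' : R₀ < 1 / 2) (hh : 0 < h) {z : ℂ} :
    z ∈ periodicDomain (cell R₀ h) ↔ |z.im| < h ∨ ∃ m : ℤ, ‖z - m‖ < R₀ := by
  have hcl : ∀ m : ℤ, closure ((fun z : ℂ => z + m) '' cell R₀ h)
      = {z | cellGauge R₀ h (z - m) ≤ 1} := by
    intro m
    have e : (fun z : ℂ => z + m) '' closure (cell R₀ h)
        = closure ((fun z : ℂ => z + m) '' cell R₀ h) :=
      (Homeomorph.addRight (m : ℂ)).image_closure _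
    rw [← e, closure_cell hR hh]
    ext w
    constructor
    · rintro ⟨v, hv, rfl⟩
      simpa using hv
    · intro hw
      exact ⟨w - m, hw, by simp⟩
  have hU : (⋃ m : ℤ, closure ((fun z : ℂ => z + m) '' cell R₀ h))
      = {z : ℂ | |z.im| ≤ h ∨ ∃ m : ℤ, ‖z - m‖ ≤ R₀} := by
    ext w
    simp only [hcl, mem_iUnion, mem_ofPred_eq, cellGauge, min_le_iff, max_le_iff, div_le_one hR,
      div_le_one hh, Complex.sub_re, Complex.sub_im, Complex.intCast_re, Complex.intCast_im,
      sub_zero]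
    constructor
    · rintro ⟨m, h1 | h1⟩
      · exact Or.inr ⟨m, h1⟩
      · exact Or.inl h1.2
    · rintro (h1 | ⟨m, h1⟩)
      · refine ⟨round w.re, Or.inr ⟨?_, h1⟩⟩
        linarith [abs_sub_round w.re]
      · exact ⟨m, Or.inl h1⟩
  have hmem : z ∈ periodicDomain (cell R₀ h) ↔
      z ∈ interior {z : ℂ | |z.im| ≤ h ∨ ∃ m : ℤ, ‖z - m‖ ≤ R₀} := by
    rw [← hU]; rfl
  rw [hmem]
  constructor
  · intro hz
    by_contra! hcon
    obtain ⟨hc1, hc2⟩ := hcon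
    -- moving away from the real axis leaves the closed set at once
    set s : ℝ := ((SignType.sign z.im : SignType) : ℝ) with hs
    have hz0 : z.im ≠ 0 := by rintro h0; rw [h0, abs_zero] at hc1; linarith
    have hss : s * z.im = |z.im| := sign_mul_self z.im
    have hs2 : s * s = 1 := by
      rcases lt_or_gt_of_ne hz0 with h0 | h0
      · simp [hs, sign_neg h0]
      · simp [hs, sign_pos h0]
    have hlim : Tendsto (fun t : ℝ => z + (t * s : ℝ) * Complex.I) (𝓝[>] 0) (𝓝 z) := by
      have : Continuous fun t : ℝ => z + (t * s : ℝ) * Complex.I := by fun_prop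
      simpa using (this.tendsto 0).mono_left nhdsWithin_le_nhds
    obtain ⟨t, htm, ht⟩ := ((hlim.eventually (isOpen_interior.mem_nhds hz)).and
      self_mem_nhdsWithin).exists
    have ht0 : 0 < t := ht
    have him : |(z.im + t * s)| = |z.im| + t := by
      have e1 : z.im + t * s = s * (|z.im| + t) := by
        rw [← hss]; linear_combination (-z.im) * hs2
      have e2 : |s| = 1 := by
        have := abs_mul_abs_self s
        nlinarith [abs_nonneg s]
      rw [e1, abs_mul, e2, one_mul, abs_of_nonneg (by positivity)]
    rcases interior_subset htm with h1 | ⟨m, h1⟩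
    · simp only [Complex.add_im, Complex.mul_im, Complex.ofReal_re, Complex.ofReal_im, Complex.I_re,
        Complex.I_im, mul_one, add_zero, mul_zero] at h1
      rw [him] at h1
      linarith
    · have h2 := hc2 m
      have h3 : ‖z + (t * s : ℝ) * Complex.I - m‖ ^ 2 ≤ ‖z - m‖ ^ 2 :=
        pow_le_pow_left₀ (norm_nonneg _) (h1.trans h2) 2
      rw [Complex.sq_norm, Complex.sq_norm, Complex.normSq_apply, Complex.normSq_apply] at h3
      simp only [Complex.sub_re, Complex.add_re, Complex.mul_re, Complex.ofReal_re, Complex.I_re,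
        mul_zero, Complex.ofReal_im, Complex.I_im, mul_one, sub_self, add_zero, Complex.intCast_re,
        Complex.sub_im, Complex.add_im, Complex.mul_im, Complex.intCast_im, sub_zero,
        add_le_add_iff_left] at h3
      rw [← abs_mul_abs_self (z.im + t * s), ← abs_mul_abs_self z.im, him] at h3
      nlinarith [abs_nonneg z.im]
  · intro hz
    rw [mem_interior]
    refine ⟨{z : ℂ | |z.im| < h ∨ ∃ m : ℤ, ‖z - m‖ < R₀}, ?_, ?_, hz⟩
    · rintro w (h1 | ⟨m, h1⟩)
      · exact Or.inl h1.le
      · exact Or.inr ⟨m, h1.le⟩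
    · have : {z : ℂ | |z.im| < h ∨ ∃ m : ℤ, ‖z - m‖ < R₀}
          = {z : ℂ | |z.im| < h} ∪ ⋃ m : ℤ, {z : ℂ | ‖z - m‖ < R₀} := by
        ext; simp
      rw [this]
      refine IsOpen.union (isOpen_lt (by fun_prop) (by fun_prop)) (isOpen_iUnion fun m => ?_)
      exact isOpen_lt (by fun_prop) (by fun_prop)

/-- The periodic domain is contracted vertically onto the real axis. -/
theorem simplyConnectedSpace_periodicDomain_cell (hR : 0 < R₀) (hR' : R₀ < 1 / 2) (hh : 0 < h) :
    SimplyConnectedSpace (periodicDomain (cell R₀ h)) := by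
  set V := periodicDomain (cell R₀ h) with hV
  have hmem : ∀ z : ℂ, z ∈ V ↔ |z.im| < h ∨ ∃ m : ℤ, ‖z - m‖ < R₀ :=
    fun z => mem_periodicDomain_cell hR hR' hh
  have hvert : ∀ z : ℂ, z ∈ V → ∀ t ∈ Icc (0 : ℝ) 1,
      (z.re : ℂ) + (t * z.im : ℝ) * Complex.I ∈ V := by
    intro z hz t ht
    rw [hmem] at hz ⊢
    rcases hz with h1 | ⟨m, h1⟩
    · left
      simp only [Complex.add_im, Complex.mul_im, Complex.ofReal_re, Complex.ofReal_im, Complex.I_re,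
        Complex.I_im, mul_one, add_zero, mul_zero, zero_add]
      rw [abs_mul, abs_of_nonneg ht.1]
      nlinarith [ht.2, abs_nonneg z.im]
    · right
      refine ⟨m, lt_of_le_of_lt ?_ h1⟩
      refine le_of_sq_le_sq ?_ (norm_nonneg _)
      rw [Complex.sq_norm, Complex.sq_norm, Complex.normSq_apply, Complex.normSq_apply]
      simp
      nlinarith [mul_le_one₀ ht.2 ht.1 ht.2, mul_self_nonneg z.im]
  have hreal : ∀ x : ℝ, (x : ℂ) ∈ V := fun x => (hmem _).2 (Or.inl (by simpa using hh))
  let ρ : C(V, V) := ⟨fun z => ⟨((z : ℂ).re : ℂ), hreal _⟩, by fun_prop⟩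
  let zer : V := ⟨0, by simpa using hreal 0⟩
  have H1 : ContinuousMap.Homotopic ρ (ContinuousMap.id V) := by
    refine ⟨⟨⟨fun p => ⟨((p.2 : ℂ).re : ℂ) + ((p.1 : ℝ) * (p.2 : ℂ).im : ℝ) * Complex.I,
      hvert _ p.2.2 _ p.1.2⟩, by fun_prop⟩, ?_, ?_⟩⟩
    · intro z
      apply Subtype.ext
      simp [ρ]
    · intro z
      apply Subtype.ext
      simp [Complex.re_add_im]
  have H2 : ContinuousMap.Homotopic ρ (ContinuousMap.const V zer) := by
    refine ⟨⟨⟨fun p => ⟨(((1 - (p.1 : ℝ)) * (p.2 : ℂ).re : ℝ) : ℂ), hreal _⟩, by fun_prop⟩,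
      ?_, ?_⟩⟩
    · intro z
      apply Subtype.ext
      simp [ρ]
    · intro z
      apply Subtype.ext
      simp [zer]
  have : ContractibleSpace V := by
    rw [contractible_iff_id_nullhomotopic]
    exact ⟨zer, H1.symm.trans H2⟩
  infer_instance

end Geometry

/-! ### Bergman spaces and Toeplitz operators -/

section Bergman

open scoped ComplexConjugate

variable {Ω : TopologicalSpace.Opens ℂ} {a : ℂ → ℂ}

/-- The element of `A²(Ω)` defined by an analytic function that is square integrable on `Ω`. -/
def bergmanMk (g : ℂ → ℂ) (hg : DifferentiableOn ℂ g Ω)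
    (hL : MemLp g 2 (volume.restrict (Ω : Set ℂ))) : bergman Ω :=
  ⟨hL.toLp g, g, hg, hL.coeFn_toLp⟩

theorem coeFn_bergmanMk {g : ℂ → ℂ} (hg : DifferentiableOn ℂ g Ω)
    (hL : MemLp g 2 (volume.restrict (Ω : Set ℂ))) :
    ((bergmanMk g hg hL : L2 Ω) : ℂ → ℂ) =ᵐ[volume.restrict (Ω : Set ℂ)] g :=
  hL.coeFn_toLp

theorem inner_bergman (f g : bergman Ω) :
    inner ℂ f g = ∫ z in (Ω : Set ℂ), conj ((f : L2 Ω) z) * (g : L2 Ω) z := by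
  rw [Submodule.coe_inner, L2.inner_def]
  simp only [RCLike.inner_apply']

theorem integrable_conj_mul_bergman (f g : bergman Ω) :
    IntegrableOn (fun z => conj ((f : L2 Ω) z) * (g : L2 Ω) z) Ω := by
  have := L2.integrable_inner (𝕜 := ℂ) (f : L2 Ω) (g : L2 Ω)
  simp only [RCLike.inner_apply'] at this
  exact this

theorem coeFn_mulOp (ha : IsSymbol Ω a) (f : L2 Ω) :
    (mulOp Ω a ha f : ℂ → ℂ) =ᵐ[volume.restrict (Ω : Set ℂ)] fun z => a z * f z := by
  have h := (ContinuousLinearMap.mul ℂ ℂ).coeFn_holder (r := 2) (ha.toLp a) f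
  filter_upwards [h, ha.coeFn_toLp] with z h1 h2
  change ((ContinuousLinearMap.mul ℂ ℂ).holder 2 (ha.toLp a) f) z = _
  rw [h1, h2]
  rfl

theorem inner_toeplitz (ha : IsSymbol Ω a) (f g : bergman Ω) :
    inner ℂ f (toeplitz Ω a ha g) =
      ∫ z in (Ω : Set ℂ), conj ((f : L2 Ω) z) * (a z * (g : L2 Ω) z) := by
  change inner ℂ f ((bergman Ω).orthogonalProjectionOnto (mulOp Ω a ha g)) = _
  rw [Submodule.inner_orthogonalProjectionOnto_eq_of_mem_left, L2.inner_def]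
  refine integral_congr_ae ?_
  filter_upwards [coeFn_mulOp ha (g : L2 Ω)] with z hz
  rw [hz, RCLike.inner_apply']

theorem isSelfAdjoint_toeplitz {b : ℂ → ℝ} (hb : IsSymbol Ω fun z => (b z : ℂ)) :
    IsSelfAdjoint (toeplitz Ω (fun z => (b z : ℂ)) hb) := by
  rw [ContinuousLinearMap.isSelfAdjoint_iff_isSymmetric]
  intro f g
  rw [← inner_conj_symm]
  simp only [ContinuousLinearMap.coe_coe]
  rw [inner_toeplitz, inner_toeplitz, ← integral_conj]
  refine integral_congr_ae (Eventually.of_forall fun z => ?_)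
  simp only [map_mul, Complex.conj_conj, Complex.conj_ofReal]
  ring

theorem norm_toeplitz_apply_le (ha : IsSymbol Ω a) (f : bergman Ω) :
    ‖toeplitz Ω a ha f‖ ≤ ‖mulOp Ω a ha f‖ := by
  change ‖(bergman Ω).orthogonalProjectionOnto (mulOp Ω a ha f)‖ ≤ _
  refine (ContinuousLinearMap.le_opNorm _ _).trans ?_
  exact mul_le_of_le_one_left (norm_nonneg _) (bergman Ω).orthogonalProjectionOnto_norm_le

end Bergman

/-! ### The monomial basis of the Bergman space of the disc -/

section Disc

open scoped ComplexConjugate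

/-- Mean value property with respect to a radial weight. -/
theorem integral_ball_norm_pow_smul {g : ℂ → ℂ} (hg : DifferentiableOn ℂ g (ball 0 1)) (n : ℕ)
    (hi : IntegrableOn (fun z => (‖z‖ ^ (2 * n) : ℝ) • g z) (ball 0 1)) :
    ∫ z in ball (0 : ℂ) 1, (‖z‖ ^ (2 * n) : ℝ) • g z = (π / (n + 1) : ℝ) • g 0 := by
  classical
  set G : ℂ → ℂ := (ball (0 : ℂ) 1).indicator fun z => (‖z‖ ^ (2 * n) : ℝ) • g z with hG
  have hGi : Integrable G := (integrable_indicator_iff measurableSet_ball).2 hi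
  have hGm : Measurable G := by
    rw [hG, ← piecewise_eq_indicator]
    refine ContinuousOn.measurable_piecewise ?_ continuousOn_const measurableSet_ball
    exact ContinuousOn.smul (f := fun z : ℂ => ‖z‖ ^ (2 * n)) (by fun_prop) hg.continuousOn
  have hsymm : Measurable fun p : ℝ × ℝ => Complex.polarCoord.symm p := by
    have : (fun p : ℝ × ℝ => Complex.polarCoord.symm p) = fun p : ℝ × ℝ =>
        (p.1 : ℂ) * (Real.cos p.2 + Real.sin p.2 * Complex.I) := by
      funext p; exact Complex.polarCoord_symm_apply p
    rw [this]
    fun_prop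
  have hpi : IntegrableOn (fun p : ℝ × ℝ => p.1 • G (Complex.polarCoord.symm p))
      (Ioi 0 ×ˢ Ioo (-π) π) := by
    refine ⟨(measurable_fst.smul (hGm.comp hsymm)).aestronglyMeasurable, ?_⟩
    rw [hasFiniteIntegral_iff_enorm]
    have h1 := Complex.lintegral_comp_polarCoord_symm fun z => ‖G z‖ₑ
    rw [polarCoord_target] at h1
    have h2 : ∫⁻ p in Ioi (0 : ℝ) ×ˢ Ioo (-π) π, ‖p.1 • G (Complex.polarCoord.symm p)‖ₑ
        = ∫⁻ z, ‖G z‖ₑ := by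
      rw [← h1]
      refine setLIntegral_congr_fun (measurableSet_Ioi.prod measurableSet_Ioo) fun p hp => ?_
      simp only [enorm_smul, smul_eq_mul]
      rw [Real.enorm_eq_ofReal (le_of_lt hp.1)]
    rw [h2]
    exact hGi.2
  have hinner : ∀ ρ ∈ Ioi (0 : ℝ), ∫ θ in Ioo (-π) π, ρ • G (Complex.polarCoord.symm (ρ, θ))
      = (Ioo (0 : ℝ) 1).indicator (fun ρ => (ρ ^ (2 * n + 1) * (2 * π)) • g 0) ρ := by
    intro ρ hρ
    have hρ0 : 0 < ρ := hρ
    by_cases hρ1 : ρ < 1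
    · rw [indicator_of_mem (show ρ ∈ Ioo (0 : ℝ) 1 from ⟨hρ0, hρ1⟩)]
      have hd : DiffContOnCl ℂ g (ball 0 |ρ|) := by
        apply DifferentiableOn.diffContOnCl
        rw [abs_of_pos hρ0, closure_ball _ hρ0.ne']
        exact hg.mono (closedBall_subset_ball hρ1)
      have h1 := hd.circleAverage
      rw [Real.circleAverage_eq_integral_add (-π)] at h1
      have h3 : (∫ θ in (0 : ℝ)..2 * π, g (circleMap 0 ρ (θ + -π)))
          = ∫ θ in Ioo (-π) π, g (Complex.polarCoord.symm (ρ, θ)) := by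
        rw [intervalIntegral.integral_comp_add_right (fun θ => g (circleMap 0 ρ θ))]
        rw [show (0 : ℝ) + -π = -π by ring, show 2 * π + -π = π by ring,
          intervalIntegral.integral_of_le (by linarith [Real.pi_pos]),
          integral_Ioc_eq_integral_Ioo]
        refine integral_congr_ae (Eventually.of_forall fun θ => ?_)
        simp only [circleMap, Complex.polarCoord_symm_apply, Complex.exp_mul_I, Complex.ofReal_cos,
          Complex.ofReal_sin, zero_add]
      rw [h3] at h1
      have h4 : ∫ θ in Ioo (-π) π, g (Complex.polarCoord.symm (ρ, θ)) = (2 * π) • g 0 := by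
        rw [← h1, smul_inv_smul₀ (by positivity)]
      rw [integral_smul]
      have h5 : ∫ θ in Ioo (-π) π, G (Complex.polarCoord.symm (ρ, θ))
          = (ρ ^ (2 * n) : ℝ) • ∫ θ in Ioo (-π) π, g (Complex.polarCoord.symm (ρ, θ)) := by
        rw [← integral_smul]
        refine integral_congr_ae (Eventually.of_forall fun θ => ?_)
        have hn : ‖Complex.polarCoord.symm (ρ, θ)‖ = ρ := by
          rw [Complex.norm_polarCoord_symm, abs_of_pos hρ0]
        simp only [hG]
        rw [indicator_of_mem (by rw [mem_ball_zero_iff, hn]; exact hρ1), hn]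
      rw [h5, h4, smul_smul, smul_smul]
      congr 1
      ring
    · rw [indicator_of_notMem (fun h => hρ1 h.2)]
      refine (integral_congr_ae (Eventually.of_forall fun θ => ?_)).trans (integral_zero _ _)
      have hn : ‖Complex.polarCoord.symm (ρ, θ)‖ = ρ := by
        rw [Complex.norm_polarCoord_symm, abs_of_pos hρ0]
      simp only [hG]
      rw [indicator_of_notMem (by rw [mem_ball_zero_iff, hn]; exact hρ1), smul_zero]
  rw [← integral_indicator measurableSet_ball, ← hG, ← Complex.integral_comp_polarCoord_symm,
    polarCoord_target, Measure.volume_eq_prod, setIntegral_prod _ hpi,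
    setIntegral_congr_fun measurableSet_Ioi hinner, setIntegral_indicator measurableSet_Ioo,
    inter_eq_right.2 (fun x hx => hx.1), integral_smul_const]
  congr 1
  rw [integral_mul_const, ← integral_Ioc_eq_integral_Ioo,
    ← intervalIntegral.integral_of_le zero_le_one, integral_pow]
  push_cast
  have : (n : ℝ) + 1 ≠ 0 := by positivity
  field_simp
  ring_nf

theorem memLp_pow_unitDisc (n : ℕ) :
    MemLp (fun z : ℂ => z ^ n) 2 (volume.restrict (unitDisc : Set ℂ)) := by
  have : IsFiniteMeasure (volume.restrict (unitDisc : Set ℂ)) :=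
    ⟨by rw [Measure.restrict_apply_univ]; exact measure_ball_lt_top⟩
  refine MemLp.of_bound (by fun_prop) 1 ?_
  filter_upwards [ae_restrict_mem unitDisc.isOpen.measurableSet] with z hz
  rw [norm_pow]
  exact pow_le_one₀ (norm_nonneg _) (mem_ball_zero_iff.1 hz).le

/-- The monomial `zⁿ` in `A²(𝔻)`. -/
def discMonomial (n : ℕ) : bergman unitDisc :=
  bergmanMk (fun z => z ^ n) (by fun_prop) (memLp_pow_unitDisc n)

theorem coeFn_discMonomial (n : ℕ) :
    ((discMonomial n : L2 unitDisc) : ℂ → ℂ) =ᵐ[volume.restrict (unitDisc : Set ℂ)]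
      fun z => z ^ n :=
  coeFn_bergmanMk _ _

/-- If `zⁿ q` represents an element of `A²(𝔻)`, its inner product with `zⁿ` is a multiple of
`q 0`. -/
theorem inner_discMonomial_eq (n : ℕ) (f : bergman unitDisc) (q : ℂ → ℂ)
    (hq : DifferentiableOn ℂ q (ball 0 1))
    (hf : (f : L2 unitDisc) =ᵐ[volume.restrict (unitDisc : Set ℂ)] fun z => z ^ n * q z) :
    inner ℂ (discMonomial n) f = (π / (n + 1) : ℝ) • q 0 := by
  have h1 : (fun z => conj ((discMonomial n : L2 unitDisc) z) * (f : L2 unitDisc) z)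
      =ᵐ[volume.restrict (unitDisc : Set ℂ)] fun z => (‖z‖ ^ (2 * n) : ℝ) • q z := by
    filter_upwards [coeFn_discMonomial n, hf] with z h1 h2
    rw [h1, h2, map_pow, ← mul_assoc, ← mul_pow, ← Complex.normSq_eq_conj_mul_self,
      Complex.real_smul, Complex.normSq_eq_norm_sq, pow_mul]
    push_cast
    rfl
  rw [inner_bergman, integral_congr_ae h1]
  exact integral_ball_norm_pow_smul hq n ((integrable_conj_mul_bergman _ f).congr h1)

theorem inner_discMonomial_self (n : ℕ) :
    inner ℂ (discMonomial n) (discMonomial n) = ((π / (n + 1) : ℝ) : ℂ) := by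
  rw [inner_discMonomial_eq n _ (fun _ => 1) (by fun_prop)]
  · simp
  · simpa using coeFn_discMonomial n

theorem inner_discMonomial_of_lt {m n : ℕ} (h : m < n) :
    inner ℂ (discMonomial m) (discMonomial n) = 0 := by
  rw [inner_discMonomial_eq m _ (fun z => z ^ (n - m)) (by fun_prop)]
  · rw [zero_pow (by omega), smul_zero]
  · filter_upwards [coeFn_discMonomial n] with z hz
    rw [hz, ← pow_add]
    congr 1
    omega

theorem norm_discMonomial_sq (n : ℕ) : ‖discMonomial n‖ ^ 2 = π / (n + 1) := by
  have h := inner_self_eq_norm_sq_to_K (𝕜 := ℂ) (E := bergman unitDisc) (discMonomial n)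
  rw [inner_discMonomial_self] at h
  have h2 : ((π / (n + 1) : ℝ) : ℂ) = ((‖discMonomial n‖ ^ 2 : ℝ) : ℂ) := by
    rw [h, Complex.ofReal_pow]; rfl
  exact (Complex.ofReal_injective h2).symm

theorem norm_discMonomial_pos (n : ℕ) : 0 < ‖discMonomial n‖ := by
  have h := norm_discMonomial_sq n
  have h2 : 0 < π / (n + 1) := by positivity
  rw [← h] at h2
  exact (sq_pos_iff.1 h2).lt_of_le' (norm_nonneg _)

/-- A function in `A²(𝔻)` that is orthogonal to all monomials vanishes: otherwise it equals
`zⁿ q` with `q 0 ≠ 0`. -/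
theorem eq_zero_of_inner_discMonomial_eq_zero {f : bergman unitDisc}
    (hf : ∀ n, inner ℂ (discMonomial n) f = 0) : f = 0 := by
  obtain ⟨g, hg, hfg⟩ := f.2
  have hg' : DifferentiableOn ℂ g (ball 0 1) := hg
  have han : AnalyticOnNhd ℂ g (ball 0 1) := hg'.analyticOnNhd isOpen_ball
  have h0 : (0 : ℂ) ∈ ball (0 : ℂ) 1 := mem_ball_self one_pos
  by_cases hz : ∀ᶠ z in 𝓝 (0 : ℂ), g z = 0
  · have h1 := han.eqOn_zero_of_preconnected_of_eventuallyEq_zero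
      (convex_ball (0 : ℂ) 1).isPreconnected h0 hz
    apply Subtype.ext
    refine Lp.ext ?_
    filter_upwards [hfg, ae_restrict_mem unitDisc.isOpen.measurableSet,
      Lp.coeFn_zero ℂ 2 (volume.restrict (unitDisc : Set ℂ))] with z h2 h3 h4
    rw [h2, h1 h3]
    exact h4.symm
  · exfalso
    obtain ⟨n, q, hqa, hq0, hgq⟩ := (han 0 h0).exists_eventuallyEq_pow_smul_nonzero_iff.2 hz
    classical
    set Q : ℂ → ℂ := Function.update (fun z => g z / z ^ n) 0 (q 0) with hQ
    have hQ0 : Q 0 = q 0 := Function.update_self ..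
    have hQne : ∀ z, z ≠ 0 → Q z = g z / z ^ n := fun z hz => Function.update_of_ne hz ..
    have hQq : Q =ᶠ[𝓝 0] q := by
      filter_upwards [hgq] with z hz
      by_cases h : z = 0
      · rw [h, hQ0]
      · rw [hQne z h, hz, sub_zero, smul_eq_mul, mul_div_cancel_left₀ _ (pow_ne_zero n h)]
    have hQd : DifferentiableOn ℂ Q (ball 0 1) := by
      intro z hz
      apply DifferentiableAt.differentiableWithinAt
      by_cases h : z = 0
      · rw [h]
        exact hqa.differentiableAt.congr_of_eventuallyEq hQq
      · have h1 : DifferentiableAt ℂ (fun z => g z / z ^ n) z :=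
          (hg'.differentiableAt (isOpen_ball.mem_nhds hz)).div (by fun_prop) (pow_ne_zero n h)
        refine h1.congr_of_eventuallyEq ?_
        filter_upwards [isOpen_ne.mem_nhds h] with w hw
        exact hQne w hw
    have hgQ : ∀ z, g z = z ^ n * Q z := by
      intro z
      by_cases h : z = 0
      · rw [h, hQ0, hgq.self_of_nhds, sub_zero, smul_eq_mul]
      · rw [hQne z h, mul_div_cancel₀ _ (pow_ne_zero n h)]
    have h1 := inner_discMonomial_eq n f Q hQd (hfg.trans (Eventually.of_forall hgQ))
    rw [hf n, hQ0] at h1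
    have h2 : (π / (n + 1) : ℝ) ≠ 0 := by positivity
    exact hq0 ((smul_eq_zero.1 h1.symm).resolve_left h2)

/-- The normalized monomials. -/
def discBasisVec (n : ℕ) : bergman unitDisc :=
  ((‖discMonomial n‖⁻¹ : ℝ) : ℂ) • discMonomial n

theorem orthonormal_discBasisVec : Orthonormal ℂ discBasisVec := by
  refine ⟨fun n => ?_, fun m n hmn => ?_⟩
  · rw [discBasisVec, norm_smul, Complex.norm_real, norm_inv, norm_norm,
      inv_mul_cancel₀ (norm_discMonomial_pos n).ne']
  · simp only [discBasisVec]
    rw [inner_smul_left (E := bergman unitDisc), inner_smul_right (E := bergman unitDisc)]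
    have : inner ℂ (discMonomial m) (discMonomial n) = 0 := by
      rcases lt_or_gt_of_ne hmn with h | h
      · exact inner_discMonomial_of_lt h
      · rw [← inner_conj_symm (E := bergman unitDisc), inner_discMonomial_of_lt h, map_zero]
    rw [this, mul_zero, mul_zero]

/-- The normalized monomials as a Hilbert basis of `A²(𝔻)`. -/
def discBasis : HilbertBasis ℕ ℂ (bergman unitDisc) :=
  HilbertBasis.mkOfOrthogonalEqBot orthonormal_discBasisVec (by
    rw [Submodule.eq_bot_iff]
    intro f hf
    apply eq_zero_of_inner_discMonomial_eq_zero
    intro n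
    have h1 : inner ℂ (discBasisVec n) f = 0 :=
      (Submodule.mem_orthogonal _ _).1 hf _ (Submodule.subset_span ⟨n, rfl⟩)
    rw [discBasisVec, inner_smul_left (E := bergman unitDisc), Complex.conj_ofReal] at h1
    refine (mul_eq_zero.1 h1).resolve_left ?_
    exact Complex.ofReal_ne_zero.2 (inv_ne_zero (norm_discMonomial_pos n).ne'))

theorem discBasis_apply (n : ℕ) :
    discBasis n = ((‖discMonomial n‖⁻¹ : ℝ) : ℂ) • discMonomial n := by
  rw [discBasis, HilbertBasis.coe_mkOfOrthogonalEqBot]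
  rfl

theorem not_finiteDimensional_bergman_unitDisc :
    ¬ FiniteDimensional ℂ (bergman unitDisc) := by
  intro h
  have := orthonormal_discBasisVec.linearIndependent.finite
  exact not_finite ℕ

end Disc

/-! ### Compactness of Toeplitz operators with compactly supported symbol -/

section FiniteRank

open InnerProductSpace

variable {H : Type*} [NormedAddCommGroup H] [InnerProductSpace ℂ H] [CompleteSpace H]

/-- A self-adjoint operator with `∑ ‖T eₙ‖ < ∞` is the limit in norm of the finite rank
operators `∑_{k < n} ⟨T eₖ, ·⟩ eₖ`. -/
theorem tendsto_sum_rankOne_of_summable {T : H →L[ℂ] H} (hT : IsSelfAdjoint T)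
    (e : HilbertBasis ℕ ℂ H) (hs : Summable fun n => ‖T (e n)‖) :
    Tendsto (fun n => ∑ k ∈ Finset.range n, rankOne ℂ (e k) (T (e k))) atTop (𝓝 T) := by
  have h1 : Summable fun k => rankOne ℂ (e k) (T (e k)) := by
    refine Summable.of_norm ?_
    simpa [e.orthonormal.1] using hs
  obtain ⟨S, hS⟩ := h1
  have h2 : S = T := by
    ext x
    have h3 : HasSum (fun k => rankOne ℂ (e k) (T (e k)) x) (S x) :=
      hS.mapL (ContinuousLinearMap.apply ℂ H x)
    have h4 := e.hasSum_repr (T x)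
    refine h3.unique ?_
    convert! h4 using 2 with k
    rw [rankOne_apply, e.repr_apply_apply]
    congr 1
    exact hT.isSymmetric _ _
  exact h2 ▸ hS.tendsto_sum_nat

omit [CompleteSpace H] in
theorem isCompactOperator_rankOne (x y : H) : IsCompactOperator (rankOne ℂ x y) := by
  have h1 : IsCompactOperator (innerSL ℂ y) :=
    isCompactOperator_of_locallyCompactSpace_dom (innerSL ℂ y)
  exact h1.clm_comp (ContinuousLinearMap.toSpanSingleton ℂ x)

theorem isCompactOperator_of_summable {T : H →L[ℂ] H} (hT : IsSelfAdjoint T)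
    (e : HilbertBasis ℕ ℂ H) (hs : Summable fun n => ‖T (e n)‖) : IsCompactOperator T := by
  refine isCompactOperator_of_tendsto (tendsto_sum_rankOne_of_summable hT e hs)
    (Eventually.of_forall fun n => ?_)
  induction n with
  | zero => simpa using isCompactOperator_zero
  | succ n ih =>
    rw [Finset.sum_range_succ]
    exact ih.add (isCompactOperator_rankOne _ _)

end FiniteRank

section DiscToeplitz

variable {b : ℂ → ℝ} (hb : IsSymbol unitDisc (fun z => (b z : ℂ))) {R : ℝ}

/-- The symbol lives on a smaller disc, where the normalized monomials decay geometrically. -/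
theorem summable_norm_toeplitz_discBasis (hR : R < 1)
    (hsupp : ∀ᵐ z ∂(volume.restrict (unitDisc : Set ℂ)), R ≤ ‖z‖ → b z = 0) :
    Summable fun n => ‖toeplitz unitDisc (fun z => (b z : ℂ)) hb (discBasis n)‖ := by
  have hfin : IsFiniteMeasure (volume.restrict (unitDisc : Set ℂ)) :=
    ⟨by rw [Measure.restrict_apply_univ]; exact measure_ball_lt_top⟩
  set r := max R 0 with hr
  have hr0 : 0 ≤ r := le_max_right _ _
  have hr1 : r < 1 := max_lt hR one_pos
  obtain ⟨B, hB0, hB⟩ : ∃ B : ℝ, 0 ≤ B ∧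
      ∀ᵐ z ∂(volume.restrict (unitDisc : Set ℂ)), ‖(b z : ℂ)‖ ≤ B := by
    have h := hb.2
    rw [eLpNorm_exponent_top] at h
    refine ⟨(eLpNormEssSup (fun z => (b z : ℂ)) (volume.restrict (unitDisc : Set ℂ))).toReal,
      ENNReal.toReal_nonneg, ?_⟩
    filter_upwards [ae_le_eLpNormEssSup (f := fun z => (b z : ℂ))
      (μ := volume.restrict (unitDisc : Set ℂ))] with z hz
    rw [← toReal_enorm]
    exact ENNReal.toReal_mono h.ne hz
  set M := (measureUnivNNReal (volume.restrict (unitDisc : Set ℂ)) : ℝ) ^ (2 : ℝ≥0∞).toReal⁻¹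
    with hM
  have hM0 : 0 ≤ M := by positivity
  have h1 : ∀ n, ‖toeplitz unitDisc (fun z => (b z : ℂ)) hb (discMonomial n)‖
      ≤ M * (B * r ^ n) := by
    intro n
    refine (norm_toeplitz_apply_le hb _).trans (Lp.norm_le_of_ae_bound (by positivity) ?_)
    filter_upwards [coeFn_mulOp hb (discMonomial n : L2 unitDisc), coeFn_discMonomial n, hB, hsupp]
      with z h1 h2 h3 h4
    rw [h1, h2]
    by_cases hz : R ≤ ‖z‖
    · rw [h4 hz]
      simp only [Complex.ofReal_zero, zero_mul, norm_zero]
      positivity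
    · rw [norm_mul, norm_pow]
      gcongr
      exact (not_le.1 hz).le.trans (le_max_left _ _)
  have h2 : ∀ n, ‖discMonomial n‖⁻¹ ≤ (n : ℝ) + 1 := by
    intro n
    have h := norm_discMonomial_sq n
    have hp := norm_discMonomial_pos n
    rw [inv_le_comm₀ hp (by positivity)]
    refine le_of_sq_le_sq ?_ hp.le
    rw [h, inv_pow, inv_eq_one_div, div_le_div_iff₀ (by positivity) (by positivity)]
    have : (0 : ℝ) ≤ n := by positivity
    nlinarith [Real.pi_gt_three, mul_nonneg this this, Real.pi_pos,
      mul_nonneg Real.pi_pos.le (mul_nonneg this this), mul_nonneg Real.pi_pos.le this]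
  have hsum : Summable fun n : ℕ => M * B * (((n : ℝ) ^ 1 * r ^ n) + r ^ n) := by
    refine Summable.mul_left _ (Summable.add ?_ (summable_geometric_of_lt_one hr0 hr1))
    refine summable_pow_mul_geometric_of_norm_lt_one 1 ?_
    rwa [Real.norm_eq_abs, abs_of_nonneg hr0]
  refine Summable.of_nonneg_of_le (fun n => norm_nonneg _) (fun n => ?_) hsum
  rw [discBasis_apply, map_smul, norm_smul, Complex.norm_real, norm_inv, norm_norm]
  calc ‖discMonomial n‖⁻¹ * ‖toeplitz unitDisc (fun z => (b z : ℂ)) hb (discMonomial n)‖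
      ≤ ((n : ℝ) + 1) * (M * (B * r ^ n)) :=
        mul_le_mul (h2 n) (h1 n) (norm_nonneg _) (by positivity)
    _ = _ := by ring

theorem isCompactOperator_toeplitz_unitDisc (hR : R < 1)
    (hsupp : ∀ᵐ z ∂(volume.restrict (unitDisc : Set ℂ)), R ≤ ‖z‖ → b z = 0) :
    IsCompactOperator (toeplitz unitDisc (fun z => (b z : ℂ)) hb) :=
  isCompactOperator_of_summable (isSelfAdjoint_toeplitz hb) discBasis
    (summable_norm_toeplitz_discBasis hb hR hsupp)

end DiscToeplitz

/-! ### Operators acting coordinatewise on a Hilbert sum -/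

section HilbertSum

variable {ι E F : Type*} [NormedAddCommGroup E] [InnerProductSpace ℂ E]

theorem hasSum_norm_sq_lp {G : ι → Type*} [∀ i, NormedAddCommGroup (G i)] (x : lp G 2) :
    HasSum (fun i => ‖x i‖ ^ 2) (‖x‖ ^ 2) := by
  have h := lp.hasSum_norm (p := 2) (by norm_num) x
  simpa using h

theorem norm_lp_le_mul_norm {G G' : ι → Type*} [∀ i, NormedAddCommGroup (G i)]
    [∀ i, NormedAddCommGroup (G' i)] {x : lp G 2} {y : lp G' 2} {c : ℝ} (hc : 0 ≤ c)
    (h : ∀ i, ‖x i‖ ≤ c * ‖y i‖) : ‖x‖ ≤ c * ‖y‖ := by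
  refine le_of_sq_le_sq ?_ (by positivity)
  rw [mul_pow]
  refine hasSum_le (fun i => ?_) (hasSum_norm_sq_lp x) ((hasSum_norm_sq_lp y).mul_left (c ^ 2))
  rw [← mul_pow]
  exact pow_le_pow_left₀ (norm_nonneg _) (h i) 2

theorem memℓp_two_of_summable_sq {G : ι → Type*} [∀ i, NormedAddCommGroup (G i)] {x : ∀ i, G i}
    (h : Summable fun i => ‖x i‖ ^ 2) : Memℓp x 2 :=
  memℓp_gen (by simpa using h)

theorem memℓp_apply_lp (T : E →L[ℂ] E) (x : lp (fun _ : ι => E) 2) :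
    Memℓp (fun i => T (x i)) 2 := by
  refine memℓp_two_of_summable_sq (Summable.of_nonneg_of_le (fun i => sq_nonneg _) (fun i => ?_)
    ((hasSum_norm_sq_lp x).summable.mul_left (‖T‖ ^ 2)))
  rw [← mul_pow]
  exact pow_le_pow_left₀ (norm_nonneg _) (T.le_opNorm _) 2

variable (ι) in
/-- The operator on `ℓ²(ι; E)` that applies `T` in each coordinate. -/
def lpMap (T : E →L[ℂ] E) : lp (fun _ : ι => E) 2 →L[ℂ] lp (fun _ : ι => E) 2 :=
  LinearMap.mkContinuous
    { toFun := fun x => ⟨fun i => T (x i), memℓp_apply_lp T x⟩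
      map_add' := fun x y => lp.ext (funext fun i => map_add T (x i) (y i))
      map_smul' := fun c x => lp.ext (funext fun i => map_smul T c (x i)) }
    ‖T‖ (fun _ => norm_lp_le_mul_norm (norm_nonneg _) fun _ => T.le_opNorm _)

@[simp]
theorem lpMap_apply (T : E →L[ℂ] E) (x : lp (fun _ : ι => E) 2) (i : ι) :
    lpMap ι T x i = T (x i) := rfl

theorem norm_lpMap_le (T : E →L[ℂ] E) : ‖lpMap ι T‖ ≤ ‖T‖ :=
  LinearMap.mkContinuous_norm_le _ (norm_nonneg _) _

theorem lpMap_sub (S T : E →L[ℂ] E) : lpMap ι (S - T) = lpMap ι S - lpMap ι T := by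
  ext x i; simp

theorem lpMap_sum {κ : Type*} (s : Finset κ) (S : κ → E →L[ℂ] E) :
    lpMap ι (∑ k ∈ s, S k) = ∑ k ∈ s, lpMap ι (S k) := by
  classical
  induction s using Finset.induction_on with
  | empty => ext x i; simp
  | insert a s ha ih =>
    rw [Finset.sum_insert ha, Finset.sum_insert ha, ← ih]
    ext x i; simp

theorem lpMap_single [DecidableEq ι] (T : E →L[ℂ] E) (i : ι) (v : E) :
    lpMap ι T (lp.single 2 i v) = lp.single 2 i (T v) := by
  ext j
  by_cases h : j = i
  · subst h; simp
  · simp [h]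

/-- A bound for a continuous linear map on `ℓ²` follows from a bound on finitely supported
sequences. -/
theorem norm_le_of_forall_sum_single [DecidableEq ι] [NormedAddCommGroup F] [NormedSpace ℂ F]
    (A : lp (fun _ : ι => E) 2 →L[ℂ] F) {C : ℝ} (hC : 0 ≤ C)
    (h : ∀ (s : Finset ι) (x : ι → E),
      ‖A (∑ i ∈ s, lp.single 2 i (x i))‖ ≤ C * ‖∑ i ∈ s, lp.single 2 i (x i)‖) : ‖A‖ ≤ C := by
  refine A.opNorm_le_bound hC fun x => ?_
  have h1 : Tendsto (fun s : Finset ι => ∑ i ∈ s, lp.single (E := fun _ : ι => E) 2 i (x i)) atTop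
      (𝓝 x) := lp.hasSum_single (by norm_num) x
  exact le_of_tendsto_of_tendsto ((A.continuous.tendsto x).comp h1).norm (h1.norm.const_mul C)
    (Eventually.of_forall fun s => h s _)

omit [InnerProductSpace ℂ E] in
theorem sum_single_apply [DecidableEq ι] (s : Finset ι) (x : ι → E) (j : ι) :
    (∑ i ∈ s, lp.single (E := fun _ : ι => E) 2 i (x i)) j = if j ∈ s then x j else 0 := by
  rw [lp.coeFn_sum, Finset.sum_apply]
  by_cases hj : j ∈ s
  · rw [if_pos hj, Finset.sum_eq_single j]
    · simp
    · intro i _ hij; simp [hij.symm]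
    · intro h; exact absurd hj h
  · rw [if_neg hj]
    refine Finset.sum_eq_zero fun i hi => ?_
    have : j ≠ i := by rintro rfl; exact hj hi
    simp [this]

omit [InnerProductSpace ℂ E] in
theorem norm_sq_sum_single [DecidableEq ι] (s : Finset ι) (x : ι → E) :
    ‖∑ i ∈ s, lp.single (E := fun _ : ι => E) 2 i (x i)‖ ^ 2 = ∑ i ∈ s, ‖x i‖ ^ 2 := by
  have h1 := hasSum_norm_sq_lp (∑ i ∈ s, lp.single (E := fun _ : ι => E) 2 i (x i))
  simp only [sum_single_apply] at h1
  refine h1.unique ?_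
  have h2 : ∀ i ∈ s, ‖x i‖ ^ 2 = ‖if i ∈ s then x i else 0‖ ^ 2 := by
    intro i hi; rw [if_pos hi]
  rw [Finset.sum_congr rfl h2]
  exact hasSum_sum_of_ne_finset_zero fun i hi => by simp [hi]

/-- The contraction into `ℓ²(ι; E)` with the given coordinate maps. -/
def lpPi [NormedAddCommGroup F] [InnerProductSpace ℂ F] (R : ι → F →ₗ[ℂ] E)
    (hs : ∀ f, Summable fun i => ‖R i f‖ ^ 2) (hle : ∀ f, ∑' i, ‖R i f‖ ^ 2 ≤ ‖f‖ ^ 2) :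
    F →L[ℂ] lp (fun _ : ι => E) 2 :=
  LinearMap.mkContinuous
    { toFun := fun f => ⟨fun i => R i f, memℓp_two_of_summable_sq (hs f)⟩
      map_add' := fun f g => lp.ext (funext fun i => map_add (R i) f g)
      map_smul' := fun c f => lp.ext (funext fun i => map_smul (R i) c f) }
    1 (fun f => by
      rw [one_mul]
      refine le_of_sq_le_sq ?_ (norm_nonneg _)
      rw [← (hasSum_norm_sq_lp _).tsum_eq]
      exact hle f)

theorem lpPi_apply [NormedAddCommGroup F] [InnerProductSpace ℂ F] (R : ι → F →ₗ[ℂ] E)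
    (hs : ∀ f, Summable fun i => ‖R i f‖ ^ 2) (hle : ∀ f, ∑' i, ‖R i f‖ ^ 2 ≤ ‖f‖ ^ 2)
    (f : F) (i : ι) : lpPi R hs hle f i = R i f := rfl

theorem norm_lpPi_le [NormedAddCommGroup F] [InnerProductSpace ℂ F] (R : ι → F →ₗ[ℂ] E)
    (hs : ∀ f, Summable fun i => ‖R i f‖ ^ 2) (hle : ∀ f, ∑' i, ‖R i f‖ ^ 2 ≤ ‖f‖ ^ 2) :
    ‖lpPi R hs hle‖ ≤ 1 :=
  LinearMap.mkContinuous_norm_le _ zero_le_one _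

end HilbertSum

/-! ### Restriction to the discs of a periodic domain -/

section Restriction

open scoped ComplexConjugate

variable {Ω : TopologicalSpace.Opens ℂ} {R₀ : ℝ}

/-- The affine map of the unit disc onto the disc of radius `R₀` centred at `m`. -/
def discMap (R₀ : ℝ) (m : ℤ) (z : ℂ) : ℂ := (m : ℂ) + R₀ • z

/-- `discMap` as a homeomorphism of the plane. -/
def discHomeomorph (R₀ : ℝ) (hR : R₀ ≠ 0) (m : ℤ) : ℂ ≃ₜ ℂ :=
  (Homeomorph.smulOfNeZero R₀ hR).trans (Homeomorph.addLeft (m : ℂ))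

theorem measurableEmbedding_discMap (hR : 0 < R₀) (m : ℤ) : MeasurableEmbedding (discMap R₀ m) :=
  (discHomeomorph R₀ hR.ne' m).measurableEmbedding

theorem discMap_preimage_ball (hR : 0 < R₀) (m : ℤ) :
    discMap R₀ m ⁻¹' ball (m : ℂ) R₀ = ball 0 1 := by
  ext z
  rw [mem_preimage, mem_ball_iff_norm, mem_ball_zero_iff, discMap, add_sub_cancel_left, norm_smul,
    Real.norm_eq_abs, abs_of_pos hR]
  exact mul_lt_iff_lt_one_right hR

theorem map_discMap_restrict (hR : 0 < R₀) (m : ℤ) :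
    Measure.map (discMap R₀ m) (volume.restrict (ball 0 1)) =
      ENNReal.ofReal (R₀ ^ 2)⁻¹ • volume.restrict (ball (m : ℂ) R₀) := by
  have h1 : Measure.map (discMap R₀ m) volume = ENNReal.ofReal (R₀ ^ 2)⁻¹ • volume := by
    have e : discMap R₀ m = (fun z => (m : ℂ) + z) ∘ (fun z : ℂ => R₀ • z) := rfl
    rw [e, ← Measure.map_map (by fun_prop) (by fun_prop), Measure.map_addHaar_smul _ hR.ne',
      Measure.map_smul, map_add_left_eq_self, Complex.finrank_real_complex,
      abs_of_pos (by positivity)]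
  rw [← discMap_preimage_ball hR m, ← (measurableEmbedding_discMap hR m).restrict_map, h1,
    Measure.restrict_smul]

theorem quasiMeasurePreserving_discMap (hR : 0 < R₀) (m : ℤ)
    (hΩ : ball (m : ℂ) R₀ ⊆ Ω) :
    Measure.QuasiMeasurePreserving (discMap R₀ m) (volume.restrict (unitDisc : Set ℂ))
      (volume.restrict (Ω : Set ℂ)) := by
  refine ⟨(measurableEmbedding_discMap hR m).measurable, ?_⟩
  change Measure.map (discMap R₀ m) (volume.restrict (ball 0 1)) ≪ _
  rw [map_discMap_restrict hR m]
  exact Measure.AbsolutelyContinuous.smul_left (Measure.absolutelyContinuous_of_le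
    (Measure.restrict_mono hΩ le_rfl)) _

theorem integral_comp_discMap (hR : 0 < R₀) (m : ℤ) (F : ℂ → ℂ) :
    ∫ z in (unitDisc : Set ℂ), (R₀ : ℂ) ^ 2 * F (discMap R₀ m z) = ∫ z in ball (m : ℂ) R₀, F z := by
  have h := (measurableEmbedding_discMap hR m).integral_map (μ := volume.restrict (ball 0 1)) F
  rw [map_discMap_restrict hR m, integral_smul_measure, ENNReal.toReal_ofReal (by positivity)] at h
  rw [integral_const_mul]
  change (R₀ : ℂ) ^ 2 * ∫ z in ball 0 1, F (discMap R₀ m z) = _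
  rw [← h, Complex.real_smul]
  have : (R₀ : ℂ) ≠ 0 := by exact_mod_cast hR.ne'
  push_cast
  field_simp

theorem memLp_comp_discMap (hR : 0 < R₀) (m : ℤ) (hΩ : ball (m : ℂ) R₀ ⊆ Ω) {f : ℂ → ℂ}
    (hf : MemLp f 2 (volume.restrict (Ω : Set ℂ))) :
    MemLp (fun z => (R₀ : ℂ) * f (discMap R₀ m z)) 2 (volume.restrict (unitDisc : Set ℂ)) := by
  have h1 : MemLp f 2 (Measure.map (discMap R₀ m) (volume.restrict (ball 0 1))) := by
    rw [map_discMap_restrict hR m]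
    exact (hf.mono_measure (Measure.restrict_mono hΩ le_rfl)).smul_measure ENNReal.ofReal_ne_top
  exact ((measurableEmbedding_discMap hR m).memLp_map_measure_iff.1 h1).const_mul _

/-- The underlying function of `restrictDisc`. -/
def restrictDiscFun (hR : 0 < R₀) (hΩ : ∀ m : ℤ, ball (m : ℂ) R₀ ⊆ Ω) (m : ℤ) (f : bergman Ω) :
    bergman unitDisc :=
  ⟨(memLp_comp_discMap hR m (hΩ m) (Lp.memLp (f : L2 Ω))).toLp _, by
    obtain ⟨g, hg, hfg⟩ := f.2
    refine ⟨fun z => (R₀ : ℂ) * g (discMap R₀ m z), ?_, ?_⟩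
    · refine DifferentiableOn.const_mul (hg.comp ?_ ?_) _
      · unfold discMap; fun_prop
      · intro z hz
        apply hΩ m
        rwa [← mem_preimage, discMap_preimage_ball hR m]
    · refine (MemLp.coeFn_toLp _).trans ?_
      filter_upwards [(quasiMeasurePreserving_discMap hR m (hΩ m)).ae hfg] with z hz
      rw [hz]⟩

theorem coeFn_restrictDiscFun (hR : 0 < R₀) (hΩ : ∀ m : ℤ, ball (m : ℂ) R₀ ⊆ Ω) (m : ℤ)
    (f : bergman Ω) :
    ((restrictDiscFun hR hΩ m f : L2 unitDisc) : ℂ → ℂ)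
      =ᵐ[volume.restrict (unitDisc : Set ℂ)] fun z => (R₀ : ℂ) * (f : L2 Ω) (discMap R₀ m z) :=
  MemLp.coeFn_toLp (memLp_comp_discMap hR m (hΩ m) (Lp.memLp (f : L2 Ω)))

theorem bergman_ext {f g : bergman Ω}
    (h : ((f : L2 Ω) : ℂ → ℂ) =ᵐ[volume.restrict (Ω : Set ℂ)] ((g : L2 Ω) : ℂ → ℂ)) : f = g :=
  Subtype.ext (Lp.ext h)

theorem coeFn_bergman_add (f g : bergman Ω) :
    (((f + g : bergman Ω) : L2 Ω) : ℂ → ℂ) =ᵐ[volume.restrict (Ω : Set ℂ)]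
      fun z => (f : L2 Ω) z + (g : L2 Ω) z :=
  Lp.coeFn_add (f : L2 Ω) (g : L2 Ω)

theorem coeFn_bergman_smul (c : ℂ) (f : bergman Ω) :
    (((c • f : bergman Ω) : L2 Ω) : ℂ → ℂ) =ᵐ[volume.restrict (Ω : Set ℂ)]
      fun z => c * (f : L2 Ω) z :=
  Lp.coeFn_smul c (f : L2 Ω)

/-- The restriction of a function in `A²(Ω)` to the disc of radius `R₀` centred at `m`, transported
to the unit disc. The factor `R₀` makes the transport unitary. -/
def restrictDisc (hR : 0 < R₀) (hΩ : ∀ m : ℤ, ball (m : ℂ) R₀ ⊆ Ω) (m : ℤ) :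
    bergman Ω →ₗ[ℂ] bergman unitDisc where
  toFun f := restrictDiscFun hR hΩ m f
  map_add' f g := by
    apply bergman_ext
    filter_upwards [coeFn_restrictDiscFun hR hΩ m (f + g), coeFn_restrictDiscFun hR hΩ m f,
      coeFn_restrictDiscFun hR hΩ m g,
      coeFn_bergman_add (restrictDiscFun hR hΩ m f) (restrictDiscFun hR hΩ m g),
      (quasiMeasurePreserving_discMap hR m (hΩ m)).ae (coeFn_bergman_add f g)] with z h1 h2 h3 h4 h5
    rw [h1, h4, h2, h3, h5, mul_add]
  map_smul' c f := by
    apply bergman_ext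
    filter_upwards [coeFn_restrictDiscFun hR hΩ m (c • f), coeFn_restrictDiscFun hR hΩ m f,
      coeFn_bergman_smul c (restrictDiscFun hR hΩ m f),
      (quasiMeasurePreserving_discMap hR m (hΩ m)).ae (coeFn_bergman_smul c f)] with z h1 h2 h3 h4
    rw [h1, RingHom.id_apply, h3, h2, h4]
    ring

variable (hR : 0 < R₀) (hΩ : ∀ m : ℤ, ball (m : ℂ) R₀ ⊆ Ω)

theorem coeFn_restrictDisc (m : ℤ) (f : bergman Ω) :
    ((restrictDisc hR hΩ m f : L2 unitDisc) : ℂ → ℂ)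
      =ᵐ[volume.restrict (unitDisc : Set ℂ)] fun z => (R₀ : ℂ) * (f : L2 Ω) (discMap R₀ m z) :=
  coeFn_restrictDiscFun hR hΩ m f

theorem inner_restrictDisc (m : ℤ) (f g : bergman Ω) :
    inner ℂ (restrictDisc hR hΩ m f) (restrictDisc hR hΩ m g) =
      ∫ z in ball (m : ℂ) R₀, conj ((f : L2 Ω) z) * (g : L2 Ω) z := by
  rw [inner_bergman, ← integral_comp_discMap hR]
  refine integral_congr_ae ?_
  filter_upwards [coeFn_restrictDisc hR hΩ m f, coeFn_restrictDisc hR hΩ m g] with z h1 h2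
  rw [h1, h2, map_mul, Complex.conj_ofReal]
  ring

theorem pairwise_disjoint_ball_intCast (hR' : R₀ < 1 / 2) :
    Pairwise (Function.onFun Disjoint fun m : ℤ => ball (m : ℂ) R₀) := by
  intro m n hmn
  apply ball_disjoint_ball
  rw [dist_eq_norm, ← Int.cast_sub, Complex.norm_intCast]
  have : (1 : ℝ) ≤ |((m - n : ℤ) : ℝ)| := by
    exact_mod_cast Int.one_le_abs (sub_ne_zero.2 hmn)
  linarith

omit hR hΩ in
theorem integral_conj_mul_self (s : Set ℂ) (f : ℂ → ℂ) :
    ∫ z in s, conj (f z) * f z = ((∫ z in s, ‖f z‖ ^ 2 : ℝ) : ℂ) := by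
  rw [← integral_complex_ofReal]
  refine integral_congr_ae (Eventually.of_forall fun z => ?_)
  simp [Complex.conj_mul']

omit hR hΩ in
theorem norm_sq_bergman (f : bergman Ω) : ‖f‖ ^ 2 = ∫ z in (Ω : Set ℂ), ‖(f : L2 Ω) z‖ ^ 2 := by
  have h := inner_self_eq_norm_sq_to_K (𝕜 := ℂ) (E := bergman Ω) f
  rw [inner_bergman, integral_conj_mul_self] at h
  apply Complex.ofReal_injective
  rw [h, Complex.ofReal_pow]
  rfl

omit hR hΩ in
theorem integrableOn_norm_sq_bergman (f : bergman Ω) :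
    IntegrableOn (fun z => ‖(f : L2 Ω) z‖ ^ 2) Ω :=
  (memLp_two_iff_integrable_sq_norm (Lp.memLp (f : L2 Ω)).1).1 (Lp.memLp (f : L2 Ω))

theorem norm_sq_restrictDisc (m : ℤ) (f : bergman Ω) :
    ‖restrictDisc hR hΩ m f‖ ^ 2 = ∫ z in ball (m : ℂ) R₀, ‖(f : L2 Ω) z‖ ^ 2 := by
  have h := inner_self_eq_norm_sq_to_K (𝕜 := ℂ) (E := bergman unitDisc) (restrictDisc hR hΩ m f)
  rw [inner_restrictDisc, integral_conj_mul_self] at h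
  apply Complex.ofReal_injective
  rw [h, Complex.ofReal_pow]
  rfl

theorem hasSum_norm_sq_restrictDisc (hR' : R₀ < 1 / 2) (f : bergman Ω) :
    HasSum (fun m : ℤ => ‖restrictDisc hR hΩ m f‖ ^ 2)
      (∫ z in ⋃ m : ℤ, ball (m : ℂ) R₀, ‖(f : L2 Ω) z‖ ^ 2) := by
  simp only [norm_sq_restrictDisc]
  exact hasSum_integral_iUnion (fun m : ℤ => measurableSet_ball)
    (pairwise_disjoint_ball_intCast hR')
    ((integrableOn_norm_sq_bergman f).mono_set (iUnion_subset hΩ))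

omit hR in
include hΩ in
theorem setIntegral_iUnion_ball_le (f : bergman Ω) :
    ∫ z in ⋃ m : ℤ, ball (m : ℂ) R₀, ‖(f : L2 Ω) z‖ ^ 2 ≤ ‖f‖ ^ 2 := by
  rw [norm_sq_bergman]
  exact setIntegral_mono_set (integrableOn_norm_sq_bergman f)
    (Eventually.of_forall fun z => sq_nonneg _) (iUnion_subset hΩ).eventuallyLE

/-- The Hilbert sum of the Bergman spaces of the discs centred at the integers. -/
abbrev DiscSum : Type := lp (fun _ : ℤ => bergman unitDisc) 2

/-- Restriction to all the discs of radius `R₀` centred at the integers. -/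
def restrictDiscs (hR' : R₀ < 1 / 2) : bergman Ω →L[ℂ] DiscSum :=
  lpPi (restrictDisc hR hΩ) (fun f => (hasSum_norm_sq_restrictDisc hR hΩ hR' f).summable)
    (fun f => (hasSum_norm_sq_restrictDisc hR hΩ hR' f).tsum_eq.trans_le
      (setIntegral_iUnion_ball_le hΩ f))

variable (hR' : R₀ < 1 / 2)

theorem restrictDiscs_apply (f : bergman Ω) (m : ℤ) :
    restrictDiscs hR hΩ hR' f m = restrictDisc hR hΩ m f := lpPi_apply _ _ _ f m

theorem norm_restrictDiscs_le : ‖restrictDiscs hR hΩ hR'‖ ≤ 1 :=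
  norm_lpPi_le _ _ _

theorem norm_sq_restrictDiscs (f : bergman Ω) :
    ‖restrictDiscs hR hΩ hR' f‖ ^ 2 = ∫ z in ⋃ m : ℤ, ball (m : ℂ) R₀, ‖(f : L2 Ω) z‖ ^ 2 := by
  have h1 := hasSum_norm_sq_lp (restrictDiscs hR hΩ hR' f)
  simp only [restrictDiscs_apply] at h1
  exact h1.unique (hasSum_norm_sq_restrictDisc hR hΩ hR' f)

/-- The defect of isometry of the restriction is the mass outside of the discs. -/
theorem norm_sq_sub_norm_sq_restrictDiscs (f : bergman Ω) :
    ‖f‖ ^ 2 - ‖restrictDiscs hR hΩ hR' f‖ ^ 2 =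
      ∫ z in (Ω : Set ℂ) \ ⋃ m : ℤ, ball (m : ℂ) R₀, ‖(f : L2 Ω) z‖ ^ 2 := by
  rw [norm_sq_restrictDiscs, norm_sq_bergman, setIntegral_sdiff
    (MeasurableSet.iUnion fun m => measurableSet_ball) (integrableOn_norm_sq_bergman f)
    (iUnion_subset hΩ)]

/-! ### The periodic symbol -/

theorem periodicSymbol_discMap (hR' : R₀ < 1 / 2) (hR : 0 < R₀) (b : ℂ → ℝ) (m : ℤ) {z : ℂ}
    (hz : z ∈ ball (0 : ℂ) 1) : periodicSymbol b R₀ (discMap R₀ m z) = b z := by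
  have hn : ‖R₀ • z‖ < R₀ := by
    rw [norm_smul, Real.norm_eq_abs, abs_of_pos hR]
    exact mul_lt_of_lt_one_right hR (mem_ball_zero_iff.1 hz)
  -- the discs have radius less than `1 / 2`, so `m` is the integer nearest to the real part
  have hfl : ⌊(discMap R₀ m z).re + 1 / 2⌋ = m := by
    have h1 := (Complex.abs_re_le_norm (R₀ • z)).trans_lt hn
    rw [abs_lt] at h1
    rw [Int.floor_eq_iff, discMap, Complex.add_re, Complex.intCast_re]
    constructor <;> linarith [h1.1, h1.2]
  have hsub : discMap R₀ m z - m = R₀ • z := by simp [discMap]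
  have hR0 : (R₀ : ℂ) ≠ 0 := by exact_mod_cast hR.ne'
  rw [periodicSymbol, hfl, hsub, if_pos (by rwa [mem_ball_zero_iff]), Complex.real_smul,
    mul_div_cancel_left₀ _ hR0]

theorem periodicSymbol_eq_zero (b : ℂ → ℝ) {z : ℂ} (hz : z ∉ ⋃ m : ℤ, ball (m : ℂ) R₀) :
    periodicSymbol b R₀ z = 0 := by
  rw [periodicSymbol, if_neg]
  intro h
  apply hz
  rw [mem_iUnion]
  refine ⟨⌊z.re + 1 / 2⌋, ?_⟩
  rwa [mem_ball_iff_norm, ← mem_ball_zero_iff]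

end Restriction

/-! ### The periodic Toeplitz operator as a compression -/

section Periodic

open scoped ComplexConjugate
open ContinuousLinearMap (adjoint)

variable {Ω : TopologicalSpace.Opens ℂ} {R₀ : ℝ}

theorem ae_restrict_ball_of_discMap (hR : 0 < R₀) (m : ℤ) {p : ℂ → Prop}
    (h : ∀ᵐ z ∂(volume.restrict (unitDisc : Set ℂ)), p (discMap R₀ m z)) :
    ∀ᵐ z ∂(volume.restrict (ball (m : ℂ) R₀)), p z := by
  have h1 : ∀ᵐ z ∂(Measure.map (discMap R₀ m) (volume.restrict (ball 0 1))), p z :=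
    (measurableEmbedding_discMap hR m).ae_map_iff.2 h
  rw [map_discMap_restrict hR m] at h1
  exact (Measure.absolutelyContinuous_smul (by simpa using hR.ne')).ae_le h1

theorem isSymbol_periodicSymbol (hR : 0 < R₀) (hR' : R₀ < 1 / 2) {b : ℂ → ℝ}
    (hb : IsSymbol unitDisc fun z => (b z : ℂ)) (Ω : TopologicalSpace.Opens ℂ) :
    IsSymbol Ω fun z => (periodicSymbol b R₀ z : ℂ) := by
  set a : ℂ → ℂ := fun z => (periodicSymbol b R₀ z : ℂ) with ha
  set U : Set ℂ := ⋃ m : ℤ, ball (m : ℂ) R₀ with hU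
  have hUm : MeasurableSet U := MeasurableSet.iUnion fun m => measurableSet_ball
  have hcomp : ∀ m : ℤ, ∀ᵐ z ∂(volume.restrict (unitDisc : Set ℂ)),
      a (discMap R₀ m z) = (b z : ℂ) := by
    intro m
    filter_upwards [ae_restrict_mem unitDisc.isOpen.measurableSet] with z hz
    simp only [ha]
    rw [periodicSymbol_discMap hR' hR b m hz]
  have hoff : ∀ z, z ∉ U → a z = 0 := by
    intro z hz
    simp only [ha]
    rw [periodicSymbol_eq_zero b hz, Complex.ofReal_zero]
  have hmeas : AEStronglyMeasurable a volume := by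
    have h1 : AEStronglyMeasurable a (volume.restrict U) := by
      rw [hU, aestronglyMeasurable_iUnion_iff]
      intro m
      have h2 : AEStronglyMeasurable a
          (Measure.map (discMap R₀ m) (volume.restrict (ball 0 1))) := by
        rw [(measurableEmbedding_discMap hR m).aestronglyMeasurable_map_iff]
        exact hb.1.congr (EventuallyEq.symm (hcomp m))
      rw [map_discMap_restrict hR m] at h2
      exact h2.mono_ac (Measure.absolutelyContinuous_smul (by simpa using hR.ne'))
    have h3 : a = U.indicator a := by
      ext z
      by_cases hz : z ∈ U
      · rw [indicator_of_mem hz]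
      · rw [indicator_of_notMem hz, hoff z hz]
    rw [h3]
    exact (aestronglyMeasurable_indicator_iff hUm).2 h1
  set B := (eLpNormEssSup (fun z => (b z : ℂ)) (volume.restrict (unitDisc : Set ℂ))).toReal with hB
  have hbB : ∀ᵐ z ∂(volume.restrict (unitDisc : Set ℂ)), ‖(b z : ℂ)‖ ≤ B := by
    have h := hb.2
    rw [eLpNorm_exponent_top] at h
    filter_upwards [ae_le_eLpNormEssSup (f := fun z => (b z : ℂ))
      (μ := volume.restrict (unitDisc : Set ℂ))] with z hz
    rw [← toReal_enorm]
    exact ENNReal.toReal_mono h.ne hz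
  have hbound : ∀ᵐ z, ‖a z‖ ≤ B := by
    have h1 : ∀ᵐ z ∂(volume.restrict U), ‖a z‖ ≤ B := by
      rw [hU, ae_restrict_iUnion_iff]
      intro m
      apply ae_restrict_ball_of_discMap hR m
      filter_upwards [hcomp m, hbB] with z h1 h2
      rwa [h1]
    rw [ae_restrict_iff' hUm] at h1
    filter_upwards [h1] with z hz
    by_cases hzU : z ∈ U
    · exact hz hzU
    · rw [hoff z hzU, norm_zero]; exact ENNReal.toReal_nonneg
  exact memLp_top_of_bound hmeas.restrict B (ae_restrict_of_ae hbound)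

theorem integrable_conj_mul_symbol_mul {a : ℂ → ℂ} (ha : IsSymbol Ω a) (f g : bergman Ω) :
    IntegrableOn (fun z => conj ((f : L2 Ω) z) * (a z * (g : L2 Ω) z)) Ω := by
  have := L2.integrable_inner (𝕜 := ℂ) (f : L2 Ω) (mulOp Ω a ha (g : L2 Ω))
  refine this.congr ?_
  filter_upwards [coeFn_mulOp ha (g : L2 Ω)] with z hz
  rw [hz, RCLike.inner_apply']

variable (hR : 0 < R₀) (hΩ : ∀ m : ℤ, ball (m : ℂ) R₀ ⊆ Ω) (hR' : R₀ < 1 / 2)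
  {b : ℂ → ℝ} (hb : IsSymbol unitDisc fun z => (b z : ℂ))
  (ha : IsSymbol Ω fun z => (periodicSymbol b R₀ z : ℂ))

include hR' in
/-- The periodic symbol vanishes outside of the discs, so the quadratic form of its Toeplitz
operator splits into the forms of `T_b` on the discs. -/
theorem hasSum_inner_toeplitz_restrictDisc (f g : bergman Ω) :
    HasSum (fun m : ℤ => inner ℂ (restrictDisc hR hΩ m f)
        (toeplitz unitDisc (fun z => (b z : ℂ)) hb (restrictDisc hR hΩ m g)))
      (inner ℂ f (toeplitz Ω (fun z => (periodicSymbol b R₀ z : ℂ)) ha g)) := by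
  have hint := integrable_conj_mul_symbol_mul ha f g
  set F : ℂ → ℂ := fun z => conj ((f : L2 Ω) z) * ((periodicSymbol b R₀ z : ℂ) * (g : L2 Ω) z)
    with hF
  have h1 : ∀ m : ℤ, inner ℂ (restrictDisc hR hΩ m f)
      (toeplitz unitDisc (fun z => (b z : ℂ)) hb (restrictDisc hR hΩ m g))
      = ∫ z in ball (m : ℂ) R₀, F z := by
    intro m
    rw [inner_toeplitz, ← integral_comp_discMap hR]
    refine integral_congr_ae ?_
    filter_upwards [coeFn_restrictDisc hR hΩ m f, coeFn_restrictDisc hR hΩ m g,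
      ae_restrict_mem unitDisc.isOpen.measurableSet] with z h1 h2 h3
    rw [h1, h2, map_mul, Complex.conj_ofReal]
    simp only [hF]
    rw [periodicSymbol_discMap hR' hR b m h3]
    ring
  have h2 : inner ℂ f (toeplitz Ω (fun z => (periodicSymbol b R₀ z : ℂ)) ha g)
      = ∫ z in ⋃ m : ℤ, ball (m : ℂ) R₀, F z := by
    rw [inner_toeplitz]
    refine setIntegral_eq_of_subset_of_forall_sdiff_eq_zero Ω.isOpen.measurableSet
      (iUnion_subset hΩ) fun z hz => ?_
    rw [periodicSymbol_eq_zero b hz.2, Complex.ofReal_zero, zero_mul, mul_zero]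
  simp only [h1, h2]
  exact hasSum_integral_iUnion (fun m : ℤ => measurableSet_ball)
    (pairwise_disjoint_ball_intCast hR') (hint.mono_set (iUnion_subset hΩ))

/-- The Toeplitz operator with periodic symbol is the compression of the direct sum of the Toeplitz
operators of the discs. -/
theorem toeplitz_periodicSymbol_eq_compress :
    toeplitz Ω (fun z => (periodicSymbol b R₀ z : ℂ)) ha =
      adjoint (restrictDiscs hR hΩ hR') ∘L lpMap ℤ (toeplitz unitDisc (fun z => (b z : ℂ)) hb) ∘L
        restrictDiscs hR hΩ hR' := by
  refine ContinuousLinearMap.ext fun g => ext_inner_left ℂ fun f => ?_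
  rw [ContinuousLinearMap.comp_apply, ContinuousLinearMap.adjoint_inner_right]
  have h1 := hasSum_inner_toeplitz_restrictDisc hR hΩ hR' hb ha f g
  have h2 := lp.hasSum_inner (𝕜 := ℂ) (restrictDiscs hR hΩ hR' f)
    (lpMap ℤ (toeplitz unitDisc (fun z => (b z : ℂ)) hb) (restrictDiscs hR hΩ hR' g))
  simp only [lpMap_apply, restrictDiscs_apply] at h2
  exact h1.unique h2

/-! ### Translations of the Bergman space of a periodic domain -/

theorem measurePreserving_add_intCast (hper : ∀ (k : ℤ) (z : ℂ), z + k ∈ Ω ↔ z ∈ Ω) (k : ℤ) :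
    MeasurePreserving (fun z : ℂ => z + k) (volume.restrict (Ω : Set ℂ))
      (volume.restrict (Ω : Set ℂ)) := by
  have h := (measurePreserving_add_right (volume : Measure ℂ) (k : ℂ)).restrict_preimage
    Ω.isOpen.measurableSet
  have e : (fun z : ℂ => z + k) ⁻¹' (Ω : Set ℂ) = Ω := by
    ext z; exact hper k z
  rwa [e] at h

/-- Translation `f ↦ f(· + k)` on the Bergman space of a periodic domain. -/
def bergmanTranslate (hper : ∀ (k : ℤ) (z : ℂ), z + k ∈ Ω ↔ z ∈ Ω) (k : ℤ) :
    bergman Ω →ₗ[ℂ] bergman Ω :=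
  ((Lp.compMeasurePreservingₗ ℂ _ (measurePreserving_add_intCast hper k)).comp
    (bergman Ω).subtype).codRestrict (bergman Ω) (by
      intro f
      obtain ⟨g, hg, hfg⟩ := f.2
      refine ⟨fun z => g (z + k), hg.comp (by fun_prop) (fun z hz => (hper k z).2 hz), ?_⟩
      have hmp := measurePreserving_add_intCast hper k
      exact (Lp.coeFn_compMeasurePreserving _ hmp).trans (hmp.quasiMeasurePreserving.ae hfg))

variable (hper : ∀ (k : ℤ) (z : ℂ), z + k ∈ Ω ↔ z ∈ Ω)

theorem coeFn_bergmanTranslate (k : ℤ) (f : bergman Ω) :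
    ((bergmanTranslate hper k f : L2 Ω) : ℂ → ℂ) =ᵐ[volume.restrict (Ω : Set ℂ)]
      fun z => (f : L2 Ω) (z + k) :=
  Lp.coeFn_compMeasurePreserving _ (measurePreserving_add_intCast hper k)

theorem norm_bergmanTranslate (k : ℤ) (f : bergman Ω) : ‖bergmanTranslate hper k f‖ = ‖f‖ :=
  Lp.norm_compMeasurePreserving _ (measurePreserving_add_intCast hper k)

theorem bergmanTranslate_bergmanTranslate_neg (k : ℤ) (f : bergman Ω) :
    bergmanTranslate hper k (bergmanTranslate hper (-k) f) = f := by
  apply bergman_ext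
  filter_upwards [coeFn_bergmanTranslate hper k (bergmanTranslate hper (-k) f),
    (measurePreserving_add_intCast hper k).quasiMeasurePreserving.ae
      (coeFn_bergmanTranslate hper (-k) f)]
    with z h1 h2
  rw [h1, h2]
  simp

theorem restrictDisc_bergmanTranslate (k m : ℤ) (f : bergman Ω) :
    restrictDisc hR hΩ m (bergmanTranslate hper k f) = restrictDisc hR hΩ (m + k) f := by
  apply bergman_ext
  filter_upwards [coeFn_restrictDisc hR hΩ m (bergmanTranslate hper k f),
    coeFn_restrictDisc hR hΩ (m + k) f,
    (quasiMeasurePreserving_discMap hR m (hΩ m)).ae (coeFn_bergmanTranslate hper k f)]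
    with z h1 h2 h3
  rw [h1, h2, h3]
  congr 2
  simp only [discMap]
  push_cast
  ring

include hR hΩ hR' hb in
theorem inner_bergmanTranslate_toeplitz (k : ℤ) (f g : bergman Ω) :
    inner ℂ (bergmanTranslate hper k f) (toeplitz Ω (fun z => (periodicSymbol b R₀ z : ℂ)) ha
      (bergmanTranslate hper k g)) =
    inner ℂ f (toeplitz Ω (fun z => (periodicSymbol b R₀ z : ℂ)) ha g) := by
  have h1 := hasSum_inner_toeplitz_restrictDisc hR hΩ hR' hb ha (bergmanTranslate hper k f)
    (bergmanTranslate hper k g)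
  simp only [restrictDisc_bergmanTranslate] at h1
  have h2 := hasSum_inner_toeplitz_restrictDisc hR hΩ hR' hb ha f g
  rw [← (Equiv.addRight k).hasSum_iff] at h2
  exact h1.unique h2

theorem inner_bergmanTranslate (k : ℤ) (f g : bergman Ω) :
    inner ℂ (bergmanTranslate hper k f) (bergmanTranslate hper k g) = inner ℂ f g :=
  LinearIsometry.inner_map_map ⟨bergmanTranslate hper k, norm_bergmanTranslate hper k⟩ f g

end Periodic

/-! ### Translations and the essential spectrum -/

/-- A nonzero spectral point of a self-adjoint operator `T` is in the essential spectrum as soon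
as `T` commutes with an operator `U` all of whose eigenvectors are killed by `T`: a
finite-dimensional eigenspace of `T` is invariant under `U`, hence, if nonzero, contains an
eigenvector of `U`. -/
theorem IsSelfAdjoint.mem_essSpectrum_of_commute {H : Type*} [NormedAddCommGroup H]
    [InnerProductSpace ℂ H] [CompleteSpace H] {T : H →L[ℂ] H} (hT : IsSelfAdjoint T)
    (U : H →ₗ[ℂ] H) (hU : ∀ f, T (U f) = U (T f)) (hUT : ∀ (c : ℂ) (f : H), U f = c • f → T f = 0)
    {μ : ℝ} (hμ : μ ≠ 0) (h : (μ : ℂ) ∈ spectrum ℂ T) : (μ : ℂ) ∈ essSpectrum T := by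
  intro hF
  rw [mem_spectrum_iff_not_isUnit] at h
  refine h ((hT.sub_ofReal_smul_id μ).isUnit_of_isFredholm hF ?_)
  set A := T - (μ : ℂ) • ContinuousLinearMap.id ℂ H with hA
  have hmem : ∀ f : H, f ∈ (A : H →ₗ[ℂ] H).ker ↔ T f = (μ : ℂ) • f := by
    intro f
    simp [hA, sub_eq_zero]
  have hinv : ∀ f ∈ (A : H →ₗ[ℂ] H).ker, U f ∈ (A : H →ₗ[ℂ] H).ker := by
    intro f hf
    rw [hmem] at hf ⊢
    rw [hU, hf, map_smul]
  have := hF.finite_ker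
  by_contra hne
  have : Nontrivial (A : H →ₗ[ℂ] H).ker := Submodule.nontrivial_iff_ne_bot.2 hne
  obtain ⟨c, hc⟩ := Module.End.exists_eigenvalue (U.restrict hinv)
  obtain ⟨f, hf⟩ := hc.exists_hasEigenvector
  have h1 : U f = c • (f : H) := congrArg Subtype.val hf.apply_eq_smul
  have h2 := (hmem f).1 f.2
  rw [hUT c f h1] at h2
  refine hf.2 (Subtype.ext ?_)
  have h3 := (smul_eq_zero.1 h2.symm).resolve_left (by exact_mod_cast hμ)
  exact h3

section Periodic

variable {Ω : TopologicalSpace.Opens ℂ} {R₀ : ℝ}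

/-- Eigenvectors of a translation vanish on the discs: the norms of the restrictions to the
discs are all equal, and square summable. -/
theorem restrictDiscs_eq_zero_of_bergmanTranslate_eq_smul (hR : 0 < R₀)
    (hΩ : ∀ m : ℤ, ball (m : ℂ) R₀ ⊆ Ω) (hR' : R₀ < 1 / 2)
    (hper : ∀ (k : ℤ) (z : ℂ), z + k ∈ Ω ↔ z ∈ Ω) {c : ℂ} {f : bergman Ω}
    (h : bergmanTranslate hper 1 f = c • f) : restrictDiscs hR hΩ hR' f = 0 := by
  rcases eq_or_ne f 0 with rfl | hf
  · exact map_zero _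
  have hc : ‖c‖ = 1 := by
    have h1 := norm_bergmanTranslate hper 1 f
    rw [h, norm_smul] at h1
    exact mul_right_cancel₀ (norm_ne_zero_iff.2 hf) (h1.trans (one_mul _).symm)
  have hstep : ∀ m : ℤ, ‖restrictDisc hR hΩ (m + 1) f‖ = ‖restrictDisc hR hΩ m f‖ := by
    intro m
    rw [← restrictDisc_bergmanTranslate hR hΩ hper 1 m f, h, map_smul, norm_smul, hc, one_mul]
  have hconst : ∀ m : ℤ, ‖restrictDisc hR hΩ m f‖ = ‖restrictDisc hR hΩ 0 f‖ := by
    intro m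
    induction m using Int.induction_on with
    | zero => rfl
    | succ i hi => rw [hstep, hi]
    | pred i hi => rw [← hi, ← hstep, sub_add_cancel]
  have hs := (hasSum_norm_sq_restrictDisc hR hΩ hR' f).summable
  simp only [hconst] at hs
  have h0 := summable_const_iff _ |>.1 hs
  ext1
  funext m
  rw [restrictDiscs_apply]
  have : ‖restrictDisc hR hΩ m f‖ = 0 := by
    rw [hconst]
    exact pow_eq_zero_iff (two_ne_zero) |>.1 h0
  exact norm_eq_zero.1 this

theorem toeplitz_bergmanTranslate (hR : 0 < R₀) (hΩ : ∀ m : ℤ, ball (m : ℂ) R₀ ⊆ Ω)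
    (hR' : R₀ < 1 / 2)
    {b : ℂ → ℝ} (hb : IsSymbol unitDisc fun z => (b z : ℂ))
    (ha : IsSymbol Ω fun z => (periodicSymbol b R₀ z : ℂ))
    (hper : ∀ (k : ℤ) (z : ℂ), z + k ∈ Ω ↔ z ∈ Ω) (k : ℤ) (f : bergman Ω) :
    toeplitz Ω (fun z => (periodicSymbol b R₀ z : ℂ)) ha (bergmanTranslate hper k f) =
      bergmanTranslate hper k (toeplitz Ω (fun z => (periodicSymbol b R₀ z : ℂ)) ha f) := by
  refine ext_inner_left ℂ fun g => ?_
  rw [← bergmanTranslate_bergmanTranslate_neg hper k g,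
    inner_bergmanTranslate_toeplitz hR hΩ hR' hb ha hper,
    inner_bergmanTranslate]

/-- Apart from `0`, the spectrum of the periodic Toeplitz operator is essential. -/
theorem mem_essSpectrum_toeplitz_periodicSymbol (hR : 0 < R₀)
    (hΩ : ∀ m : ℤ, ball (m : ℂ) R₀ ⊆ Ω) (hR' : R₀ < 1 / 2) {b : ℂ → ℝ}
    (hb : IsSymbol unitDisc fun z => (b z : ℂ))
    (ha : IsSymbol Ω fun z => (periodicSymbol b R₀ z : ℂ))
    (hper : ∀ (k : ℤ) (z : ℂ), z + k ∈ Ω ↔ z ∈ Ω) {μ : ℝ} (hμ : μ ≠ 0)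
    (h : (μ : ℂ) ∈ spectrum ℂ (toeplitz Ω (fun z => (periodicSymbol b R₀ z : ℂ)) ha)) :
    (μ : ℂ) ∈ essSpectrum (toeplitz Ω (fun z => (periodicSymbol b R₀ z : ℂ)) ha) := by
  refine (isSelfAdjoint_toeplitz ha).mem_essSpectrum_of_commute (bergmanTranslate hper 1)
    (toeplitz_bergmanTranslate hR hΩ hR' hb ha hper 1) (fun c f hf => ?_) hμ h
  rw [toeplitz_periodicSymbol_eq_compress hR hΩ hR' hb ha, ContinuousLinearMap.comp_apply,
    ContinuousLinearMap.comp_apply,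
    restrictDiscs_eq_zero_of_bergmanTranslate_eq_smul hR hΩ hR' hper hf, map_zero, map_zero]

end Periodic

/-! ### Localized test functions -/

/-- A rational function that is close to the monomial `(w / R₀) ^ n / R₀` for `|w| < R₀ < 1 / 2`
and small for `|w| > 1 / 2` if `N` is large. For even `N` it has no poles near the real axis. -/
def bump (R₀ : ℝ) (n N : ℕ) (w : ℂ) : ℂ :=
  (w / R₀) ^ n / R₀ / (1 + (2 * w) ^ N)

/-- The decay of the test functions over the cells of the periodic domain. -/
def cellWeight (l : ℤ) : ℝ := (1 + (l : ℝ) ^ 2)⁻¹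

theorem cellWeight_nonneg (l : ℤ) : 0 ≤ cellWeight l := by
  unfold cellWeight; positivity

theorem summable_cellWeight : Summable cellWeight := by
  have h : Summable fun l : ℤ => 1 / |(l : ℝ)| ^ (2 : ℝ) :=
    Real.summable_abs_int_rpow (b := 2) (by norm_num) |>.congr fun l => by
      rw [Real.rpow_neg (abs_nonneg _), one_div]
  refine Summable.of_norm_bounded_eventually (g := fun l : ℤ => 1 / |(l : ℝ)| ^ (2 : ℝ)) h ?_
  have : ({0}ᶜ : Set ℤ) ∈ cofinite := (Set.finite_singleton 0).compl_mem_cofinite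
  filter_upwards [this] with l hl
  have hl' : (0 : ℝ) < (l : ℝ) ^ 2 := by
    have : (l : ℝ) ≠ 0 := by simpa using hl
    positivity
  rw [Real.norm_of_nonneg (cellWeight_nonneg l), cellWeight, Real.rpow_two, sq_abs, one_div]
  exact inv_anti₀ hl' (by linarith)

section Bounds

variable {R₀ : ℝ} {n N : ℕ} {w : ℂ}

theorem norm_monomial_le (hR : 1 / 4 < R₀) : ‖(w / R₀) ^ n / R₀‖ ≤ 4 * (4 * ‖w‖) ^ n := by
  have h0 : 0 < R₀ := by linarith
  have h4 : 1 / R₀ ≤ 4 := by rw [div_le_iff₀ h0]; linarith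
  rw [norm_div, norm_pow, norm_div, Complex.norm_real, Real.norm_of_nonneg h0.le,
    div_eq_mul_one_div, div_eq_mul_one_div ‖w‖, mul_comm, mul_comm ‖w‖]
  gcongr

theorem norm_bump_le_of_half_le (hR : 1 / 4 < R₀) (h : 1 / 2 ≤ ‖1 + (2 * w) ^ N‖) :
    ‖bump R₀ n N w‖ ≤ 8 * (4 * ‖w‖) ^ n := by
  rw [bump, norm_div, div_le_iff₀ (by linarith)]
  have h1 := norm_monomial_le (n := n) (w := w) hR
  have h2 : 0 ≤ 8 * (4 * ‖w‖) ^ n := by positivity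
  nlinarith

theorem half_le_norm_one_add_pow_of_two_le (h : 2 ≤ (2 * ‖w‖) ^ N) :
    1 / 2 * (2 * ‖w‖) ^ N ≤ ‖1 + (2 * w) ^ N‖ := by
  have h1 : ‖(2 * w) ^ N‖ = (2 * ‖w‖) ^ N := by simp
  have h2 := norm_sub_le (1 + (2 * w) ^ N) 1
  rw [add_sub_cancel_left, h1, norm_one] at h2
  linarith

theorem half_le_norm_one_add_pow_of_le_half (h : (2 * ‖w‖) ^ N ≤ 1 / 2) :
    1 / 2 ≤ ‖1 + (2 * w) ^ N‖ := by
  have h1 : ‖(2 * w) ^ N‖ = (2 * ‖w‖) ^ N := by simp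
  have h2 := norm_sub_le (1 + (2 * w) ^ N) ((2 * w) ^ N)
  rw [add_sub_cancel_right, h1, norm_one] at h2
  linarith

theorem norm_bump_le_cellWeight (hR : 1 / 4 < R₀) {K : ℝ} (hK : 0 < K) {l : ℤ} (hl : l ≠ 0)
    (hlt : |(l : ℝ)| ≤ 2 * ‖w‖) (h2 : 2 ≤ (2 * ‖w‖) ^ N)
    (hN : K * (2 * ‖w‖) ^ (n + 2) ≤ (2 * ‖w‖) ^ N) :
    ‖bump R₀ n N w‖ ≤ 16 * 2 ^ n / K * cellWeight l := by
  set t := 2 * ‖w‖ with ht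
  have hl1 : 1 ≤ |(l : ℝ)| := by exact_mod_cast Int.one_le_abs hl
  have ht1 : 1 ≤ t := hl1.trans hlt
  have h3 := half_le_norm_one_add_pow_of_two_le h2
  rw [← ht] at h3
  have h4 := norm_monomial_le (n := n) (w := w) hR
  rw [show 4 * ‖w‖ = 2 * t by rw [ht]; ring, mul_pow] at h4
  have hden : 0 < 1 / 2 * (K * t ^ (n + 2)) := by positivity
  have hl2 : 1 + (l : ℝ) ^ 2 ≤ 2 * t ^ 2 := by
    have : (l : ℝ) ^ 2 ≤ t ^ 2 := by rw [← sq_abs]; gcongr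
    have : 1 ≤ t ^ 2 := one_le_pow₀ ht1
    linarith
  calc ‖bump R₀ n N w‖ ≤ 4 * (2 ^ n * t ^ n) / (1 / 2 * (K * t ^ (n + 2))) := by
        rw [bump, norm_div]
        gcongr
        exact (mul_le_mul_of_nonneg_left hN (by norm_num)).trans h3
    _ = 16 * 2 ^ n / K * (2 * t ^ 2)⁻¹ := by
        field_simp
        ring
    _ ≤ _ := by
        unfold cellWeight
        gcongr

/-- On the disc `|w| < R₀` the test function is close to the monomial. -/
theorem norm_bump_sub_monomial_le (hR : 1 / 4 < R₀) (hw : ‖w‖ < R₀)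
    (hq : (2 * R₀) ^ N ≤ 1 / 2) :
    ‖bump R₀ n N w - (w / R₀) ^ n / R₀‖ ≤ 8 * (2 * R₀) ^ N := by
  have h0 : 0 < R₀ := by linarith
  have hq' : (2 * ‖w‖) ^ N ≤ (2 * R₀) ^ N := by gcongr
  have h1 := half_le_norm_one_add_pow_of_le_half (hq'.trans hq)
  have hne : 1 + (2 * w) ^ N ≠ 0 := by
    intro h
    rw [h, norm_zero] at h1
    linarith
  have hp : ‖(w / R₀) ^ n / R₀‖ ≤ 4 := by
    rw [norm_div, norm_pow, norm_div, Complex.norm_real, Real.norm_of_nonneg h0.le,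
      div_le_iff₀ h0]
    have : (‖w‖ / R₀) ^ n ≤ 1 := pow_le_one₀ (by positivity) ((div_le_one h0).2 hw.le)
    linarith
  have heq : bump R₀ n N w - (w / R₀) ^ n / R₀ =
      -((w / R₀) ^ n / R₀ * (2 * w) ^ N / (1 + (2 * w) ^ N)) := by
    rw [bump]
    generalize (w / R₀) ^ n / R₀ = p
    generalize (2 * w) ^ N = q at hne
    field_simp
    ring
  rw [heq, norm_neg, norm_div, norm_mul, div_le_iff₀ (by linarith)]
  have h2 : ‖(2 * w) ^ N‖ ≤ (2 * R₀) ^ N := by simpa using hq'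
  have h3 : 0 ≤ (2 * R₀) ^ N := by positivity
  calc _ ≤ 4 * (2 * R₀) ^ N := by gcongr
    _ ≤ _ := by nlinarith

/-- For even `N` the denominator is at least `1` on the real axis, so it is bounded below near
the real axis. -/
theorem exists_half_le_norm_one_add_pow (hN : Even N) :
    ∃ h₀ > 0, ∀ w : ℂ, ‖w‖ ≤ 2 → |w.im| < h₀ → 1 / 2 ≤ ‖1 + (2 * w) ^ N‖ := by
  have huc : UniformContinuousOn (fun w : ℂ => 1 + (2 * w) ^ N) (closedBall 0 2) :=
    (isCompact_closedBall 0 2).uniformContinuousOn_of_continuous (by fun_prop)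
  rw [Metric.uniformContinuousOn_iff] at huc
  obtain ⟨h₀, hh, huc⟩ := huc (1 / 2) (by norm_num)
  refine ⟨h₀, hh, fun w hw hi => ?_⟩
  have hre : ‖(w.re : ℂ)‖ ≤ 2 := by
    rw [Complex.norm_real]
    exact (Complex.abs_re_le_norm w).trans hw
  have h1 := huc w (by simpa using hw) w.re (by simpa using hre) (by
    rw [dist_eq_norm]
    have : w - w.re = w.im * Complex.I := by
      apply Complex.ext <;> simp
    rw [this]
    simpa using hi)
  have h2 : 1 ≤ ‖1 + (2 * (w.re : ℂ)) ^ N‖ := by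
    have : 1 + (2 * (w.re : ℂ)) ^ N = ((1 + (2 * w.re) ^ N : ℝ) : ℂ) := by push_cast; rfl
    rw [this, Complex.norm_real, Real.norm_eq_abs]
    refine le_trans ?_ (le_abs_self _)
    linarith [hN.pow_nonneg (2 * w.re)]
  rw [dist_comm, dist_eq_norm] at h1
  have h3 := norm_sub_norm_le (1 + (2 * (w.re : ℂ)) ^ N) (1 + (2 * w) ^ N)
  linarith

end Bounds

theorem floor_re_add_half_eq {R₀ : ℝ} (hR' : R₀ < 1 / 2) {l : ℤ} {w : ℂ}
    (hw : ‖w - l‖ < R₀) : ⌊w.re + 1 / 2⌋ = l := by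
  have h1 := (Complex.abs_re_le_norm (w - l)).trans_lt hw
  rw [Complex.sub_re, Complex.intCast_re, abs_lt] at h1
  rw [Int.floor_eq_iff]
  constructor <;> linarith

/-- The properties of the test functions that are needed: they are close to the monomial on the
central disc, small on the other discs, and bounded with decay everywhere in the periodic
domain. -/
theorem exists_bump {R₀ : ℝ} (hR : 1 / 4 < R₀) (hR' : R₀ < 1 / 2) (n : ℕ) {τ : ℝ} (hτ : 0 < τ) :
    ∃ (N : ℕ) (C h₀ : ℝ), 0 ≤ C ∧ 0 < h₀ ∧
      (∀ w : ℂ, ‖w‖ < R₀ → ‖bump R₀ n N w - (w / R₀) ^ n / R₀‖ ≤ τ) ∧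
      (∀ l : ℤ, l ≠ 0 → ∀ w : ℂ, ‖w - l‖ < R₀ → ‖bump R₀ n N w‖ ≤ τ * cellWeight l) ∧
      ∀ w : ℂ, (|w.im| < h₀ ∨ ∃ l : ℤ, ‖w - l‖ < R₀) →
        1 + (2 * w) ^ N ≠ 0 ∧ ‖bump R₀ n N w‖ ≤ C * cellWeight ⌊w.re + 1 / 2⌋ := by
  set ρ : ℝ := 2 * (1 - R₀) with hρ
  have hρ1 : 1 < ρ := by rw [hρ]; linarith
  -- `ρ` bounds `2 * ‖w‖` from below on the discs away from the origin, and `K` is the gain that is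
  -- required of the powers of `ρ`
  set K : ℝ := max 2 (16 * 2 ^ n / τ) with hK
  have hK2 : 2 ≤ K := le_max_left _ _
  have hKτ : 16 * 2 ^ n / K ≤ τ := by
    rw [div_le_iff₀ (by linarith), ← div_le_iff₀' hτ]
    exact le_max_right _ _
  obtain ⟨N, hNe, hNn, hNK, hNq⟩ : ∃ N : ℕ, Even N ∧ n + 2 ≤ N ∧ K ≤ ρ ^ (N - (n + 2)) ∧
      (2 * R₀) ^ N ≤ min (1 / 2) (τ / 8) := by
    have h1 : ∀ᶠ N : ℕ in atTop, K ≤ ρ ^ (N - (n + 2)) :=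
      ((tendsto_pow_atTop_atTop_of_one_lt hρ1).comp (tendsto_sub_atTop_nat _)).eventually_ge_atTop K
    have h2 : ∀ᶠ N : ℕ in atTop, (2 * R₀) ^ N ≤ min (1 / 2) (τ / 8) :=
      ((tendsto_pow_atTop_nhds_zero_of_lt_one (by linarith) (by linarith)).eventually_le_const
        (by positivity))
    obtain ⟨M, hM⟩ := eventually_atTop.1 (h1.and (h2.and (eventually_ge_atTop (n + 2))))
    obtain ⟨a, b, c⟩ := hM (2 * M) (by omega)
    exact ⟨2 * M, even_two_mul M, c, a, b⟩
  obtain ⟨h₁, hh₁, hden⟩ := exists_half_le_norm_one_add_pow hNe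
  -- the discs away from the origin
  have hfar : ∀ l : ℤ, l ≠ 0 → ∀ w : ℂ, ‖w - l‖ < R₀ → ρ ≤ 2 * ‖w‖ ∧ |(l : ℝ)| ≤ 2 * ‖w‖ := by
    intro l hl w hw
    have hl1 : 1 ≤ |(l : ℝ)| := by exact_mod_cast Int.one_le_abs hl
    have h1 : ‖(l : ℂ)‖ = |(l : ℝ)| := by
      rw [← Complex.ofReal_intCast, Complex.norm_real, Real.norm_eq_abs]
    have h2 := norm_sub_norm_le (l : ℂ) w
    rw [h1, norm_sub_rev] at h2
    constructor
    · rw [hρ]; linarith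
    · linarith
  have hpow : ∀ w : ℂ, ρ ≤ 2 * ‖w‖ →
      2 ≤ (2 * ‖w‖) ^ N ∧ K * (2 * ‖w‖) ^ (n + 2) ≤ (2 * ‖w‖) ^ N := by
    intro w hw
    have h1 : K ≤ (2 * ‖w‖) ^ (N - (n + 2)) := hNK.trans (by gcongr)
    have h2 : K * (2 * ‖w‖) ^ (n + 2) ≤ (2 * ‖w‖) ^ N := by
      rw [show (2 * ‖w‖) ^ N = (2 * ‖w‖) ^ (N - (n + 2)) * (2 * ‖w‖) ^ (n + 2) by
        rw [← pow_add, Nat.sub_add_cancel hNn]]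
      gcongr
    refine ⟨le_trans ?_ h2, h2⟩
    have : 1 ≤ (2 * ‖w‖) ^ (n + 2) := one_le_pow₀ (hρ1.le.trans hw)
    nlinarith
  have hdisc : ∀ l : ℤ, l ≠ 0 → ∀ w : ℂ, ‖w - l‖ < R₀ →
      ‖bump R₀ n N w‖ ≤ τ * cellWeight l := by
    intro l hl w hw
    obtain ⟨h1, h2⟩ := hfar l hl w hw
    obtain ⟨h3, h4⟩ := hpow w h1
    refine (norm_bump_le_cellWeight hR (by linarith) hl h2 h3 h4).trans ?_
    exact mul_le_mul_of_nonneg_right hKτ (cellWeight_nonneg l)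
  have hne : ∀ {c : ℝ} {z : ℂ}, 0 < c → c ≤ ‖z‖ → z ≠ 0 := by
    rintro c z hc h rfl
    rw [norm_zero] at h
    linarith
  refine ⟨N, τ + 16 * 8 ^ n, min h₁ (1 / 2), by positivity, by positivity, ?_, hdisc, ?_⟩
  · intro w hw
    refine (norm_bump_sub_monomial_le hR hw (hNq.trans (min_le_left _ _))).trans ?_
    linarith [hNq.trans (min_le_right _ _)]
  have hC : ∀ x y : ℝ, 0 ≤ y → x ≤ 16 * 8 ^ n * y → x ≤ (τ + 16 * 8 ^ n) * y := by
    intro x y hy h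
    nlinarith
  have hw0 : ∀ l : ℤ, |(l : ℝ)| ≤ 1 → 1 / 2 ≤ cellWeight l := by
    intro l hl
    unfold cellWeight
    rw [one_div]
    refine inv_anti₀ (by positivity) ?_
    have : (l : ℝ) ^ 2 ≤ 1 := by rw [← sq_abs]; exact pow_le_one₀ (abs_nonneg _) hl
    linarith
  -- the points at which the denominator is bounded below by `1 / 2`
  have hnear : ∀ w : ℂ, ‖w‖ ≤ 2 → 1 / 2 ≤ ‖1 + (2 * w) ^ N‖ → ∀ l : ℤ, |(l : ℝ)| ≤ 1 →
      1 + (2 * w) ^ N ≠ 0 ∧ ‖bump R₀ n N w‖ ≤ (τ + 16 * 8 ^ n) * cellWeight l := by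
    intro w hw h l hl
    refine ⟨hne (by norm_num) h, hC _ _ (cellWeight_nonneg l) ?_⟩
    have h1 := norm_bump_le_of_half_le (n := n) hR h
    have h2 : (4 * ‖w‖) ^ n ≤ 8 ^ n := by
      gcongr
      linarith
    have h3 := hw0 l hl
    have h4 : (0 : ℝ) < 8 ^ n := by positivity
    nlinarith
  rintro w (hw | ⟨l, hw⟩)
  · set l := ⌊w.re + 1 / 2⌋ with hl
    have hl1 := Int.floor_le (w.re + 1 / 2)
    have hl2 := Int.lt_floor_add_one (w.re + 1 / 2)
    rw [← hl] at hl1 hl2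
    have hrl : |w.re - l| ≤ 1 / 2 := by rw [abs_le]; constructor <;> linarith
    have hwr := Complex.abs_re_le_norm w
    by_cases hl3 : |(l : ℝ)| ≤ 1
    · have hw2 : ‖w‖ ≤ 2 := by
        refine (Complex.norm_le_abs_re_add_abs_im w).trans ?_
        have h1 : |w.im| < 1 / 2 := hw.trans_le (min_le_right _ _)
        have h2 : |w.re| - |(l : ℝ)| ≤ 1 / 2 := (abs_sub_abs_le_abs_sub _ _).trans hrl
        linarith
      exact hnear w hw2 (hden w hw2 (hw.trans_le (min_le_left _ _))) l hl3
    · have hl4 : 2 ≤ |(l : ℝ)| := by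
        have h1 : 1 < |l| := by
          rw [not_le] at hl3
          exact_mod_cast hl3
        have h2 : (2 : ℤ) ≤ |l| := h1
        exact_mod_cast h2
      have h5 : |(l : ℝ)| - |w.re| ≤ 1 / 2 := by
        refine (abs_sub_abs_le_abs_sub _ _).trans ?_
        rwa [abs_sub_comm]
      have ht : 3 ≤ 2 * ‖w‖ := by linarith
      have hlt : |(l : ℝ)| ≤ 2 * ‖w‖ := by linarith
      have h6 : 2 ≤ (2 * ‖w‖) ^ N := by
        have := le_self_pow₀ (by linarith : 1 ≤ 2 * ‖w‖) (by omega : N ≠ 0)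
        linarith
      refine ⟨hne (by positivity) ((half_le_norm_one_add_pow_of_two_le h6)), ?_⟩
      have h7 : 1 * (2 * ‖w‖) ^ (n + 2) ≤ (2 * ‖w‖) ^ N := by
        rw [one_mul]
        exact pow_le_pow_right₀ (by linarith) hNn
      have hl0 : l ≠ 0 := by
        rintro h
        rw [h] at hl4
        norm_num at hl4
      refine (norm_bump_le_cellWeight hR one_pos hl0 hlt h6 h7).trans
        (hC _ _ (cellWeight_nonneg l) ?_)
      rw [div_one]
      refine mul_le_mul_of_nonneg_right ?_ (cellWeight_nonneg l)
      gcongr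
      norm_num
  · rw [floor_re_add_half_eq hR' hw]
    rcases eq_or_ne l 0 with rfl | hl
    · have hw' : ‖w‖ < R₀ := by simpa using hw
      refine hnear w (by linarith) (half_le_norm_one_add_pow_of_le_half ?_) 0 (by simp)
      refine le_trans ?_ (hNq.trans (min_le_left _ _))
      gcongr
    · obtain ⟨h1, h2⟩ := hfar l hl w hw
      obtain ⟨h3, h4⟩ := hpow w h1
      refine ⟨hne (by positivity) (half_le_norm_one_add_pow_of_two_le h3),
        (hdisc l hl w hw).trans ?_⟩
      refine mul_le_mul_of_nonneg_right ?_ (cellWeight_nonneg l)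
      have : (0 : ℝ) < 8 ^ n := by positivity
      linarith

/-! ### Superpositions of translated test functions -/

/-- The Schur test for a convolution with nonnegative summable weights on `ℤ`. -/
theorem summable_sq_convolution {κ : ℤ → ℝ} (h0 : ∀ l, 0 ≤ κ l) (hκ : Summable κ) (s : Finset ℤ)
    (c : ℤ → ℝ) :
    Summable (fun j : ℤ => (∑ m ∈ s, c m * κ (j - m)) ^ 2) ∧
      ∑' j : ℤ, (∑ m ∈ s, c m * κ (j - m)) ^ 2 ≤ (∑' l, κ l) ^ 2 * ∑ m ∈ s, c m ^ 2 := by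
  set S := ∑' l, κ l with hS
  have hb : ∀ j : ℤ, (∑ m ∈ s, c m * κ (j - m)) ^ 2 ≤ ∑ m ∈ s, S * c m ^ 2 * κ (j - m) := by
    intro j
    have h1 : (∑ m ∈ s, c m * κ (j - m)) ^ 2 ≤
        (∑ m ∈ s, κ (j - m)) * ∑ m ∈ s, c m ^ 2 * κ (j - m) :=
      Finset.sum_sq_le_sum_mul_sum_of_sq_le_mul s (fun m _ => h0 _)
        (fun m _ => mul_nonneg (sq_nonneg _) (h0 _)) fun m _ => le_of_eq (by ring)
    have h2 : ∑ m ∈ s, κ (j - m) ≤ S := by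
      have h3 : ∑ m ∈ s, κ (j - m) ≤ ∑' m, κ (j - m) :=
        ((Equiv.subLeft j).summable_iff.2 hκ).sum_le_tsum s fun m _ => h0 _
      exact h3.trans_eq ((Equiv.subLeft j).tsum_eq κ)
    refine h1.trans ((mul_le_mul_of_nonneg_right h2
      (Finset.sum_nonneg fun m _ => mul_nonneg (sq_nonneg _) (h0 _))).trans_eq ?_)
    rw [Finset.mul_sum]
    exact Finset.sum_congr rfl fun m _ => by ring
  have hsum : HasSum (fun j : ℤ => ∑ m ∈ s, S * c m ^ 2 * κ (j - m))
      (∑ m ∈ s, S * c m ^ 2 * S) :=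
    hasSum_sum fun m _ => ((Equiv.subRight m).hasSum_iff.2 hκ.hasSum).mul_left _
  have hs := Summable.of_nonneg_of_le (fun j => sq_nonneg _) hb hsum.summable
  refine ⟨hs, (hs.tsum_le_tsum hb hsum.summable).trans_eq ?_⟩
  rw [hsum.tsum_eq, Finset.mul_sum]
  exact Finset.sum_congr rfl fun m _ => by ring

/-- The points with `j` as the integer nearest to the real part form a strip of width `1`. -/
theorem volume_inter_cell_le {E : Set ℂ} {y : ℝ} (hE : ∀ z ∈ E, |z.im| ≤ y) (j : ℤ) :
    volume (E ∩ {z : ℂ | ⌊z.re + 1 / 2⌋ = j}) ≤ ENNReal.ofReal (2 * y) := by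
  have hsub : E ∩ {z : ℂ | ⌊z.re + 1 / 2⌋ = j} ⊆ Complex.measurableEquivRealProd ⁻¹'
      (Icc ((j : ℝ) - 1 / 2) (j + 1 / 2) ×ˢ Icc (-y) y) := by
    rintro z ⟨hz, hj⟩
    rw [mem_ofPred_eq, Int.floor_eq_iff] at hj
    have := abs_le.1 (hE z hz)
    rw [mem_preimage, Complex.measurableEquivRealProd_apply]
    exact ⟨⟨by simp only; linarith [hj.1], by simp only; linarith [hj.2]⟩, this⟩
  refine (measure_mono hsub).trans ?_
  rw [Complex.volume_preserving_equiv_real_prod.measure_preimage_equiv, Measure.volume_eq_prod,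
    Measure.prod_prod, Real.volume_Icc, Real.volume_Icc, show (j : ℝ) + 1 / 2 - (j - 1 / 2) = 1 by
    ring, ENNReal.ofReal_one, one_mul, show y - -y = 2 * y by ring]

/-- A function with square summable bounds on the cells is square integrable over a set of
bounded height. -/
theorem lintegral_sq_le_of_cells {E : Set ℂ} (hE : MeasurableSet E) {y : ℝ} (hy0 : 0 ≤ y)
    (hy : ∀ z ∈ E, |z.im| ≤ y) {g : ℂ → ℂ} {a : ℤ → ℝ} (hg : ∀ z ∈ E, ‖g z‖ ≤ a ⌊z.re + 1 / 2⌋)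
    (hs : Summable fun j => a j ^ 2) :
    ∫⁻ z in E, ‖g z‖ₑ ^ (2 : ℝ) ≤ ENNReal.ofReal (2 * y * ∑' j, a j ^ 2) := by
  have hQ : ∀ j : ℤ, MeasurableSet {z : ℂ | ⌊z.re + 1 / 2⌋ = j} := fun j =>
    measurableSet_eq_fun (by fun_prop) measurable_const
  have hU : E = ⋃ j : ℤ, E ∩ {z : ℂ | ⌊z.re + 1 / 2⌋ = j} := by
    ext z
    simp
  rw [hU, lintegral_iUnion (fun j => hE.inter (hQ j))]
  · calc ∑' j : ℤ, ∫⁻ z in E ∩ {z : ℂ | ⌊z.re + 1 / 2⌋ = j}, ‖g z‖ₑ ^ (2 : ℝ)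
        ≤ ∑' j : ℤ, ENNReal.ofReal (2 * y * a j ^ 2) := by
          refine ENNReal.tsum_le_tsum fun j => ?_
          have h1 : ∀ z ∈ E ∩ {z : ℂ | ⌊z.re + 1 / 2⌋ = j},
              ‖g z‖ₑ ^ (2 : ℝ) ≤ ENNReal.ofReal (a j ^ 2) := by
            rintro z ⟨hz, hj⟩
            have h2 := hg z hz
            rw [mem_ofPred_eq] at hj
            rw [hj] at h2
            rw [ENNReal.rpow_two, ENNReal.ofReal_pow ((norm_nonneg _).trans h2),
              ← ofReal_norm]
            gcongr
          refine (setLIntegral_mono' (hE.inter (hQ j)) h1).trans ?_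
          rw [setLIntegral_const, mul_comm, ENNReal.ofReal_mul (by positivity)]
          gcongr
          exact volume_inter_cell_le hy j
      _ = _ := by
          rw [← ENNReal.ofReal_tsum_of_nonneg (fun j => by positivity) (hs.mul_left _),
            tsum_mul_left]
  · intro i j hij
    refine disjoint_left.2 fun z hi hj => hij ?_
    exact hi.2.symm.trans hj.2

theorem norm_sq_bergman_unitDisc_le {f : bergman unitDisc} {B : ℝ}
    (h : ∀ᵐ z ∂(volume.restrict (unitDisc : Set ℂ)), ‖(f : L2 unitDisc) z‖ ≤ B) :
    ‖f‖ ^ 2 ≤ π * B ^ 2 := by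
  have hfin : IsFiniteMeasure (volume.restrict (unitDisc : Set ℂ)) :=
    ⟨by rw [Measure.restrict_apply_univ]; exact measure_ball_lt_top⟩
  rw [norm_sq_bergman]
  have h1 : ∫ z in (unitDisc : Set ℂ), ‖(f : L2 unitDisc) z‖ ^ 2 ≤
      ∫ _ in (unitDisc : Set ℂ), B ^ 2 := by
    refine integral_mono_ae (integrableOn_norm_sq_bergman f) (integrable_const _) ?_
    filter_upwards [h] with z hz
    gcongr
  refine h1.trans_eq ?_
  rw [integral_const, smul_eq_mul, measureReal_restrict_apply_univ]
  congr 1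
  simp [unitDisc, Measure.real, Complex.volume_ball]

theorem coeFn_bergman_sub {Ω : TopologicalSpace.Opens ℂ} (f g : bergman Ω) :
    (((f - g : bergman Ω) : L2 Ω) : ℂ → ℂ) =ᵐ[volume.restrict (Ω : Set ℂ)]
      fun z => (f : L2 Ω) z - (g : L2 Ω) z :=
  Lp.coeFn_sub (f : L2 Ω) (g : L2 Ω)

section Superposition

variable {R₀ : ℝ}

open Classical in
/-- In a periodic domain with thin ligaments, every finite superposition of copies of a monomial
on the discs is the restriction of an element of the Bergman space up to a small error, and this
element is small outside of the discs. -/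
theorem exists_bergman_restrictDiscs_approx (hR : 1 / 4 < R₀) (hR' : R₀ < 1 / 2) (n : ℕ) {τ : ℝ}
    (hτ : 0 < τ) : ∃ h₀ > 0, ∀ (h : ℝ), 0 < h → h ≤ h₀ → ∀ (Ω : TopologicalSpace.Opens ℂ)
      (hΩ : ∀ m : ℤ, ball (m : ℂ) R₀ ⊆ Ω)
      (_ : ∀ z ∈ Ω, |z.im| < h ∨ ∃ m : ℤ, ‖z - m‖ < R₀) (s : Finset ℤ) (c : ℤ → ℂ),
      ∃ f : bergman Ω,
        ‖restrictDiscs (by linarith) hΩ hR' f -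
          ∑ m ∈ s, lp.single (E := fun _ : ℤ => bergman unitDisc) 2 m
            (c m • discMonomial n)‖ ^ 2 ≤ τ ^ 2 * ∑ m ∈ s, ‖c m‖ ^ 2 ∧
        ‖f‖ ^ 2 - ‖restrictDiscs (by linarith) hΩ hR' f‖ ^ 2 ≤ τ ^ 2 * ∑ m ∈ s, ‖c m‖ ^ 2 := by
  have hR0 : 0 < R₀ := by linarith
  set S : ℝ := ∑' l, cellWeight l with hS
  have hS0 : 0 ≤ S := tsum_nonneg cellWeight_nonneg
  obtain ⟨N, C, h₀, hC, hh₀, hb1, hb2, hb3⟩ :=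
    exists_bump hR hR' n (τ := τ / (2 * (S + 1))) (by positivity)
  set τ' : ℝ := τ / (2 * (S + 1)) with hτ'
  have hτ'0 : 0 ≤ τ' := by positivity
  -- `π * (τ' * S) ^ 2` is the total error on the discs, by the Schur test
  have hτS : π * (τ' * S) ^ 2 ≤ τ ^ 2 := by
    have h1 : τ' * S ≤ τ / 2 := by
      rw [hτ', div_mul_eq_mul_div, div_le_div_iff₀ (by positivity) (by norm_num)]
      nlinarith
    have h2 : (τ' * S) ^ 2 ≤ (τ / 2) ^ 2 := by gcongr
    nlinarith [Real.pi_le_four, sq_nonneg (τ' * S)]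
  -- the second bound on `h` makes the mass in the ligaments small: their area is at most `2 * h` in
  -- each cell, and the constant `C` does not depend on `h`
  refine ⟨min h₀ (τ ^ 2 / (2 * (C ^ 2 * S ^ 2 + 1))), by positivity, ?_⟩
  intro h hh hhle Ω hΩ hmem s c
  have hhh₀ : h ≤ h₀ := hhle.trans (min_le_left _ _)
  have hh2 : 2 * h * (C ^ 2 * S ^ 2) ≤ τ ^ 2 := by
    have h1 := hhle.trans (min_le_right _ _)
    rw [le_div_iff₀ (by positivity)] at h1
    nlinarith
  set ψ := bump R₀ n N with hψ
  set a : ℤ → ℝ := fun j => ∑ m ∈ s, ‖c m‖ * cellWeight (j - m) with ha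
  obtain ⟨hsum, hle⟩ := summable_sq_convolution cellWeight_nonneg summable_cellWeight s
    fun m => ‖c m‖
  set F : ℂ → ℂ := fun z => ∑ m ∈ s, c m * ψ (z - m) with hF
  have hshift : ∀ z ∈ Ω, ∀ m : ℤ, 1 + (2 * (z - m)) ^ N ≠ 0 ∧
      ‖ψ (z - m)‖ ≤ C * cellWeight (⌊z.re + 1 / 2⌋ - m) := by
    intro z hz m
    have h1 := hb3 (z - m) ?_
    · rwa [Complex.sub_re, Complex.intCast_re,
        show z.re - (m : ℝ) + 1 / 2 = z.re + 1 / 2 - (m : ℝ) by ring, Int.floor_sub_intCast] at h1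
    · rcases hmem z hz with h1 | ⟨l, h1⟩
      · left
        simpa using h1.trans_le hhh₀
      · right
        refine ⟨l - m, ?_⟩
        push_cast
        rwa [sub_sub_sub_cancel_right]
  have hFd : DifferentiableOn ℂ F Ω := by
    refine DifferentiableOn.fun_sum fun m _ => DifferentiableOn.const_mul ?_ _
    intro z hz
    have h1 := (hshift z hz m).1
    refine DifferentiableAt.differentiableWithinAt ?_
    simp only [hψ, bump]
    exact DifferentiableAt.div (by fun_prop) (by fun_prop) h1
  have hFb : ∀ z ∈ (Ω : Set ℂ), ‖F z‖ ≤ C * a ⌊z.re + 1 / 2⌋ := by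
    intro z hz
    simp only [hF, ha]
    rw [Finset.mul_sum]
    refine (norm_sum_le _ _).trans (Finset.sum_le_sum fun m _ => ?_)
    rw [norm_mul]
    have := (hshift z hz m).2
    calc _ ≤ ‖c m‖ * (C * cellWeight (⌊z.re + 1 / 2⌋ - m)) := by gcongr
      _ = _ := by ring
  have hCs : Summable fun j => (C * a j) ^ 2 := by
    simp only [mul_pow]
    exact hsum.mul_left _
  have hCt : ∑' j, (C * a j) ^ 2 ≤ C ^ 2 * S ^ 2 * ∑ m ∈ s, ‖c m‖ ^ 2 := by
    simp only [mul_pow]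
    rw [tsum_mul_left, mul_assoc]
    gcongr
  have hFm : AEStronglyMeasurable F (volume.restrict (Ω : Set ℂ)) :=
    hFd.continuousOn.aestronglyMeasurable Ω.isOpen.measurableSet
  have hL : MemLp F 2 (volume.restrict (Ω : Set ℂ)) := by
    refine ⟨hFm, ?_⟩
    rw [eLpNorm_lt_top_iff_lintegral_rpow_enorm_lt_top (by norm_num) (by norm_num),
      ENNReal.toReal_ofNat]
    have himΩ : ∀ z ∈ (Ω : Set ℂ), |z.im| ≤ h + R₀ := by
      intro z hz
      rcases hmem z hz with h1 | ⟨m, h1⟩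
      · linarith
      · have h2 := (Complex.abs_im_le_norm _).trans_lt h1
        rw [Complex.sub_im, Complex.intCast_im, sub_zero] at h2
        linarith
    exact (lintegral_sq_le_of_cells Ω.isOpen.measurableSet (by positivity) himΩ hFb hCs).trans_lt
      ENNReal.ofReal_lt_top
  have hfF := coeFn_bergmanMk hFd hL
  refine ⟨bergmanMk F hFd hL, ?_, ?_⟩
  · -- the error on the disc centred at `j`
    have hj : ∀ j : ℤ, ‖restrictDisc hR0 hΩ j (bergmanMk F hFd hL) -
        (if j ∈ s then c j • discMonomial n else 0)‖ ^ 2 ≤ π * τ' ^ 2 * a j ^ 2 := by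
      intro j
      have hite : (if j ∈ s then c j • discMonomial n else 0) =
          (if j ∈ s then c j else 0) • discMonomial n := by
        split_ifs <;> simp
      rw [hite, mul_assoc, ← mul_pow]
      apply norm_sq_bergman_unitDisc_le
      filter_upwards [coeFn_bergman_sub (restrictDisc hR0 hΩ j (bergmanMk F hFd hL))
          ((if j ∈ s then c j else 0) • discMonomial n),
        coeFn_restrictDisc hR0 hΩ j (bergmanMk F hFd hL),
        coeFn_bergman_smul (if j ∈ s then c j else 0) (discMonomial n), coeFn_discMonomial n,
        (quasiMeasurePreserving_discMap hR0 j (hΩ j)).ae hfF,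
        ae_restrict_mem unitDisc.isOpen.measurableSet] with z h1 h2 h3 h4 h5 hz
      have hz1 : ‖z‖ < 1 := mem_ball_zero_iff.1 hz
      have hsplit : (R₀ : ℂ) * F (discMap R₀ j z) - (if j ∈ s then c j else 0) * z ^ n =
          ∑ m ∈ s, c m * (R₀ * ψ (discMap R₀ j z - m) - if m = j then z ^ n else 0) := by
        simp only [hF, mul_sub, Finset.sum_sub_distrib, Finset.mul_sum, mul_ite, mul_zero,
          Finset.sum_ite_eq', ite_mul, zero_mul]
        congr 1
        exact Finset.sum_congr rfl fun m _ => by ring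
      rw [h1, h2, h3, h4, h5, hsplit, ha, Finset.mul_sum]
      refine (norm_sum_le _ _).trans (Finset.sum_le_sum fun m _ => ?_)
      have hdm : discMap R₀ j z - m = ((j - m : ℤ) : ℂ) + R₀ * z := by
        simp only [discMap, Complex.real_smul]
        push_cast
        ring
      have hRz : ‖(R₀ : ℂ) * z‖ < R₀ := by
        rw [norm_mul, Complex.norm_real, Real.norm_of_nonneg hR0.le]
        nlinarith
      have hterm : ‖(R₀ : ℂ) * ψ (discMap R₀ j z - m) - if m = j then z ^ n else 0‖ ≤
          τ' * cellWeight (j - m) := by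
        have hR1 : ‖(R₀ : ℂ)‖ ≤ 1 := by
          rw [Complex.norm_real, Real.norm_of_nonneg hR0.le]
          linarith
        have hRne : (R₀ : ℂ) ≠ 0 := by exact_mod_cast hR0.ne'
        rcases eq_or_ne m j with rfl | hm
        · rw [if_pos rfl, hdm, sub_self, Int.cast_zero, zero_add]
          have h6 := hb1 _ hRz
          have h7 : (R₀ : ℂ) * ψ (R₀ * z) - z ^ n =
              R₀ * (ψ (R₀ * z) - (R₀ * z / R₀) ^ n / R₀) := by
            rw [mul_div_cancel_left₀ _ hRne, mul_sub, mul_div_cancel₀ _ hRne]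
          rw [h7, norm_mul, cellWeight, Int.cast_zero, zero_pow two_ne_zero, add_zero, inv_one,
            mul_one]
          calc _ ≤ 1 * τ' := by gcongr
            _ = τ' := one_mul _
        · rw [if_neg hm, sub_zero, norm_mul]
          have h6 := hb2 (j - m) (sub_ne_zero.2 hm.symm) (discMap R₀ j z - m)
            (by rw [hdm, add_sub_cancel_left]; exact hRz)
          calc _ ≤ 1 * (τ' * cellWeight (j - m)) := by gcongr
            _ = _ := one_mul _
      rw [norm_mul]
      calc _ ≤ ‖c m‖ * (τ' * cellWeight (j - m)) := by gcongr
        _ = _ := by ring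
    set v := ∑ m ∈ s, lp.single (E := fun _ : ℤ => bergman unitDisc) 2 m
            (c m • discMonomial n) with hv
    have h1 := hasSum_norm_sq_lp (restrictDiscs hR0 hΩ hR' (bergmanMk F hFd hL) - v)
    have h2 : ∀ j, ‖(restrictDiscs hR0 hΩ hR' (bergmanMk F hFd hL) - v) j‖ ^ 2 ≤
        π * τ' ^ 2 * a j ^ 2 := by
      intro j
      rw [lp.coeFn_sub, Pi.sub_apply, restrictDiscs_apply, hv, sum_single_apply]
      exact hj j
    refine (hasSum_le h2 h1 (hsum.mul_left _).hasSum).trans ?_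
    rw [tsum_mul_left]
    calc π * τ' ^ 2 * ∑' j, a j ^ 2 ≤ π * τ' ^ 2 * (S ^ 2 * ∑ m ∈ s, ‖c m‖ ^ 2) := by gcongr
      _ = π * (τ' * S) ^ 2 * ∑ m ∈ s, ‖c m‖ ^ 2 := by ring
      _ ≤ _ := by gcongr
  · rw [norm_sq_sub_norm_sq_restrictDiscs]
    set E : Set ℂ := (Ω : Set ℂ) \ ⋃ m : ℤ, ball (m : ℂ) R₀ with hE
    have hEm : MeasurableSet E :=
      Ω.isOpen.measurableSet.diff (MeasurableSet.iUnion fun m => measurableSet_ball)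
    have hEim : ∀ z ∈ E, |z.im| ≤ h := by
      rintro z ⟨hz, hz'⟩
      rcases hmem z hz with h1 | ⟨m, h1⟩
      · exact h1.le
      · exact absurd (mem_iUnion.2 ⟨m, mem_ball_iff_norm.2 h1⟩) hz'
    have h1 := lintegral_sq_le_of_cells hEm hh.le hEim (fun z hz => hFb z hz.1) hCs
    have h2 : ∫ z in E, ‖(bergmanMk F hFd hL : L2 Ω) z‖ ^ 2 = ∫ z in E, ‖F z‖ ^ 2 := by
      refine integral_congr_ae ?_
      filter_upwards [ae_restrict_of_ae_restrict_of_subset sdiff_subset hfF] with z hz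
      rw [hz]
    rw [h2, integral_eq_lintegral_of_nonneg_ae (Eventually.of_forall fun z => by positivity)]
    · refine ENNReal.toReal_le_of_le_ofReal (by positivity) ?_
      have h3 : ∫⁻ z in E, ENNReal.ofReal (‖F z‖ ^ 2) = ∫⁻ z in E, ‖F z‖ₑ ^ (2 : ℝ) := by
        refine lintegral_congr fun z => ?_
        rw [ENNReal.ofReal_pow (norm_nonneg _), ofReal_norm, ENNReal.rpow_two]
      rw [h3]
      refine h1.trans (ENNReal.ofReal_le_ofReal ?_)
      calc 2 * h * ∑' j, (C * a j) ^ 2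
          ≤ 2 * h * (C ^ 2 * S ^ 2 * ∑ m ∈ s, ‖c m‖ ^ 2) := by gcongr
        _ = 2 * h * (C ^ 2 * S ^ 2) * ∑ m ∈ s, ‖c m‖ ^ 2 := by ring
        _ ≤ _ := by gcongr
    · exact (hFm.mono_measure (Measure.restrict_mono sdiff_subset le_rfl)).norm.pow 2

end Superposition

/-! ### The compression is asymptotically lossless -/

section Operators

open ContinuousLinearMap (adjoint)

variable {H K : Type*} [NormedAddCommGroup H] [InnerProductSpace ℂ H] [CompleteSpace H]
  [NormedAddCommGroup K] [InnerProductSpace ℂ K] [CompleteSpace K] {J : H →L[ℂ] K}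

/-- A vector close to a vector `J f` with `‖J f‖` close to `‖f‖` is nearly fixed by `J J†`. -/
theorem norm_sub_comp_adjoint_le_of_approx (hJ : ‖J‖ ≤ 1) {v : K} {f : H} {ε : ℝ} (hε : 0 ≤ ε)
    (h1 : ‖J f - v‖ ^ 2 ≤ ε ^ 2) (h2 : ‖f‖ ^ 2 - ‖J f‖ ^ 2 ≤ ε ^ 2) :
    ‖v - J (adjoint J v)‖ ≤ 3 * ε := by
  have h3 : ‖J f - J (adjoint J (J f))‖ ≤ ε :=
    (sq_le_sq₀ (norm_nonneg _) hε).1 ((norm_sub_comp_adjoint_sq_le hJ f).trans h2)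
  have h4 : ‖J f - v‖ ≤ ε := (sq_le_sq₀ (norm_nonneg _) hε).1 h1
  have h5 := norm_sub_comp_adjoint_le hJ (J f - v)
  have h6 : v - J (adjoint J v) = (J f - J (adjoint J (J f))) -
      ((J f - v) - J (adjoint J (J f - v))) := by
    rw [map_sub, map_sub]
    abel
  rw [h6]
  refine (norm_sub_le _ _).trans ?_
  linarith

theorem norm_sub_comp_adjoint_comp_le (hJ : ‖J‖ ≤ 1) (A : K →L[ℂ] K) :
    ‖A - J ∘L adjoint J ∘L A‖ ≤ 2 * ‖A‖ := by
  refine ContinuousLinearMap.opNorm_le_bound _ (by positivity) fun u => ?_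
  refine (norm_sub_comp_adjoint_le hJ (A u)).trans ?_
  rw [mul_assoc]
  gcongr
  exact A.le_opNorm u

/-- Approximate invariance under `J J†` of the copies of `e` in a direct sum gives approximate
invariance of the range of the direct sum of copies of a rank one operator onto `ℂ e`. -/
theorem norm_lpMap_rankOne_sub_le {ι E : Type*} [DecidableEq ι] [NormedAddCommGroup E]
    [InnerProductSpace ℂ E] [CompleteSpace E] {J : H →L[ℂ] lp (fun _ : ι => E) 2} (hJ : ‖J‖ ≤ 1)
    {e : E} {τ : ℝ} (hτ : 0 ≤ τ)
    (happ : ∀ (s : Finset ι) (c : ι → ℂ), ∃ f : H,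
      ‖J f - ∑ m ∈ s, lp.single (E := fun _ : ι => E) 2 m (c m • e)‖ ^ 2 ≤
        τ ^ 2 * ∑ m ∈ s, ‖c m‖ ^ 2 ∧
      ‖f‖ ^ 2 - ‖J f‖ ^ 2 ≤ τ ^ 2 * ∑ m ∈ s, ‖c m‖ ^ 2) (y : E) :
    ‖lpMap ι (InnerProductSpace.rankOne ℂ e y) -
      J ∘L adjoint J ∘L lpMap ι (InnerProductSpace.rankOne ℂ e y)‖ ≤ 3 * (τ * ‖y‖) := by
  refine norm_le_of_forall_sum_single _ (by positivity) fun s x => ?_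
  have hv : lpMap ι (InnerProductSpace.rankOne ℂ e y)
      (∑ i ∈ s, lp.single (E := fun _ : ι => E) 2 i (x i)) =
      ∑ i ∈ s, lp.single (E := fun _ : ι => E) 2 i (inner ℂ y (x i) • e) := by
    rw [map_sum]
    refine Finset.sum_congr rfl fun i _ => ?_
    rw [lpMap_single, InnerProductSpace.rankOne_apply]
  obtain ⟨f, h1, h2⟩ := happ s fun i => inner ℂ y (x i)
  have hcs : τ ^ 2 * ∑ m ∈ s, ‖(inner ℂ y (x m) : ℂ)‖ ^ 2 ≤
      (τ * ‖y‖ * ‖∑ i ∈ s, lp.single (E := fun _ : ι => E) 2 i (x i)‖) ^ 2 := by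
    rw [mul_pow _ ‖_‖, norm_sq_sum_single, mul_pow, mul_assoc]
    gcongr
    rw [Finset.mul_sum]
    refine Finset.sum_le_sum fun i _ => ?_
    rw [← mul_pow]
    gcongr
    exact norm_inner_le_norm (𝕜 := ℂ) y (x i)
  have h3 := norm_sub_comp_adjoint_le_of_approx hJ (by positivity) (h1.trans hcs) (h2.trans hcs)
  rw [sub_apply, ContinuousLinearMap.comp_apply,
    ContinuousLinearMap.comp_apply, hv]
  refine h3.trans_eq ?_
  ring

/-- Passage from the terms of a finite sum to an operator approximated by this sum. -/
theorem norm_lpMap_sub_le_of_approx {ι E : Type*} [NormedAddCommGroup E]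
    [InnerProductSpace ℂ E] [CompleteSpace E] {J : H →L[ℂ] lp (fun _ : ι => E) 2} (hJ : ‖J‖ ≤ 1)
    {T : E →L[ℂ] E} {d : ℕ} {F : ℕ → E →L[ℂ] E} {η : ℝ}
    (hT : ‖T - ∑ k ∈ Finset.range d, F k‖ ≤ η / 4)
    (hF : ∀ k ∈ Finset.range d, ‖lpMap ι (F k) - J ∘L adjoint J ∘L lpMap ι (F k)‖ ≤
      η / (2 * (d + 1))) :
    ‖lpMap ι T - J ∘L adjoint J ∘L lpMap ι T‖ ≤ η := by
  have hη : 0 ≤ η := by linarith [norm_nonneg (T - ∑ k ∈ Finset.range d, F k)]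
  have hdec : lpMap ι T - J ∘L adjoint J ∘L lpMap ι T =
      (lpMap ι (T - ∑ k ∈ Finset.range d, F k) -
        J ∘L adjoint J ∘L lpMap ι (T - ∑ k ∈ Finset.range d, F k)) +
      ∑ k ∈ Finset.range d, (lpMap ι (F k) - J ∘L adjoint J ∘L lpMap ι (F k)) := by
    rw [Finset.sum_sub_distrib, lpMap_sub, lpMap_sum, ContinuousLinearMap.comp_sub,
      ContinuousLinearMap.comp_sub, ContinuousLinearMap.comp_finsetSum,
      ContinuousLinearMap.comp_finsetSum]
    abel
  rw [hdec]
  refine (norm_add_le _ _).trans ?_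
  have h1 := (norm_sub_comp_adjoint_comp_le hJ (lpMap ι (T - ∑ k ∈ Finset.range d, F k)))
  have h2 := (norm_lpMap_le (ι := ι) (T - ∑ k ∈ Finset.range d, F k)).trans hT
  have h3 : ‖∑ k ∈ Finset.range d, (lpMap ι (F k) - J ∘L adjoint J ∘L lpMap ι (F k))‖ ≤ η / 2 := by
    refine (norm_sum_le _ _).trans ((Finset.sum_le_sum hF).trans ?_)
    rw [Finset.sum_const, Finset.card_range, nsmul_eq_mul, mul_div_assoc', div_le_div_iff₀
      (by positivity) (by norm_num)]
    nlinarith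
  linarith

omit [CompleteSpace K] in
theorem exists_norm_sub_lt_of_tendsto {u : ℕ → K →L[ℂ] K} {T : K →L[ℂ] K}
    (h : Tendsto u atTop (𝓝 T)) {η : ℝ} (hη : 0 < η) : ∃ d, ‖T - u d‖ < η := by
  obtain ⟨d, hd⟩ := ((tendsto_iff_norm_sub_tendsto_zero.1 h).eventually_lt_const hη).exists
  exact ⟨d, by rwa [norm_sub_rev]⟩

end Operators

section Periodic

open ContinuousLinearMap (adjoint)

variable {R₀ : ℝ}

theorem rankOne_discBasis (n : ℕ) (y : bergman unitDisc) :
    InnerProductSpace.rankOne ℂ (discBasis n) y =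
      InnerProductSpace.rankOne ℂ (discMonomial n) (((‖discMonomial n‖⁻¹ : ℝ) : ℂ) • y) := by
  ext1 x
  rw [InnerProductSpace.rankOne_apply, InnerProductSpace.rankOne_apply, discBasis_apply, smul_smul,
    inner_smul_left (E := bergman unitDisc), Complex.conj_ofReal, mul_comm]

/-- In a periodic domain with thin ligaments the operator `J J†`, for `J` the restriction to the
discs, is close to the identity on the range of a diagonal rank one operator. -/
theorem eventually_norm_lpMap_rankOne_sub_le (hR : 1 / 4 < R₀) (hR' : R₀ < 1 / 2) (n : ℕ)
    (y : bergman unitDisc) {η : ℝ} (hη : 0 < η) :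
    ∀ᶠ h in 𝓝[>] (0 : ℝ), ∀ (Ω : TopologicalSpace.Opens ℂ) (hΩ : ∀ m : ℤ, ball (m : ℂ) R₀ ⊆ Ω)
      (_ : ∀ z ∈ Ω, |z.im| < h ∨ ∃ m : ℤ, ‖z - m‖ < R₀) (hR0 : 0 < R₀),
      ‖lpMap ℤ (InnerProductSpace.rankOne ℂ (discBasis n) y) -
        restrictDiscs hR0 hΩ hR' ∘L adjoint (restrictDiscs hR0 hΩ hR') ∘L
          lpMap ℤ (InnerProductSpace.rankOne ℂ (discBasis n) y)‖ ≤ η := by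
  classical
  rw [rankOne_discBasis]
  set y' := ((‖discMonomial n‖⁻¹ : ℝ) : ℂ) • y
  set τ : ℝ := η / (3 * (‖y'‖ + 1)) with hτ
  have hτ0 : 0 < τ := by positivity
  obtain ⟨h₀, hh₀, happ⟩ := exists_bergman_restrictDiscs_approx hR hR' n hτ0
  filter_upwards [Ioc_mem_nhdsGT hh₀] with h hh Ω hΩ hmem hR0
  refine (norm_lpMap_rankOne_sub_le (norm_restrictDiscs_le hR0 hΩ hR') hτ0.le (fun s c => ?_)
    y').trans ?_
  · obtain ⟨f, h1, h2⟩ := happ h hh.1 hh.2 Ω hΩ hmem s c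
    refine ⟨f, ?_, h2⟩
    convert h1
  · rw [hτ, div_mul_eq_mul_div, mul_div_assoc', div_le_iff₀ (by positivity)]
    nlinarith

/-- In a periodic domain with thin ligaments the operator `J J†`, for `J` the restriction to the
discs, is close to the identity on the range of the direct sum of copies of `T_b`. -/
theorem eventually_norm_lpMap_toeplitz_sub_le (hR : 1 / 4 < R₀) (hR' : R₀ < 1 / 2) {b : ℂ → ℝ}
    (hb : IsSymbol unitDisc fun z => (b z : ℂ)) {R : ℝ} (hR1 : R < 1)
    (hsupp : ∀ᵐ z ∂(volume.restrict (unitDisc : Set ℂ)), R ≤ ‖z‖ → b z = 0)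
    {η : ℝ} (hη : 0 < η) :
    ∀ᶠ h in 𝓝[>] (0 : ℝ), ∀ (Ω : TopologicalSpace.Opens ℂ) (hΩ : ∀ m : ℤ, ball (m : ℂ) R₀ ⊆ Ω)
      (_ : ∀ z ∈ Ω, |z.im| < h ∨ ∃ m : ℤ, ‖z - m‖ < R₀) (hR0 : 0 < R₀),
      ‖lpMap ℤ (toeplitz unitDisc (fun z => (b z : ℂ)) hb) -
        restrictDiscs hR0 hΩ hR' ∘L adjoint (restrictDiscs hR0 hΩ hR') ∘L
          lpMap ℤ (toeplitz unitDisc (fun z => (b z : ℂ)) hb)‖ ≤ η := by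
  obtain ⟨d, hd⟩ := exists_norm_sub_lt_of_tendsto
    (tendsto_sum_rankOne_of_summable (isSelfAdjoint_toeplitz hb) discBasis
      (summable_norm_toeplitz_discBasis hb hR1 hsupp)) (η := η / 4) (by positivity)
  have hall := (Finset.eventually_all (Finset.range d)).2 fun k _ =>
    eventually_norm_lpMap_rankOne_sub_le hR hR' k
      (toeplitz unitDisc (fun z => (b z : ℂ)) hb (discBasis k))
      (η := η / (2 * (d + 1))) (by positivity)
  filter_upwards [hall] with h hh Ω hΩ hmem hR0
  exact norm_lpMap_sub_le_of_approx (norm_restrictDiscs_le hR0 hΩ hR') hd.le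
    fun k hk => hh k hk Ω hΩ hmem hR0

end Periodic

/-! ### Spectra of compressions of direct sums -/

section Operators

open ContinuousLinearMap (adjoint)

variable {ι E H : Type*} [NormedAddCommGroup E] [InnerProductSpace ℂ E] [CompleteSpace E]
  [NormedAddCommGroup H] [InnerProductSpace ℂ H] [CompleteSpace H]
  {T : E →L[ℂ] E} {A : H →L[ℂ] H} {J : H →L[ℂ] lp (fun _ : ι => E) 2} {η ε : ℝ}

/-- The nonzero spectrum of the compression of a direct sum of copies of `T` lies close to the
spectrum of `T`. -/
theorem exists_mem_spectrum_dist_lt_of_mem_spectrum_compress (hT : IsSelfAdjoint T)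
    (hAs : IsSelfAdjoint A) (hA : A = adjoint J ∘L lpMap ι T ∘L J) (hJ : ‖J‖ ≤ 1)
    (hη : ‖lpMap ι T - J ∘L adjoint J ∘L lpMap ι T‖ ≤ η) (hηε : η < ε) {μ : ℝ} (hμ : μ ≠ 0)
    (h : (μ : ℂ) ∈ spectrum ℂ A) : ∃ s ∈ spectrum ℂ T, dist s (μ : ℂ) < ε := by
  by_contra hcon
  have hε : 0 < ε := ((norm_nonneg _).trans hη).trans_lt hηε
  have h1 : ∀ u, ε * ‖u‖ ≤ ‖T u - (μ : ℂ) • u‖ := fun u => by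
    by_contra! hu
    exact hcon (hT.exists_mem_spectrum_dist_lt hu)
  have h2 : ∀ u, ε * ‖u‖ ≤ ‖lpMap ι T u - (μ : ℂ) • u‖ := by
    intro u
    rw [← le_div_iff₀' hε, div_eq_inv_mul]
    refine norm_lp_le_mul_norm (by positivity) fun i => ?_
    rw [← div_eq_inv_mul, le_div_iff₀' hε, lp.coeFn_sub, Pi.sub_apply, lpMap_apply, lp.coeFn_smul,
      Pi.smul_apply]
    exact h1 (u i)
  obtain ⟨c, hc, h3⟩ := norm_sub_smul_compress_bounded_below hA hJ hη hηε hμ h2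
  rw [mem_spectrum_iff_not_isUnit] at h
  refine h ((hAs.sub_ofReal_smul_id μ).isUnit_of_bounded_below hc fun f => ?_)
  simpa using h3 f

/-- The spectrum of the compression of a direct sum of copies of `T` comes close to every nonzero
eigenvalue of `T`. -/
theorem exists_mem_spectrum_compress_dist_lt [Nonempty ι] (hAs : IsSelfAdjoint A)
    (hA : A = adjoint J ∘L lpMap ι T ∘L J) (hJ : ‖J‖ ≤ 1)
    (hη : ‖lpMap ι T - J ∘L adjoint J ∘L lpMap ι T‖ ≤ η) {l : ℝ} (hl : l ≠ 0)
    (hε : 0 < ε) (hηl : (‖T‖ + ε) * η < ε * |l|)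
    (h : Module.End.HasEigenvalue (T : E →ₗ[ℂ] E) (l : ℂ)) :
    ∃ s ∈ spectrum ℂ A, dist s (l : ℂ) < ε := by
  classical
  obtain ⟨φ, hφ⟩ := h.exists_hasEigenvector
  obtain ⟨i⟩ := ‹Nonempty ι›
  set v : lp (fun _ : ι => E) 2 := lp.single (E := fun _ : ι => E) 2 i φ with hv
  have hTφ : T φ = (l : ℂ) • φ := hφ.apply_eq_smul
  have hDv : lpMap ι T v = (l : ℂ) • v := by
    rw [hv, lpMap_single, hTφ, lp.single_smul]
  have hv0 : 0 < ‖v‖ := by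
    have h1 := norm_sq_sum_single (E := E) {i} fun _ => φ
    rw [Finset.sum_singleton, Finset.sum_singleton] at h1
    have h2 : 0 < ‖φ‖ := norm_pos_iff.2 hφ.2
    have h3 : ‖v‖ = ‖φ‖ := (sq_eq_sq₀ (norm_nonneg _) (norm_nonneg _)).1 h1
    rwa [h3]
  obtain ⟨h1, h2⟩ := norm_compress_adjoint_eigenvector_le hA hJ hη hl hDv
  have hl' : 0 < |l| := abs_pos.2 hl
  have hη0 : 0 ≤ η := (norm_nonneg _).trans hη
  refine hAs.exists_mem_spectrum_dist_lt (h1.trans_lt ?_)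
  refine lt_of_lt_of_le ?_ (mul_le_mul_of_nonneg_left h2 hε.le)
  rw [← mul_assoc]
  refine mul_lt_mul_of_pos_right ?_ hv0
  have h3 : ‖lpMap ι T‖ * (η / |l|) ≤ ‖T‖ * (η / |l|) := by
    gcongr
    exact norm_lpMap_le T
  refine h3.trans_lt ?_
  rw [mul_one_sub, lt_sub_iff_add_lt, ← add_mul, mul_div_assoc', div_lt_iff₀ hl']
  exact hηl

/-- The spectral part of the argument. If `A` is compressed from a direct sum of copies of `T` with
a small defect `η`, then the essential spectrum of `A` meets the `ε`-discs about the leading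
eigenvalues of `T`, and it has a gap between these discs and the remainder. -/
theorem essSpectrum_inter_nonempty_and_separated [Nonempty ι] (hT : IsSelfAdjoint T)
    (hAs : IsSelfAdjoint A) (hA : A = adjoint J ∘L lpMap ι T ∘L J) (hJ : ‖J‖ ≤ 1)
    (hD : ‖lpMap ι T - J ∘L adjoint J ∘L lpMap ι T‖ ≤ η)
    (hess : ∀ {μ : ℝ}, μ ≠ 0 → (μ : ℂ) ∈ spectrum ℂ A → (μ : ℂ) ∈ essSpectrum A)
    {lam : ℕ+ → ℝ} (hlam : IsEigenvalueSequence T lam)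
    (hspec : spectrum ℂ T = {0} ∪ ⋃ n : ℕ+, {(lam n : ℂ)}) {N : ℕ+} {δ : ℝ}
    (hgap : |lam (N + 1)| + 2 * δ < |lam N|) (hε : 0 < ε) (hεδ : ε < δ / 2) (hηε : η < ε)
    (hηT : (‖T‖ + ε) * η ≤ ε * (2 * δ)) :
    let G : Set ℂ := ⋃ n ∈ Set.Iic N, ball (lam n : ℂ) ε
    (∀ n ≤ N, (essSpectrum A ∩ ball (lam n : ℂ) ε).Nonempty) ∧
      ∀ x ∈ essSpectrum A ∩ G, ∀ y ∈ essSpectrum A \ G, δ ≤ dist x y := by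
  have hlamN : 2 * δ < |lam N| := by linarith [abs_nonneg (lam (N + 1))]
  intro G
  refine ⟨fun n hn => ?_, fun x hx y hy => ?_⟩
  · have hn' : |lam N| ≤ |lam n| := hlam.antitone_abs hn
    have hne : lam n ≠ 0 := abs_pos.1 (by linarith)
    obtain ⟨s, hs, hsd⟩ := exists_mem_spectrum_compress_dist_lt hAs hA hJ hD hne hε
      (hηT.trans_lt (mul_lt_mul_of_pos_left (hlamN.trans_le hn') hε))
      ((hlam.hasEigenvalue_iff (by exact_mod_cast hne)).2 ⟨n, rfl⟩)
    have hsre : s = s.re := hAs.mem_spectrum_eq_re hs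
    have hs0 : s.re ≠ 0 := by
      intro h0
      rw [hsre, h0, Complex.ofReal_zero, dist_zero_left, Complex.norm_real,
        Real.norm_eq_abs] at hsd
      linarith
    refine ⟨s, ?_, hsd⟩
    rw [hsre] at hs ⊢
    exact hess hs0 hs
  · have hx1 : |lam N| - ε ≤ ‖x‖ := by
      obtain ⟨n, hn, hxn⟩ := mem_iUnion₂.1 hx.2
      have hn' : |lam N| ≤ |lam n| := hlam.antitone_abs hn
      rw [mem_ball_iff_norm, norm_sub_rev] at hxn
      have h1 := norm_sub_norm_le (lam n : ℂ) x
      rw [Complex.norm_real, Real.norm_eq_abs] at h1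
      linarith
    have hy1 : ‖y‖ ≤ |lam (N + 1)| + ε := by
      have hys := essSpectrum_subset_spectrum _ hy.1
      have hyre : y = y.re := hAs.mem_spectrum_eq_re hys
      rcases eq_or_ne y.re 0 with h0 | h0
      · rw [hyre, h0, Complex.ofReal_zero, norm_zero]
        positivity
      · rw [hyre] at hys
        obtain ⟨s, hs, hsd⟩ :=
          exists_mem_spectrum_dist_lt_of_mem_spectrum_compress hT hAs hA hJ hD hηε h0 hys
        rw [← hyre, dist_comm] at hsd
        have h1 := norm_sub_norm_le y s
        rw [← dist_eq_norm] at h1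
        have hsN : ‖s‖ ≤ |lam (N + 1)| := by
          rw [hspec] at hs
          rcases hs with hs | hs
          · rw [mem_singleton_iff.1 hs, norm_zero]
            positivity
          · obtain ⟨k, rfl⟩ := mem_iUnion.1 hs
            rw [Complex.norm_real, Real.norm_eq_abs]
            refine hlam.antitone_abs (not_lt.1 fun hk => hy.2 ?_)
            exact mem_iUnion₂.2 ⟨k, PNat.lt_add_one_iff.1 hk, hsd⟩
        linarith
    have h1 := norm_sub_norm_le x y
    rw [← dist_eq_norm] at h1
    linarith

end Operators

end

theorem theorem5p2 (b : ℂ → ℝ) (hb : IsSymbol unitDisc (fun z => (b z : ℂ)))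
    (R : ℝ) (hR : R < 1)
    (hsupp : ∀ᵐ z ∂(volume.restrict (unitDisc : Set ℂ)), R ≤ ‖z‖ → b z = 0)
    (R₀ : ℝ) (hR₀ : 1 / 4 < R₀) (hR₀' : R₀ < 1 / 2) :
    IsCompactOperator (toeplitz unitDisc (fun z => (b z : ℂ)) hb) ∧
    IsSelfAdjoint (toeplitz unitDisc (fun z => (b z : ℂ)) hb) ∧
    (∃ lam : ℕ+ → ℝ, IsEigenvalueSequence (toeplitz unitDisc (fun z => (b z : ℂ)) hb) lam) ∧
    ∀ lam : ℕ+ → ℝ, IsEigenvalueSequence (toeplitz unitDisc (fun z => (b z : ℂ)) hb) lam →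
      spectrum ℂ (toeplitz unitDisc (fun z => (b z : ℂ)) hb) =
        {0} ∪ ⋃ n : ℕ+, {(lam n : ℂ)} ∧
      ∀ (N : ℕ+) (δ : ℝ), 0 < δ → |lam (N + 1)| + 2 * δ < |lam N| →
        ∃ ε₀ > 0, ∀ ε : ℝ, 0 < ε → ε < ε₀ →
          ∃ h : ℝ, 0 < h ∧ h ≤ 1 / 10 ∧ IsPeriodicCell (cell R₀ h) ∧
            SimplyConnectedSpace (periodicDomain (cell R₀ h)) ∧
            ∃ ha : IsSymbol (periodicDomain (cell R₀ h)) (fun z => (periodicSymbol b R₀ z : ℂ)),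
              let S := essSpectrum (toeplitz (periodicDomain (cell R₀ h))
                (fun z => (periodicSymbol b R₀ z : ℂ)) ha)
              let G : Set ℂ := ⋃ n ∈ Set.Iic N, ball (lam n : ℂ) ε
              (∀ n ≤ N, (S ∩ ball (lam n : ℂ) ε).Nonempty) ∧
              ∀ x ∈ S ∩ G, ∀ y ∈ S \ G, δ ≤ dist x y := by
  have hT := isSelfAdjoint_toeplitz hb
  have hK := isCompactOperator_toeplitz_unitDisc hb hR hsupp
  refine ⟨hK, hT, hK.exists_isEigenvalueSequence hT, fun lam hlam => ?_⟩
  have hspec := hlam.spectrum_eq hK not_finiteDimensional_bergman_unitDisc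
  refine ⟨hspec, fun N δ hδ hgap => ⟨δ / 2, by positivity, fun ε hε hεδ => ?_⟩⟩
  have hR0 : 0 < R₀ := by linarith
  -- the admissible size of the defect of the compression
  obtain ⟨η, hη0, hηε, hηT⟩ : ∃ η > 0, η < ε ∧
      (‖toeplitz unitDisc (fun z => (b z : ℂ)) hb‖ + ε) * η ≤ ε * (2 * δ) := by
    refine ⟨min (ε / 2)
      (ε * (2 * δ) / (‖toeplitz unitDisc (fun z => (b z : ℂ)) hb‖ + ε)), by positivity,
      (min_le_left _ _).trans_lt (by linarith), ?_⟩
    rw [← le_div_iff₀' (by positivity)]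
    exact min_le_right _ _
  obtain ⟨h, hdef, hh0, hh⟩ :=
    ((eventually_norm_lpMap_toeplitz_sub_le hR₀ hR₀' hb hR hsupp hη0).and
      (Ioc_mem_nhdsGT (show (0 : ℝ) < 1 / 10 by norm_num))).exists
  set Ω := periodicDomain (cell R₀ h) with hΩdef
  have hmem : ∀ z : ℂ, z ∈ Ω ↔ |z.im| < h ∨ ∃ m : ℤ, ‖z - m‖ < R₀ := fun z =>
    mem_periodicDomain_cell hR0 hR₀' hh0
  have hΩ : ∀ m : ℤ, ball (m : ℂ) R₀ ⊆ Ω := fun m z hz =>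
    (hmem z).2 (Or.inr ⟨m, mem_ball_iff_norm.1 hz⟩)
  have hper : ∀ (k : ℤ) (z : ℂ), z + k ∈ Ω ↔ z ∈ Ω := by
    intro k z
    rw [hmem, hmem, Complex.add_im, Complex.intCast_im, add_zero]
    refine or_congr Iff.rfl ⟨fun ⟨m, hm⟩ => ⟨m - k, ?_⟩, fun ⟨m, hm⟩ => ⟨m + k, ?_⟩⟩
    · push_cast
      rwa [sub_sub_eq_add_sub]
    · push_cast
      rwa [add_sub_add_right_eq_sub]
  have ha : IsSymbol Ω fun z => (periodicSymbol b R₀ z : ℂ) :=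
    isSymbol_periodicSymbol hR0 hR₀' hb Ω
  refine ⟨h, hh0, hh, isPeriodicCell_cell hR0 hR₀' hh0 hh,
    simplyConnectedSpace_periodicDomain_cell hR0 hR₀' hh0, ha, ?_⟩
  have hAs := isSelfAdjoint_toeplitz ha
  exact essSpectrum_inter_nonempty_and_separated hT hAs
    (toeplitz_periodicSymbol_eq_compress hR0 hΩ hR₀' hb ha)
    (norm_restrictDiscs_le hR0 hΩ hR₀') (hdef Ω hΩ (fun z hz => (hmem z).1 hz) hR0)
    (fun hμ => mem_essSpectrum_toeplitz_periodicSymbol hR0 hΩ hR₀' hb ha hper hμ)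
    hlam hspec hgap hε hεδ hηε hηT
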